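/- Let $k$ be a perfect field of characteristic $p>0$ with algebraic closure $\bar k$. A symplectic variety over $k$ is a smooth, geometrically integral $k$-scheme $X$ of finite type such that $X\otimes\bar k$ carries a closed $2$-form $\bar\Omega\in H^0(X\otimes\bar k,\Omega^2_{X\otimes\bar k})$ that is nondegenerate at every point (i.e. induces a nondegenerate alternating form on the tangent space at every point). It is called irreducible symplectic if it is moreover proper over $k$, $\dim_{\bar k}H^1(X\otimes\bar k,\mathcal O_{X\otimes\bar k})=0$ and $\dim_{\bar k}H^0(X\otimes\bar k,\Omega^2_{X\otimes\bar k})=1$. Let $C$ denote the Cartier operator, defined on closed forms as the composite $Z\Omega_X^i\to Z\Omega_X^i/B\Omega_X^i=\mathcal H^i(\Omega_X^\bullet)\to\Omega_X^i$, the second map being the inverse of the Frobenius-linear isomorphism of graded algebras $C^{-1}:\bigoplus_i\Omega_X^i\to\bigoplus_i\mathcal H^i(\Omega_X^\bullet)$ with $C^{-1}(s)=s^p$ and $C^{-1}(ds)=[s^{p-1}ds]$ for local sections $s$ of $\mathcal O_X$. Let $F:X\to X$ be the absolute Frobenius morphism. One says that $X$ is Frobenius split if there is an $\mathcal O_X$-linear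 map $\varphi:F_*\mathcal O_X\to\mathcal O_X$ with $\varphi\circ F^\sharp=\mathrm{id}_{\mathcal O_X}$. Let $X$ be an irreducible symplectic variety over $k$ and let $\Omega\in H^0(X,\Omega_X^2)$ be nonzero. Then $\Omega$ is closed, so that $C(\Omega)\in H^0(X,\Omega^2_X)$ is defined (it is the unique global $2$-form $\eta$ whose image under $C^{-1}$ is the class of $\Omega$), and $C(\Omega)\neq 0$ if and only if $X$ is Frobenius split. -/

import Mathlib

open scoped KaehlerDifferential
open CategoryTheory

set_option linter.unusedSectionVars false

noncomputable section

namespace SymplecticFrobenius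

section Algebra

variable (k A : Type*) [CommRing k] [CommRing A] [Algebra k A]

/-- The graded algebra `⨁ᵢ Ωⁱ_{A/k}` of Kähler differential forms of the `k`-algebra `A`.  Its
degree `i` part is the submodule `⋀[A]^i Ω[A⁄k]`. -/
abbrev DiffForms : Type _ := ExteriorAlgebra A Ω[A⁄k]

variable {k A}

/-- The function `a`, as a form of degree `0`. -/
abbrev fn (a : A) : DiffForms k A := algebraMap A (DiffForms k A) a

/-- The form `da` of degree `1`. -/
def dd (a : A) : DiffForms k A := ExteriorAlgebra.ι A (KaehlerDifferential.D k A a)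

/-- The grading involution: `(-1)^i` in degree `i`. -/
abbrev signInv : DiffForms k A →ₐ[A] DiffForms k A := CliffordAlgebra.involute

theorem DiffForms.ind {P : DiffForms k A → Prop} (hf : ∀ a : A, P (fn a)) (hd : ∀ a : A, P (dd a))
    (hm : ∀ x y, P x → P y → P (x * y)) (ha : ∀ x y, P x → P y → P (x + y)) (x : DiffForms k A) :
    P x := by
  induction x using ExteriorAlgebra.induction with
  | algebraMap r => exact hf r
  | ι m =>
    have : m ∈ Submodule.span A (Set.range (KaehlerDifferential.D k A)) := by
      rw [KaehlerDifferential.span_range_derivation]; trivial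
    induction this using Submodule.span_induction with
    | mem y h => obtain ⟨a, rfl⟩ := h; exact hd a
    | zero => rw [map_zero, ← map_zero (algebraMap A (DiffForms k A))]; exact hf 0
    | add y z _ _ h1 h2 => rw [map_add]; exact ha _ _ h1 h2
    | smul r y _ h => rw [map_smul, Algebra.smul_def]; exact hm _ _ (hf r) h
  | mul a b h1 h2 => exact hm _ _ h1 h2
  | add a b h1 h2 => exact ha _ _ h1 h2

theorem dd_add (a b : A) : (dd (a + b) : DiffForms k A) = dd a + dd b := by simp [dd]

theorem dd_mul (a b : A) : (dd (a * b) : DiffForms k A) = fn a * dd b + fn b * dd a := by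
  simp [dd, Algebra.smul_def]

theorem dd_pow (a : A) (n : ℕ) :
    (dd (a ^ n) : DiffForms k A) = (n : DiffForms k A) * (fn (a ^ (n - 1)) * dd a) := by
  rw [dd, Derivation.leibniz_pow, map_nsmul, map_smul, nsmul_eq_mul, Algebra.smul_def]
  rfl

theorem fn_add (a b : A) : (fn (a + b) : DiffForms k A) = fn a + fn b := map_add _ a b

theorem fn_mul (a b : A) : (fn (a * b) : DiffForms k A) = fn a * fn b := map_mul _ a b

theorem dd_sq (a : A) : (dd a * dd a : DiffForms k A) = 0 := ExteriorAlgebra.ι_sq_zero _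

theorem inv_fn (a : A) : signInv (fn a : DiffForms k A) = fn a := by simp

theorem inv_dd (a : A) : signInv (dd a : DiffForms k A) = - dd a := CliffordAlgebra.involute_ι _

theorem fn_comm (a : A) (x : DiffForms k A) : fn a * x = x * fn a := Algebra.commutes a x

theorem dd_mul_comm (a : A) (x : DiffForms k A) : dd a * x = signInv x * dd a := by
  induction x using DiffForms.ind with
  | hf b => rw [inv_fn, fn_comm]
  | hd b =>
    rw [inv_dd, neg_mul]
    exact eq_neg_of_add_eq_zero_left (ExteriorAlgebra.ι_add_mul_swap _ _)
  | hm x y hx hy => rw [map_mul, mul_assoc, ← hy, ← mul_assoc, hx, mul_assoc]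
  | ha x y hx hy => rw [map_add, add_mul, mul_add, hx, hy]

variable (k A)

/-- The bimodule of forms over the ring of forms, with left action twisted by the sign involution.
A graded derivation is the same thing as a derivation with values in this bimodule. -/
def TwistedForms : Type _ := DiffForms k A

instance : AddCommGroup (TwistedForms k A) := inferInstanceAs (AddCommGroup (DiffForms k A))

instance : Module (DiffForms k A) (TwistedForms k A) :=
  Module.compHom (DiffForms k A) (signInv : DiffForms k A →ₐ[A] DiffForms k A).toRingHom

instance : Module (DiffForms k A)ᵐᵒᵖ (TwistedForms k A) :=
  inferInstanceAs (Module (DiffForms k A)ᵐᵒᵖ (DiffForms k A))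

instance : SMulCommClass (DiffForms k A) (DiffForms k A)ᵐᵒᵖ (TwistedForms k A) :=
  ⟨fun x y m => (mul_assoc (signInv x) (show DiffForms k A from m) y.unop).symm⟩

/-- Square-zero extension; ring maps `x ↦ (x, δ x)` into it are graded derivations `δ`. -/
abbrev SqZeroForms : Type _ := TrivSqZeroExt (DiffForms k A) (TwistedForms k A)

variable {k A}

/-- The element `(x, y)` of the square-zero extension. -/
def sz (x y : DiffForms k A) : SqZeroForms k A := (x, y)

theorem sz_mul (x y x' y' : DiffForms k A) :
    sz x y * sz x' y' = sz (x * x') (signInv x * y' + y * x') := rfl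

theorem sz_add (x y x' y' : DiffForms k A) : sz x y + sz x' y' = sz (x + x') (y + y') := rfl

theorem sz_zero : sz (0 : DiffForms k A) 0 = 0 := rfl

theorem sz_one : sz (1 : DiffForms k A) 0 = 1 := rfl

variable (k A)

/-- The ring map `a ↦ (a, da)`. -/
def szFn : A →+* SqZeroForms k A where
  toFun a := sz (fn a) (dd a)
  map_one' := by rw [← sz_one]; simp [dd]
  map_zero' := by rw [← sz_zero]; simp [dd]
  map_add' a b := by rw [sz_add, dd_add, fn_add]
  map_mul' a b := by rw [sz_mul, dd_mul, fn_mul, inv_fn, fn_comm b (dd a)]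

instance : Algebra A (SqZeroForms k A) :=
  (szFn k A).toAlgebra' fun a x => by
    obtain ⟨x, y, rfl⟩ : ∃ u v, x = sz u v := ⟨x.1, x.2, rfl⟩
    change sz _ _ * sz x y = sz x y * sz _ _
    rw [sz_mul, sz_mul, inv_fn, fn_comm, fn_comm, dd_mul_comm, add_comm]

instance : Algebra k (SqZeroForms k A) :=
  ((szFn k A).comp (algebraMap k A)).toAlgebra' fun r x =>
    Algebra.commutes (algebraMap k A r) x

instance : IsScalarTower k A (SqZeroForms k A) := IsScalarTower.of_algebraMap_eq fun _ => rfl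

variable {k A}

theorem smul_sz (a : A) (x y : DiffForms k A) :
    a • sz x y = sz (fn a * x) (fn a * y + dd a * x) := by
  rw [Algebra.smul_def]
  change sz _ _ * _ = _
  rw [sz_mul, inv_fn]

variable (k A)

/-- The derivation `b ↦ (db, 0)`. -/
def szDer : Derivation k A (SqZeroForms k A) where
  toFun b := sz (dd b) 0
  map_add' a b := by rw [dd_add, sz_add, add_zero]
  map_smul' r b := by
    have h : (dd (algebraMap k A r) : DiffForms k A) = 0 := by simp [dd]
    rw [RingHom.id_apply, Algebra.smul_def, ← algebraMap_smul A r (sz (dd b) 0), smul_sz, dd_mul, h]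
    simp
  map_one_eq_zero' := by
    change sz _ _ = _
    rw [← sz_zero]; simp [dd]
  leibniz' a b := by
    change sz _ _ = a • sz _ _ + b • sz _ _
    rw [smul_sz, smul_sz, sz_add, dd_mul, dd_mul_comm a, inv_dd]
    simp

theorem szDer_sq (m : Ω[A⁄k]) :
    (szDer k A).liftKaehlerDifferential m * (szDer k A).liftKaehlerDifferential m = 0 := by
  have key : ∃ y : DiffForms k A, (∀ z : DiffForms k A, y * z = z * y) ∧
      (szDer k A).liftKaehlerDifferential m = sz (ExteriorAlgebra.ι A m) y := by
    have : m ∈ Submodule.span A (Set.range (KaehlerDifferential.D k A)) := by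
      rw [KaehlerDifferential.span_range_derivation]; trivial
    induction this using Submodule.span_induction with
    | mem y h =>
      obtain ⟨a, rfl⟩ := h
      exact ⟨0, by simp, by rw [Derivation.liftKaehlerDifferential_comp_D]; rfl⟩
    | zero => exact ⟨0, by simp, by rw [map_zero, map_zero, sz_zero]⟩
    | add y z _ _ h1 h2 =>
      obtain ⟨u, hu, hu'⟩ := h1
      obtain ⟨v, hv, hv'⟩ := h2
      exact ⟨u + v, fun z => by rw [add_mul, mul_add, hu, hv],
        by rw [map_add, hu', hv', sz_add, map_add]⟩
    | smul r y _ h =>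
      obtain ⟨u, hu, hu'⟩ := h
      refine ⟨fn r * u + dd r * ExteriorAlgebra.ι A y, fun z => ?_, by
        rw [map_smul, hu', smul_sz, map_smul, Algebra.smul_def]⟩
      have h1 : ∀ (m : Ω[A⁄k]) (x : DiffForms k A),
          ExteriorAlgebra.ι A m * x = signInv x * ExteriorAlgebra.ι A m := by
        intro m x
        have : m ∈ Submodule.span A (Set.range (KaehlerDifferential.D k A)) := by
          rw [KaehlerDifferential.span_range_derivation]; trivial
        induction this using Submodule.span_induction with
        | mem y h => obtain ⟨a, rfl⟩ := h; exact dd_mul_comm a x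
        | zero => simp
        | add y z _ _ h1 h2 => rw [map_add, add_mul, mul_add, h1, h2]
        | smul r y _ h => rw [map_smul, smul_mul_assoc, mul_smul_comm, h]
      have h2 : dd r * ExteriorAlgebra.ι A y * z = z * (dd r * ExteriorAlgebra.ι A y) := by
        rw [mul_assoc, h1, ← mul_assoc, dd_mul_comm, ← mul_assoc]
        exact congrArg (fun t => t * dd r * ExteriorAlgebra.ι A y)
          (CliffordAlgebra.involute_involute z)
      rw [add_mul, mul_add, h2, mul_assoc, hu, ← mul_assoc, fn_comm, mul_assoc]
  obtain ⟨y, hy, h⟩ := key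
  rw [h, sz_mul, ExteriorAlgebra.ι_sq_zero, hy, ← add_mul, ← sz_zero]
  congr 1
  rw [show signInv (ExteriorAlgebra.ι A m) = - ExteriorAlgebra.ι A m from CliffordAlgebra.involute_ι _]
  simp

/-- The algebra map `x ↦ (x, dx)`. -/
def szLift : DiffForms k A →ₐ[A] SqZeroForms k A :=
  ExteriorAlgebra.lift A ⟨(szDer k A).liftKaehlerDifferential, szDer_sq k A⟩

/-- The exterior derivative on Kähler forms.  It is the unique additive map with
`d (a) = da`, `d (db) = 0` and `d (x y) = dx · y + (-1)^{deg x} x · dy`. -/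
def extd : DiffForms k A →+ DiffForms k A where
  toFun x := (szLift k A x).snd
  map_zero' := by rw [map_zero]; rfl
  map_add' x y := by rw [map_add]; rfl

variable {k A}

theorem szLift_fn (a : A) : szLift k A (fn a) = sz (fn a) (dd a) := AlgHom.commutes _ a

theorem szLift_dd (a : A) : szLift k A (dd a) = sz (dd a) 0 := by
  rw [szLift, dd, ExteriorAlgebra.lift_ι_apply, Derivation.liftKaehlerDifferential_comp_D]; rfl

theorem szLift_fst (x : DiffForms k A) : (szLift k A x).fst = x := by
  induction x using DiffForms.ind with
  | hf a => rw [szLift_fn]; rfl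
  | hd a => rw [szLift_dd]; rfl
  | hm x y hx hy => rw [map_mul, TrivSqZeroExt.fst_mul, hx, hy]
  | ha x y hx hy => rw [map_add, TrivSqZeroExt.fst_add, hx, hy]

theorem extd_fn (a : A) : extd k A (fn a) = dd a := by
  change (szLift k A (fn a)).snd = _
  rw [szLift_fn]; rfl

theorem extd_dd (a : A) : extd k A (dd a) = 0 := by
  change (szLift k A (dd a)).snd = _
  rw [szLift_dd]; rfl

theorem extd_mul (x y : DiffForms k A) :
    extd k A (x * y) = extd k A x * y + signInv x * extd k A y := by
  have h (x : DiffForms k A) : szLift k A x = sz x (extd k A x) :=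
    TrivSqZeroExt.ext (szLift_fst x) rfl
  change (szLift k A (x * y)).snd = _
  rw [map_mul, h, h, sz_mul, add_comm]; rfl

theorem extd_inv (x : DiffForms k A) : extd k A (signInv x) = - signInv (extd k A x) := by
  induction x using DiffForms.ind with
  | hf a => rw [inv_fn, extd_fn, inv_dd, neg_neg]
  | hd a => rw [inv_dd, map_neg, extd_dd, map_zero]
  | hm x y hx hy => simp only [map_mul, extd_mul, map_add, hx, hy, neg_mul, mul_neg, neg_add]
  | ha x y hx hy => simp only [map_add, hx, hy, neg_add]

theorem extd_extd (x : DiffForms k A) : extd k A (extd k A x) = 0 := by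
  induction x using DiffForms.ind with
  | hf a => rw [extd_fn, extd_dd]
  | hd a => rw [extd_dd, map_zero]
  | hm x y hx hy => simp [extd_mul, extd_inv, hx, hy]
  | ha x y hx hy => simp only [map_add, hx, hy, add_zero]

variable (k A)

/-- The ring `ZΩ^• = ker d` of closed forms. -/
def closedForms : Subring (DiffForms k A) where
  carrier := {x | extd k A x = 0}
  mul_mem' {x y} hx hy := by
    change extd k A _ = 0
    rw [extd_mul, show extd k A x = 0 from hx, show extd k A y = 0 from hy]; simp
  one_mem' := by
    change extd k A _ = 0
    rw [← map_one (algebraMap A (DiffForms k A)), extd_fn]; simp [dd]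
  add_mem' {x y} hx hy := by
    change extd k A _ = 0
    rw [map_add, show extd k A x = 0 from hx, show extd k A y = 0 from hy, add_zero]
  zero_mem' := map_zero _
  neg_mem' {x} hx := by
    change extd k A _ = 0
    rw [map_neg, show extd k A x = 0 from hx, neg_zero]

/-- The ideal `BΩ^• = d Ω^•` of exact forms in the ring of closed forms. -/
def exactForms : Ideal (closedForms k A) where
  carrier := {z | ∃ y, extd k A y = z}
  zero_mem' := ⟨0, map_zero _⟩
  add_mem' := by
    rintro a b ⟨y, hy⟩ ⟨z, hz⟩
    exact ⟨y + z, by rw [map_add, hy, hz]; rfl⟩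
  smul_mem' := by
    rintro z a ⟨y, hy⟩
    refine ⟨signInv z.1 * y, ?_⟩
    rw [extd_mul, extd_inv, show extd k A z = 0 from z.2, hy]
    simp only [map_zero, neg_zero, zero_mul, zero_add]
    exact congrArg (· * _) (CliffordAlgebra.involute_involute z.1)

instance : (exactForms k A).IsTwoSided where
  mul_mem_of_left := by
    rintro a z ⟨y, hy⟩
    refine ⟨y * z.1, ?_⟩
    rw [extd_mul, show extd k A z = 0 from z.2, hy, mul_zero, add_zero]; rfl

/-- The algebraic de Rham cohomology algebra `⨁ᵢ Hⁱ(Ω^•_{A/k}) = ZΩ^•/BΩ^•`. -/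
abbrev DeRhamCohomology : Type _ := closedForms k A ⧸ exactForms k A

variable {k A}

/-- The de Rham cohomology class of a closed form. -/
def deRhamClass (z : DiffForms k A) (hz : extd k A z = 0) : DeRhamCohomology k A :=
  Ideal.Quotient.mk (exactForms k A) ⟨z, hz⟩

theorem deRhamClass_eq {z w : DiffForms k A} (hz : extd k A z = 0) (hw : extd k A w = 0)
    (y : DiffForms k A) (h : extd k A y = z - w) : deRhamClass z hz = deRhamClass w hw :=
  Ideal.Quotient.eq.2 ⟨y, h⟩

theorem natCast_eq_zero (k A : Type*) [CommRing k] [CommRing A] [Algebra k A] (p : ℕ) [CharP k p] :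
    (p : A) = 0 := by
  rw [← map_natCast (algebraMap k A), CharP.cast_eq_zero, map_zero]

section Cartier

variable (k A) (p : ℕ) [hp : Fact p.Prime] [CharP k p]

/-- The `p`-th power map of a `k`-algebra, `k` of characteristic `p`. -/
def powHom : A →+* A where
  toFun a := a ^ p
  map_one' := one_pow p
  map_zero' := zero_pow hp.out.ne_zero
  map_mul' a b := mul_pow a b p
  map_add' a b := by
    cases subsingleton_or_nontrivial A
    · exact Subsingleton.elim _ _
    · have : CharP A p := (CharP.charP_iff_prime_eq_zero hp.out).2 (natCast_eq_zero k A p)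
      exact add_pow_char a b p

theorem extd_pow (a : A) : extd k A (fn (a ^ p)) = 0 := by
  rw [extd_fn, dd_pow, ← map_natCast (algebraMap A (DiffForms k A)), natCast_eq_zero k A p]
  simp

theorem extd_pow_dd (a : A) : extd k A (fn (a ^ (p - 1)) * dd a) = 0 := by
  rw [extd_mul, extd_dd, extd_fn, dd_pow, mul_assoc, mul_assoc, dd_sq]; simp

/-- The ring map `a ↦ [a^p]` to de Rham cohomology. -/
def frobClass : A →+* DeRhamCohomology k A where
  toFun a := deRhamClass (fn (a ^ p)) (extd_pow k A p a)
  map_one' := by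
    simp only [one_pow, map_one]; rfl
  map_zero' := by
    simp only [zero_pow hp.out.ne_zero, map_zero]; rfl
  map_mul' a b := by
    simp only [mul_pow, map_mul]; rfl
  map_add' a b := by
    simp only [show (a + b) ^ p = a ^ p + b ^ p from (powHom k A p).map_add a b, map_add]; rfl

/-- De Rham cohomology is an `A`-algebra through the Frobenius of `A`. -/
@[reducible] def frobAlgebra : Algebra A (DeRhamCohomology k A) :=
  (frobClass k A p).toAlgebra' fun a x => by
    obtain ⟨⟨x, hx⟩, rfl⟩ := Ideal.Quotient.mk_surjective x
    change Ideal.Quotient.mk _ _ * _ = _ * Ideal.Quotient.mk _ _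
    rw [← map_mul, ← map_mul]
    congr 1
    exact Subtype.ext (fn_comm _ _)

/-- De Rham cohomology is a `k`-algebra through the Frobenius of `k`. -/
@[reducible] def frobBaseAlgebra : Algebra k (DeRhamCohomology k A) :=
  letI := frobAlgebra k A p
  ((frobClass k A p).comp (algebraMap k A)).toAlgebra' fun a x =>
    Algebra.commutes (algebraMap k A a) x


/-- The class of `b^{p-1} db`. -/
def cartierClass (b : A) : DeRhamCohomology k A :=
  deRhamClass (fn (b ^ (p - 1)) * dd b) (extd_pow_dd k A p b)

variable {A} in
/-- `d(((a+b)^p - a^p - b^p)/p) = (a+b)^{p-1} d(a+b) - a^{p-1} da - b^{p-1} db`. -/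
theorem exists_extd_eq (a b : A) : ∃ y : DiffForms k A, extd k A y =
    fn ((a + b) ^ (p - 1)) * dd (a + b) - (fn (a ^ (p - 1)) * dd a + fn (b ^ (p - 1)) * dd b) := by
  obtain ⟨n, rfl⟩ : ∃ n, p = n + 1 := ⟨p - 1, (Nat.succ_pred hp.out.ne_zero).symm⟩
  rw [Nat.add_sub_cancel]
  have hc : ∀ j < n, ∃ c : ℕ, c * (j + 1) = n.choose j ∧ c * (n - j) = n.choose (j + 1) := by
    intro j hj
    obtain ⟨c, hc⟩ := hp.out.dvd_choose_self (k := j + 1) (by omega) (by omega)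
    refine ⟨c, ?_, ?_⟩
    · have := Nat.add_one_mul_choose_eq n j
      rw [hc, mul_assoc] at this
      exact (Nat.eq_of_mul_eq_mul_left (Nat.succ_pos n) this).symm
    · have := Nat.choose_mul_succ_eq n (j + 1)
      rw [hc, mul_comm, mul_assoc, Nat.add_sub_add_right] at this
      exact (Nat.eq_of_mul_eq_mul_left (Nat.succ_pos n) this).symm
  choose! c hc1 hc2 using hc
  have hA : ∑ j ∈ Finset.range n, a ^ j * b ^ (n - j) * (n.choose j : A) = (a + b) ^ n - a ^ n := by
    rw [add_pow, Finset.sum_range_succ]; simp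
  have hB : ∑ j ∈ Finset.range n, a ^ (j + 1) * b ^ (n - (j + 1)) * (n.choose (j + 1) : A) =
      (a + b) ^ n - b ^ n := by
    rw [add_pow, Finset.sum_range_succ']; simp
  have hD : KaehlerDifferential.D k A
      (∑ j ∈ Finset.range n, (c j : A) * (a ^ (j + 1) * b ^ (n - j))) =
      ((a + b) ^ n - a ^ n) • KaehlerDifferential.D k A a +
        ((a + b) ^ n - b ^ n) • KaehlerDifferential.D k A b := by
    rw [← hA, ← hB, Finset.sum_smul, Finset.sum_smul, ← Finset.sum_add_distrib, map_sum]
    refine Finset.sum_congr rfl fun j hj => ?_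
    have hj := Finset.mem_range.1 hj
    rw [← hc1 j hj, ← hc2 j hj, show n - (j + 1) = n - j - 1 by omega]
    simp only [Derivation.leibniz, Derivation.leibniz_pow, Derivation.map_natCast,
      ← Nat.cast_smul_eq_nsmul A, Nat.add_sub_cancel]
    push_cast
    module
  refine ⟨fn (∑ j ∈ Finset.range n, (c j : A) * (a ^ (j + 1) * b ^ (n - j))), ?_⟩
  rw [extd_fn, dd, hD, map_add, map_smul, map_smul, Algebra.smul_def, Algebra.smul_def, dd_add]
  change (algebraMap A (DiffForms k A) _) * dd a + (algebraMap A (DiffForms k A) _) * dd b = _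
  rw [map_sub, map_sub, mul_add, sub_mul, sub_mul]
  abel

/-- The derivation `b ↦ [b^{p-1} db]`, for the Frobenius module structures. -/
def cartierDer :
    letI := frobAlgebra k A p
    letI := frobBaseAlgebra k A p
    Derivation k A (DeRhamCohomology k A) :=
  letI := frobAlgebra k A p
  letI := frobBaseAlgebra k A p
  { toFun := cartierClass k A p
    map_add' := fun a b => by
      obtain ⟨y, hy⟩ := exists_extd_eq k p a b
      exact deRhamClass_eq _ ((closedForms k A).add_mem (extd_pow_dd k A p a)
        (extd_pow_dd k A p b)) y hy
    map_smul' := fun r b => by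
      have h : (dd (algebraMap k A r) : DiffForms k A) = 0 := by simp [dd]
      change Ideal.Quotient.mk _ _ = Ideal.Quotient.mk _ _ * Ideal.Quotient.mk _ _
      rw [← map_mul]
      congr 1
      refine Subtype.ext ?_
      change fn ((r • b) ^ (p - 1)) * dd (r • b) =
        fn ((algebraMap k A r) ^ p) * (fn (b ^ (p - 1)) * dd b)
      rw [Algebra.smul_def, dd_mul, h, mul_zero, add_zero, ← mul_assoc, ← mul_assoc, ← fn_mul,
        ← fn_mul]
      congr 2
      obtain ⟨n, rfl⟩ : ∃ n, p = n + 1 := ⟨p - 1, (Nat.succ_pred hp.out.ne_zero).symm⟩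
      rw [Nat.add_sub_cancel]; ring
    map_one_eq_zero' := by
      change Ideal.Quotient.mk _ _ = 0
      rw [← map_zero (Ideal.Quotient.mk _)]
      congr 1
      refine Subtype.ext ?_
      change fn (1 ^ (p - 1)) * dd 1 = 0
      simp [dd]
    leibniz' := fun a b => by
      change Ideal.Quotient.mk _ _ = Ideal.Quotient.mk _ _ * Ideal.Quotient.mk _ _ +
        Ideal.Quotient.mk _ _ * Ideal.Quotient.mk _ _
      rw [← map_mul, ← map_mul, ← map_add]
      congr 1
      refine Subtype.ext ?_
      change fn ((a * b) ^ (p - 1)) * dd (a * b) =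
        fn (a ^ p) * (fn (b ^ (p - 1)) * dd b) + fn (b ^ p) * (fn (a ^ (p - 1)) * dd a)
      rw [dd_mul, mul_add]
      simp only [← mul_assoc, ← fn_mul]
      obtain ⟨n, rfl⟩ : ∃ n, p = n + 1 := ⟨p - 1, (Nat.succ_pred hp.out.ne_zero).symm⟩
      rw [Nat.add_sub_cancel]
      congr 3 <;> ring }

theorem cartierDer_sq (m : Ω[A⁄k]) :
    letI := frobAlgebra k A p
    letI := frobBaseAlgebra k A p
    letI : IsScalarTower k A (DeRhamCohomology k A) := IsScalarTower.of_algebraMap_eq fun _ => rfl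
    (cartierDer k A p).liftKaehlerDifferential m *
      (cartierDer k A p).liftKaehlerDifferential m = 0 := by
  let := frobAlgebra k A p
  let := frobBaseAlgebra k A p
  have : IsScalarTower k A (DeRhamCohomology k A) := IsScalarTower.of_algebraMap_eq fun _ => rfl
  let L := (cartierDer k A p).liftKaehlerDifferential
  have key (m : Ω[A⁄k]) : ∃ (w : Ω[A⁄k]) (h : extd k A (ExteriorAlgebra.ι A w) = 0),
      L m = deRhamClass (ExteriorAlgebra.ι A w) h := by
    have : m ∈ Submodule.span A (Set.range (KaehlerDifferential.D k A)) := by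
      rw [KaehlerDifferential.span_range_derivation]; trivial
    induction this using Submodule.span_induction with
    | mem y h =>
      obtain ⟨a, rfl⟩ := h
      have e : ExteriorAlgebra.ι A (a ^ (p - 1) • KaehlerDifferential.D k A a) =
          fn (a ^ (p - 1)) * dd a := by rw [map_smul, Algebra.smul_def]; rfl
      refine ⟨a ^ (p - 1) • KaehlerDifferential.D k A a, by rw [e]; exact extd_pow_dd k A p a, ?_⟩
      simp only [L, e, Derivation.liftKaehlerDifferential_comp_D]
      rfl
    | zero => exact ⟨0, by simp, by simp only [map_zero]; rfl⟩
    | add y z _ _ h1 h2 =>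
      obtain ⟨u, hu, hu'⟩ := h1
      obtain ⟨v, hv, hv'⟩ := h2
      refine ⟨u + v, by rw [map_add, map_add, hu, hv, add_zero], ?_⟩
      simp only [map_add, hu', hv']
      rfl
    | smul r y _ h =>
      obtain ⟨u, hu, hu'⟩ := h
      have e : ExteriorAlgebra.ι A (r ^ p • u) = fn (r ^ p) * ExteriorAlgebra.ι A u := by
        rw [map_smul, Algebra.smul_def]
      refine ⟨r ^ p • u, by rw [e, extd_mul, extd_pow, hu, zero_mul, mul_zero, add_zero], ?_⟩
      simp only [map_smul, hu', e]
      rfl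
  obtain ⟨w, h, e⟩ := key m
  change L m * L m = 0
  rw [e]
  change Ideal.Quotient.mk _ _ * Ideal.Quotient.mk _ _ = 0
  rw [← map_mul, ← map_zero (Ideal.Quotient.mk _)]
  congr 1
  exact Subtype.ext (ExteriorAlgebra.ι_sq_zero w)

/-- The inverse Cartier operator `C⁻¹ : ⨁ᵢ Ωⁱ → ⨁ᵢ Hⁱ(Ω^•)`: the ring homomorphism with
`C⁻¹(s) = s^p` and `C⁻¹(ds) = [s^{p-1} ds]` for `s` in `A`. -/
def invCartier : DiffForms k A →+* DeRhamCohomology k A :=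
  letI := frobAlgebra k A p
  letI := frobBaseAlgebra k A p
  letI : IsScalarTower k A (DeRhamCohomology k A) := IsScalarTower.of_algebraMap_eq fun _ => rfl
  (ExteriorAlgebra.lift A
    ⟨(cartierDer k A p).liftKaehlerDifferential, cartierDer_sq k A p⟩).toRingHom

variable {A}

theorem invCartier_fn (s : A) :
    invCartier k A p (fn s) = deRhamClass (fn (s ^ p)) (extd_pow k A p s) :=
  letI := frobAlgebra k A p
  AlgHom.commutes (ExteriorAlgebra.lift A (A := DeRhamCohomology k A) _) s

theorem invCartier_dd (s : A) : invCartier k A p (dd s) =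
    deRhamClass (fn (s ^ (p - 1)) * dd s) (extd_pow_dd k A p s) := by
  let := frobAlgebra k A p
  let := frobBaseAlgebra k A p
  have : IsScalarTower k A (DeRhamCohomology k A) := IsScalarTower.of_algebraMap_eq fun _ => rfl
  refine (ExteriorAlgebra.lift_ι_apply A _ (cartierDer_sq k A p) _).trans ?_
  rw [Derivation.liftKaehlerDifferential_comp_D]
  rfl

end Cartier

section Functoriality

variable {B : Type*} [CommRing B] [Algebra k B]

/-- Pullback of differential forms along a homomorphism `φ : A → B` of `k`-algebras: the ring
homomorphism with `a ↦ φ a` and `da ↦ d(φ a)`. -/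
def pullForms (φ : A →ₐ[k] B) : DiffForms k A →+* DiffForms k B :=
  letI := φ.toRingHom.toAlgebra
  haveI : IsScalarTower k A B := IsScalarTower.of_algebraMap_eq fun r => (φ.commutes r).symm
  (ExteriorAlgebra.lift A ⟨((ExteriorAlgebra.ι B).restrictScalars A).comp
    (KaehlerDifferential.map k k A B), fun _ => ExteriorAlgebra.ι_sq_zero _⟩).toRingHom

theorem pullForms_fn (φ : A →ₐ[k] B) (a : A) : pullForms φ (fn a) = fn (φ a) :=
  letI := φ.toRingHom.toAlgebra
  AlgHom.commutes (ExteriorAlgebra.lift A (A := DiffForms k B) _) a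

theorem pullForms_dd (φ : A →ₐ[k] B) (a : A) : pullForms φ (dd a) = dd (φ a) := by
  let := φ.toRingHom.toAlgebra
  have : IsScalarTower k A B := IsScalarTower.of_algebraMap_eq fun r => (φ.commutes r).symm
  have h : (ExteriorAlgebra.ι B).restrictScalars A (KaehlerDifferential.map k k A B
      (KaehlerDifferential.D k A a)) = (dd (φ a) : DiffForms k B) := by
    rw [KaehlerDifferential.map_D]; rfl
  rw [← h]
  exact ExteriorAlgebra.lift_ι_apply A (A := DiffForms k B)
    (((ExteriorAlgebra.ι B).restrictScalars A).comp (KaehlerDifferential.map k k A B))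
    (fun _ => ExteriorAlgebra.ι_sq_zero _) (KaehlerDifferential.D k A a)

theorem pullForms_smul (φ : A →ₐ[k] B) (r : k) (x : DiffForms k A) :
    pullForms φ (r • x) = r • pullForms φ x := by
  rw [← algebraMap_smul A r x, Algebra.smul_def, map_mul, pullForms_fn, φ.commutes,
    ← Algebra.smul_def, algebraMap_smul]

end Functoriality

section Nondegenerate

variable {K : Type*} [CommRing K] [Algebra A K]

/-- The value in `K` of a `2`-form at a pair of `K`-valued tangent vectors, that is, of `A`-linear
maps `Ω_{A/k} → K`: the linear map with `x ∧ y ↦ θ₁ x · θ₂ y - θ₁ y · θ₂ x`. -/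
def evalTwoForm (θ₁ θ₂ : Ω[A⁄k] →ₗ[A] K) : ⋀[A]^2 Ω[A⁄k] →ₗ[A] K :=
  exteriorPower.alternatingMapLinearEquiv
    (MultilinearMap.alternatization
      ((MultilinearMap.mkPiAlgebra A (Fin 2) K).compLinearMap ![θ₁, θ₂]))

theorem evalTwoForm_apply (θ₁ θ₂ : Ω[A⁄k] →ₗ[A] K) (x y : Ω[A⁄k]) :
    evalTwoForm θ₁ θ₂ (exteriorPower.ιMulti A 2 ![x, y]) = θ₁ x * θ₂ y - θ₁ y * θ₂ x := by
  rw [evalTwoForm, exteriorPower.alternatingMapLinearEquiv_apply_ιMulti,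
    MultilinearMap.alternatization_apply,
    show (Finset.univ : Finset (Equiv.Perm (Fin 2))) = {1, Equiv.swap 0 1} by decide,
    Finset.sum_pair (by decide)]
  simp [sub_eq_add_neg]

/-- The `2`-form `ω` is nondegenerate at every point of `Spec A`: for every prime `𝔭` of `A` the
alternating form defined by `ω` on the tangent space `Hom_A(Ω_{A/k}, κ(𝔭))` is nondegenerate. -/
def IsNondegenerate (ω : ⋀[A]^2 Ω[A⁄k]) : Prop :=
  ∀ 𝔭 : PrimeSpectrum A, ∀ θ₁ : Ω[A⁄k] →ₗ[A] 𝔭.asIdeal.ResidueField,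
    (∀ θ₂ : Ω[A⁄k] →ₗ[A] 𝔭.asIdeal.ResidueField, evalTwoForm θ₁ θ₂ ω = 0) → θ₁ = 0

end Nondegenerate

end Algebra
section Geometry

open CategoryTheory AlgebraicGeometry Opposite

universe u

variable {k : Type u} [Field k] {X : Scheme.{u}} (f : X ⟶ Spec (CommRingCat.of k))

/-- The ring `𝒪_X(U)`, regarded as a `k`-algebra through the structure morphism `f`. -/
def Sections (_f : X ⟶ Spec (CommRingCat.of k)) (U : X.Opens) : Type u := Γ(X, U)

instance (U : X.Opens) : CommRing (Sections f U) := inferInstanceAs (CommRing Γ(X, U))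

/-- The ring map `k → 𝒪_X(U)` given by the structure morphism. -/
def structureMap (U : X.Opens) : CommRingCat.of k ⟶ Γ(X, U) :=
  (Scheme.ΓSpecIso (CommRingCat.of k)).inv ≫ f.appTop ≫ X.presheaf.map (homOfLE le_top).op

instance (U : X.Opens) : Algebra k (Sections f U) :=
  RingHom.toAlgebra (S := Γ(X, U)) (structureMap f U).hom

theorem structureMap_res {U V : X.Opens} (h : U ≤ V) :
    structureMap f V ≫ X.presheaf.map (homOfLE h).op = structureMap f U := by
  simp only [structureMap, Category.assoc, ← Functor.map_comp]
  rfl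

/-- Restriction of functions from `V` to `U ⊆ V`. -/
def resSections {U V : X.Opens} (h : U ≤ V) : Sections f V →ₐ[k] Sections f U where
  __ := (X.presheaf.map (homOfLE h).op).hom
  commutes' r := by
    exact congrArg (fun g => g.hom r) (structureMap_res f h)

/-- The space `H⁰(X, Ωⁱ_{X/k})`.  The sheaf `Ωⁱ_{X/k}` is quasi-coherent with sections
`⋀ⁱ Ω_{𝒪(V)/k}` on every affine open `V`, so a global section is a family of such forms, one for
each affine open, compatible with restriction. -/
def globalForms (i : ℕ) : Submodule k (∀ V : X.affineOpens, DiffForms k (Sections f V)) where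
  carrier := {ω | (∀ V : X.affineOpens, ω V ∈ ⋀[Sections f V]^i Ω[Sections f V⁄k]) ∧
    ∀ (V W : X.affineOpens) (h : (V : X.Opens) ≤ W), pullForms (resSections f h) (ω W) = ω V}
  add_mem' {a b} ha hb := ⟨fun V => Submodule.add_mem _ (ha.1 V) (hb.1 V), fun V W h => by
    rw [Pi.add_apply, Pi.add_apply, map_add, ha.2 V W h, hb.2 V W h]⟩
  zero_mem' := ⟨fun V => Submodule.zero_mem _, fun V W h => map_zero _⟩
  smul_mem' r a ha := ⟨fun V => by
      rw [Pi.smul_apply, ← algebraMap_smul (Sections f V) r (a V)]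
      exact Submodule.smul_mem _ _ (ha.1 V),
    fun V W h => by rw [Pi.smul_apply, Pi.smul_apply, pullForms_smul, ha.2 V W h]⟩

variable {f} in
/-- The restriction of a global `i`-form to an affine open. -/
def formOn {i : ℕ} (ω : globalForms f i) (V : X.affineOpens) :
    ⋀[Sections f V]^i Ω[Sections f V⁄k] := ⟨ω.1 V, ω.2.1 V⟩

variable {f} in
/-- The global form `ω` is closed. -/
def IsClosedForm {i : ℕ} (ω : globalForms f i) : Prop :=
  ∀ V : X.affineOpens, extd k (Sections f V) (formOn ω V) = 0

variable {f} in
/-- The global `2`-form `ω` is nondegenerate at every point of `X`. -/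
def IsNondegenerateForm (ω : globalForms f 2) : Prop :=
  ∀ V : X.affineOpens, IsNondegenerate (formOn ω V)

/-- The cohomology group `H^n(X, 𝒪_X)` of the sheaf of abelian groups `𝒪_X` for the Zariski
topology. -/
def StructureSheafCohomology (X : Scheme.{u}) (n : ℕ) : Type u :=
  have : HasExt.{u} (Sheaf (Opens.grothendieckTopology X) AddCommGrpCat.{u}) :=
    hasExt_of_enoughInjectives _
  Sheaf.H ((sheafCompose (Opens.grothendieckTopology X)
    (forget₂ CommRingCat.{u} RingCat.{u} ⋙ forget₂ RingCat.{u} AddCommGrpCat.{u})).obj X.sheaf) n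

/-- The structure morphism of `X ⊗ k̄` over `k̄`. -/
abbrev geometricBaseChange : Limits.pullback f
    (Spec.map (CommRingCat.ofHom (algebraMap k (AlgebraicClosure k)))) ⟶
      Spec (CommRingCat.of (AlgebraicClosure k)) :=
  Limits.pullback.snd _ _

/-- Symplectic varieties over `k`: smooth geometrically integral schemes of finite type that
carry, over `k̄`, a closed `2`-form that is nondegenerate at every point. -/
structure IsSymplectic : Prop where
  smooth : Smooth f
  quasiCompact : QuasiCompact f
  geometricallyIntegral : GeometricallyIntegral f
  exists_form : ∃ ω : globalForms (geometricBaseChange f) 2,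
    IsClosedForm ω ∧ IsNondegenerateForm ω

/-- Irreducible symplectic varieties over `k`: proper symplectic varieties with
`dim H¹(X ⊗ k̄, 𝒪) = 0` (that is, this group is trivial) and `dim H⁰(X ⊗ k̄, Ω²) = 1`. -/
structure IsIrreducibleSymplectic : Prop extends IsSymplectic f where
  proper : IsProper f
  h1_eq_zero : Subsingleton (StructureSheafCohomology (Limits.pullback f
    (Spec.map (CommRingCat.ofHom (algebraMap k (AlgebraicClosure k))))) 1)
  finrank_forms : Module.finrank (AlgebraicClosure k) (globalForms (geometricBaseChange f) 2) = 1

variable (p : ℕ) [hp : Fact p.Prime] [CharP k p]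

variable {f} in
/-- `C(ω) = η`, where `C` is the Cartier operator: `ω` is closed and `η` is the form that
`C⁻¹ : Ωⁱ → Hⁱ(Ω^•)` maps to the class of `ω`.  As `d` is linear over `p`-th powers, the cohomology
sheaf `Hⁱ(Ω^•)` is quasi-coherent for the Frobenius module structure and its sections on an affine
open are the cohomology of the complex of sections. -/
def IsCartierImage {i : ℕ} (ω η : globalForms f i) : Prop :=
  ∀ V : X.affineOpens, ∃ h : extd k (Sections f V) (formOn ω V) = 0,
    invCartier k (Sections f V) p (formOn η V) = deRhamClass _ h

/-- The identity on the underlying space and `s ↦ s^p` on functions. -/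
def absFrobeniusAux : X.toPresheafedSpace ⟶ X.toPresheafedSpace where
  base := 𝟙 _
  c :=
    { app := fun U => CommRingCat.ofHom (powHom k (Sections f U.unop) p)
      naturality := fun U V i => by
        ext s
        exact (map_pow (X.presheaf.map i).hom s p).symm }

/-- The absolute Frobenius of a scheme over a field of characteristic `p`: the identity on the
underlying space and `s ↦ s^p` on functions. -/
def absFrobenius : X ⟶ X :=
  ⟨absFrobeniusAux f p, fun x => by
    constructor
    intro a ha
    obtain ⟨U, hx, s, rfl⟩ := TopCat.Presheaf.exists_germ_eq X.presheaf a
    have h1 := PresheafedSpace.stalkMap_germ_apply (absFrobeniusAux f p) U x hx s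
    have h2 : X.presheaf.germ U x hx ((show Γ(X, U) from s) ^ p) =
        (X.presheaf.germ U x hx (show Γ(X, U) from s)) ^ p := map_pow _ _ _
    have h3 : IsUnit (X.presheaf.germ U x hx ((show Γ(X, U) from s) ^ p)) := by
      have h4 := h1 ▸ ha
      exact h4
    rw [h2, isUnit_pow_iff hp.out.ne_zero] at h3
    exact h3⟩

theorem absFrobenius_app (U : X.Opens) (s : Γ(X, U)) :
    (absFrobenius f p).app U s = (show Γ(X, U) from s) ^ p := rfl

/-- The map `F^♯ : 𝒪_X → F_* 𝒪_X` splits as a homomorphism of `𝒪_X`-modules: there is a map of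
sheaves `φ : F_* 𝒪_X → 𝒪_X` that is `𝒪_X`-linear and satisfies `φ ∘ F^♯ = id`. -/
def IsFrobeniusSplit : Prop :=
  ∃ φ : ∀ U : X.Opens, Γ(X, absFrobenius f p ⁻¹ᵁ U) →+ Γ(X, U),
    (∀ (U V : X.Opens) (h : U ≤ V) (s : Γ(X, absFrobenius f p ⁻¹ᵁ V)),
      φ U (X.presheaf.map ((TopologicalSpace.Opens.map (absFrobenius f p).base).map
        (homOfLE h)).op s) = X.presheaf.map (homOfLE h).op (φ V s)) ∧
    (∀ (U : X.Opens) (a : Γ(X, U)) (s : Γ(X, absFrobenius f p ⁻¹ᵁ U)),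
      φ U ((absFrobenius f p).app U a * s) = a * φ U s) ∧
    ∀ (U : X.Opens) (a : Γ(X, U)), φ U ((absFrobenius f p).app U a) = a

theorem absFrobenius_base : (absFrobenius f p).base = 𝟙 _ := rfl

end Geometry

end SymplecticFrobenius
end

/-! Write `C` for the Cartier operator; `Cart p η ω` says that `ω` is closed with `C ω = η`. Over a
perfect field, on a smooth affine chart, `C` is defined on all closed forms, kills exactly the exact
ones, is multiplicative and satisfies `C (a ^ p * ω) = a * C ω`.

Base change to the algebraic closure shows that a nonzero global `2`-form `ω` is closed, identifies
vector fields with `1`-forms, and spans the global `2`-forms over `k`; hence `C ω = c ω` with `c` in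
`k`. The link with functions goes through top degree. The power `ω ^ n / n!` makes no sense when `p
≤ n`, so it is replaced by the exponential `exp ω = ∏ (1 + yᵢ zᵢ)` for `ω = ∑ yᵢ zᵢ`, which depends
on `ω` only (`IsExp.unique`). For symplectic `ω` its top degree part `μ` has no zeros
(`isUnit_topCoeff`), and `C (exp ω) = exp (C ω)` (`Coords.cart_exp`) because the exponential of `dβ`
is `1` plus an exact form.

If `C ω = η` is nonzero, then `η` is symplectic too, with volume form `ν`, and `C μ = ν`. So `s ↦ C
(s μ) / ν` is a Frobenius splitting: it is inverse-Frobenius linear and sends `1` to `1`.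

Conversely, let `φ` be a splitting and `C ω = 0`. Then `C (exp ω) = 1`, so `C μ = 0` and `μ` is
exact at the generic point. Locally every inverse-Frobenius linear map has the form `s ↦ C (g s μ) /
μ` for a unique `g` (`Coords.exists_dual`, `Coords.eq_zero_of_cart_zero`). For `φ` these `g` agree
on overlaps, so `g ω` is a global `2`-form, whence `g = c` lies in `k`. Now `μ = φ(1) μ = C (c μ) =
0`, a contradiction.

The Cartier isomorphism is proved in coordinates: the Lie derivatives along the fields `xᵢ ∂ᵢ` are
homotopic to zero and have eigenvalues in `𝔽_p`, and the forms of weight zero are exactly the sums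
of `c ^ p x ^ (p - 1) dx` taken over subsets of the coordinates. Global statements are checked at
the generic point, into which forms on nonempty affine opens inject. -/

noncomputable section

namespace SymplecticFrobenius

/-! ### Exterior algebras: contractions, exponentials of `2`-forms, top degree coefficients -/

section ExteriorAlgebra

open ExteriorAlgebra Module

variable {R M : Type*} [CommRing R] [AddCommGroup M] [Module R M]

/-- Contraction with a linear form. -/
abbrev contr (θ : Dual R M) : ExteriorAlgebra R M →ₗ[R] ExteriorAlgebra R M :=
  CliffordAlgebra.contractLeft θ

/-- The grading involution of an exterior algebra. -/
abbrev extInv : ExteriorAlgebra R M →ₐ[R] ExteriorAlgebra R M := CliffordAlgebra.involute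

theorem contr_ι_mul (θ : Dual R M) (m : M) (x : ExteriorAlgebra R M) :
    contr θ (ι R m * x) = θ m • x - ι R m * contr θ x :=
  CliffordAlgebra.contractLeft_ι_mul ..

theorem contr_ι (θ : Dual R M) (m : M) : contr θ (ι R m) = algebraMap R _ (θ m) :=
  CliffordAlgebra.contractLeft_ι ..

theorem extInv_ι (m : M) : extInv (ι R m) = - ι R m := CliffordAlgebra.involute_ι m

theorem contr_mul (θ : Dual R M) (x y : ExteriorAlgebra R M) :
    contr θ (x * y) = contr θ x * y + extInv x * contr θ y := by
  induction x using ExteriorAlgebra.induction generalizing y with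
  | algebraMap r =>
    rw [AlgHom.commutes, ← Algebra.smul_def, map_smul, Algebra.smul_def]
    simp
  | ι m => rw [contr_ι_mul, contr_ι, extInv_ι, Algebra.smul_def, neg_mul, sub_eq_add_neg]
  | mul a b ha hb =>
    rw [mul_assoc, ha, hb, ha b, map_mul]
    simp only [mul_add, add_mul, mul_assoc, add_assoc]
  | add a b ha hb => simp only [add_mul, map_add, ha, hb]; abel

theorem ι_mul_comm (m : M) (x : ExteriorAlgebra R M) : ι R m * x = extInv x * ι R m := by
  induction x using ExteriorAlgebra.induction with
  | algebraMap r => rw [AlgHom.commutes, Algebra.commutes]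
  | ι n => rw [extInv_ι, neg_mul]; exact eq_neg_of_add_eq_zero_left (ι_add_mul_swap _ _)
  | mul a b ha hb => rw [map_mul, mul_assoc, ← hb, ← mul_assoc, ha, mul_assoc]
  | add a b ha hb => rw [map_add, add_mul, mul_add, ha, hb]

theorem ι_mul_ι_mul_comm (m n : M) (x : ExteriorAlgebra R M) :
    ι R m * ι R n * x = x * (ι R m * ι R n) := by
  rw [mul_assoc, ι_mul_comm n, ← mul_assoc, ι_mul_comm m,
    show extInv (extInv x) = x from CliffordAlgebra.involute_involute x, mul_assoc]

theorem ι_mul_ι_sq (m n : M) : ι R m * ι R n * (ι R m * ι R n) = 0 := by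
  rw [← mul_assoc, ι_mul_ι_mul_comm, ← mul_assoc, ι_sq_zero, zero_mul, zero_mul]

section Exp

/-- `E` is the exponential `Π (1 + yᵢ zᵢ)` of the `2`-form `ω = Σ yᵢ zᵢ`. -/
inductive IsExp : ExteriorAlgebra R M → ExteriorAlgebra R M → Prop
  | zero : IsExp 0 1
  | cons (y z : M) (ω E : ExteriorAlgebra R M) : IsExp ω E →
      IsExp (ι R y * ι R z + ω) ((1 + ι R y * ι R z) * E)

theorem IsExp.single (y z : M) : IsExp (ι R y * ι R z) (1 + ι R y * ι R z) := by
  simpa using IsExp.cons (R := R) y z 0 1 .zero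

theorem IsExp.add {ω ω' E E' : ExteriorAlgebra R M} (h : IsExp ω E) (h' : IsExp ω' E') :
    IsExp (ω + ω') (E * E') := by
  induction h with
  | zero => rwa [zero_add, one_mul]
  | cons y z ω E _ ih => rw [add_assoc, mul_assoc]; exact .cons _ _ _ _ ih

/-- Each factor `1 + yz` has square-zero `yz`, hence inverse `1 - yz`, which is the factor attached
to `-yz`. -/
theorem IsExp.exists_neg {ω E : ExteriorAlgebra R M} (h : IsExp ω E) :
    ∃ E', IsExp (-ω) E' ∧ E * E' = 1 ∧ E' * E = 1 := by
  induction h with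
  | zero => exact ⟨1, by rw [neg_zero]; exact .zero, by simp, by simp⟩
  | cons y z ω E h ih =>
    obtain ⟨E', h1, h2, h3⟩ := ih
    have e : IsExp (-(ι R y * ι R z)) (1 - ι R y * ι R z) := by
      simpa [sub_eq_add_neg] using IsExp.single (R := R) (-y) z
    have e1 : (1 + ι R y * ι R z) * (1 - ι R y * ι R z) = 1 := by
      rw [add_mul, mul_sub, mul_sub, ι_mul_ι_sq]; simp
    have e2 : (1 - ι R y * ι R z) * (1 + ι R y * ι R z) = 1 := by
      rw [sub_mul, mul_add, mul_add, ι_mul_ι_sq]; simp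
    refine ⟨E' * (1 - ι R y * ι R z), ?_, ?_, ?_⟩
    · rw [neg_add_rev]; exact h1.add e
    · rw [mul_assoc, ← mul_assoc E, h2, one_mul, e1]
    · rw [mul_assoc, ← mul_assoc (1 - _), e2, one_mul, h3]

theorem IsExp.exists {ω : ExteriorAlgebra R M} (h : ω ∈ ⋀[R]^2 M) : ∃ E, IsExp ω E := by
  rw [ExteriorAlgebra.exteriorPower, pow_two] at h
  induction h using Submodule.mul_induction_on' with
  | mem_mul_mem a ha b hb =>
    obtain ⟨y, rfl⟩ := ha
    obtain ⟨z, rfl⟩ := hb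
    exact ⟨_, .single y z⟩
  | add x _ y _ hx hy =>
    obtain ⟨E, hE⟩ := hx
    obtain ⟨E', hE'⟩ := hy
    exact ⟨_, hE.add hE'⟩

/-- Ring homomorphisms that send vectors to vectors preserve the shape of the product; this covers
pullback of forms. -/
theorem IsExp.map {S N : Type*} [CommRing S] [AddCommGroup N] [Module S N]
    (Ψ : ExteriorAlgebra R M →+* ExteriorAlgebra S N) (hΨ : ∀ m, ∃ n, Ψ (ι R m) = ι S n)
    {ω E : ExteriorAlgebra R M} (h : IsExp ω E) : IsExp (Ψ ω) (Ψ E) := by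
  induction h with
  | zero => rw [map_zero, map_one]; exact .zero
  | cons y z ω E h ih =>
    obtain ⟨y', hy⟩ := hΨ y
    obtain ⟨z', hz⟩ := hΨ z
    rw [map_add, map_mul, map_mul, map_add, map_one, map_mul, hy, hz]
    exact (IsExp.single y' z').add ih

/-- The logarithmic derivative of the exponential. For one factor, `contr θ (yz) * yz = 0`, so
contracting `1 + yz` gives `contr θ (yz) * (1 + yz)`; as the factors are even, the Leibniz rule
extends this to products without signs. -/
theorem IsExp.contr {ω E : ExteriorAlgebra R M} (h : IsExp ω E) (θ : Dual R M) :
    contr θ E = contr θ ω * E := by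
  induction h with
  | zero => simp
  | cons y z ω E h ih =>
    have h1 : SymplecticFrobenius.contr θ (ι R y * ι R z) = θ y • ι R z - θ z • ι R y := by
      rw [contr_ι_mul, contr_ι, ← Algebra.commutes, Algebra.smul_def (θ z)]
    have h2 : (θ y • ι R z - θ z • ι R y) * (ι R y * ι R z) = 0 := by
      rw [sub_mul, smul_mul_assoc, smul_mul_assoc, ← mul_assoc (ι R y), ι_sq_zero,
        ← ι_mul_ι_mul_comm, mul_assoc, ι_sq_zero]
      simp
    have h3 : extInv (ι R y * ι R z) = ι R y * ι R z := by
      rw [map_mul, extInv_ι, extInv_ι, neg_mul_neg]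
    rw [contr_mul, ih, map_add, map_add, map_add, CliffordAlgebra.contractLeft_one, zero_add,
      map_one, h3, add_mul, add_mul, h1, ← mul_assoc, ← mul_assoc, add_mul 1 _ E, one_mul, one_mul,
      mul_add, ← mul_assoc (_ - _) (ι R y * ι R z), h2, zero_mul, add_zero, mul_add,
      ← mul_assoc (SymplecticFrobenius.contr θ ω), ← ι_mul_ι_mul_comm y z (_)]

theorem IsExp.algebraMapInv {ω E : ExteriorAlgebra R M} (h : IsExp ω E) :
    algebraMapInv E = (1 : R) := by
  induction h with
  | zero => simp
  | cons y z ω E h ih => simpa [ExteriorAlgebra.algebraMapInv] using ih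

end Exp

section Grading

/-- The homogeneous component of degree `n` of an element of an exterior algebra. -/
abbrev pr (n : ℕ) : ExteriorAlgebra R M →ₗ[R] ExteriorAlgebra R M :=
  GradedAlgebra.proj (fun i : ℕ => ⋀[R]^i M) n

theorem pr_mem (n : ℕ) (x : ExteriorAlgebra R M) : pr n x ∈ ⋀[R]^n M :=
  SetLike.coe_mem _

theorem pr_of_mem {n : ℕ} {x : ExteriorAlgebra R M} (h : x ∈ ⋀[R]^n M) : pr n x = x :=
  DirectSum.decompose_of_mem_same (fun i : ℕ => ⋀[R]^i M) h

theorem pr_of_mem_ne {n m : ℕ} {x : ExteriorAlgebra R M} (h : x ∈ ⋀[R]^n M) (hn : n ≠ m) :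
    pr m x = 0 :=
  DirectSum.decompose_of_mem_ne (fun i : ℕ => ⋀[R]^i M) h hn

theorem homogeneous_induction {P : ExteriorAlgebra R M → Prop} (h0 : P 0)
    (hm : ∀ n, ∀ x ∈ ⋀[R]^n M, P x) (ha : ∀ x y, P x → P y → P (x + y))
    (x : ExteriorAlgebra R M) : P x := by
  classical
  rw [← DirectSum.sum_support_decompose (fun i : ℕ => ⋀[R]^i M) x]
  exact Finset.sum_induction _ P ha h0 fun i _ => hm i _ (SetLike.coe_mem _)

theorem pr_comp {S N : Type*} [CommRing S] [AddCommGroup N] [Module S N] (c : ℕ)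
    (T : ExteriorAlgebra R M →+ ExteriorAlgebra S N)
    (hT : ∀ n, ∀ x ∈ ⋀[R]^n M, T x ∈ ⋀[S]^(n + c) N) (n : ℕ) (x : ExteriorAlgebra R M) :
    pr (n + c) (T x) = T (pr n x) := by
  induction x using homogeneous_induction with
  | h0 => simp
  | hm m x hx =>
    by_cases h : m = n
    · subst h
      rw [pr_of_mem hx, pr_of_mem (hT m x hx)]
    · rw [pr_of_mem_ne hx h, pr_of_mem_ne (hT m x hx) (by omega), map_zero]
  | ha x y hx hy => simp only [map_add, hx, hy]

theorem pr_of_lt {S N : Type*} [CommRing S] [AddCommGroup N] [Module S N] (c : ℕ)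
    (T : ExteriorAlgebra R M →+ ExteriorAlgebra S N)
    (hT : ∀ n, ∀ x ∈ ⋀[R]^n M, T x ∈ ⋀[S]^(n + c) N) {n : ℕ} (hn : n < c)
    (x : ExteriorAlgebra R M) : pr n (T x) = 0 := by
  induction x using homogeneous_induction with
  | h0 => simp
  | hm m x hx => rw [pr_of_mem_ne (hT m x hx) (by omega)]
  | ha x y hx hy => simp only [map_add, hx, hy, add_zero]

theorem one_mem_zero : (1 : ExteriorAlgebra R M) ∈ ⋀[R]^0 M := by
  rw [ExteriorAlgebra.exteriorPower, pow_zero]; exact Submodule.one_le.1 le_rfl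

theorem ι_mem_one (m : M) : ι R m ∈ ⋀[R]^1 M := by
  rw [ExteriorAlgebra.exteriorPower, pow_one]; exact ⟨m, rfl⟩

theorem mul_mem_add {i j : ℕ} {x y : ExteriorAlgebra R M} (hx : x ∈ ⋀[R]^i M)
    (hy : y ∈ ⋀[R]^j M) : x * y ∈ ⋀[R]^(i + j) M :=
  SetLike.mul_mem_graded (A := fun i : ℕ => ⋀[R]^i M) hx hy

theorem extInv_mem {n : ℕ} {x : ExteriorAlgebra R M} (hx : x ∈ ⋀[R]^n M) :
    extInv x = (-1 : R) ^ n • x := by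
  rw [ExteriorAlgebra.exteriorPower] at hx
  induction n generalizing x with
  | zero =>
    rw [pow_zero] at hx
    obtain ⟨r, rfl⟩ := Submodule.mem_one.1 hx
    simp
  | succ n ih =>
    rw [pow_succ] at hx
    induction hx using Submodule.mul_induction_on' with
    | mem_mul_mem a ha b hb =>
      obtain ⟨z, rfl⟩ := hb
      rw [map_mul, ih ha, extInv_ι, pow_succ]; simp
    | add x _ y _ hx hy => rw [map_add, hx, hy, smul_add]

theorem contr_mem_zero (θ : Dual R M) {x : ExteriorAlgebra R M} (hx : x ∈ ⋀[R]^0 M) :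
    contr θ x = 0 := by
  rw [ExteriorAlgebra.exteriorPower, pow_zero] at hx
  obtain ⟨r, rfl⟩ := Submodule.mem_one.1 hx
  simp

theorem contr_mem (θ : Dual R M) (n : ℕ) {x : ExteriorAlgebra R M} (hx : x ∈ ⋀[R]^(n + 1) M) :
    contr θ x ∈ ⋀[R]^n M := by
  induction n generalizing x with
  | zero =>
    rw [ExteriorAlgebra.exteriorPower, zero_add, pow_one] at hx
    obtain ⟨m, rfl⟩ := hx
    rw [contr_ι, Algebra.algebraMap_eq_smul_one]
    exact Submodule.smul_mem _ _ one_mem_zero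
  | succ n ih =>
    rw [ExteriorAlgebra.exteriorPower, pow_succ'] at hx
    induction hx using Submodule.mul_induction_on' with
    | mem_mul_mem a ha b hb =>
      obtain ⟨z, rfl⟩ := ha
      rw [contr_ι_mul]
      refine Submodule.sub_mem _ (Submodule.smul_mem _ _ hb) ?_
      rw [add_comm]
      exact mul_mem_add (ι_mem_one z) (ih hb)
    | add x _ y _ hx hy => rw [map_add]; exact Submodule.add_mem _ hx hy

end Grading

section Basis

variable {I : Type*} [LinearOrder I] (b : Basis I R M)

theorem basis_eq_list (s : Finset I) :
    b.ExteriorAlgebra s = ((s.sort).map fun j => ι R (b j)).prod := by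
  rw [ExteriorAlgebra.basis_apply]
  refine (ιMulti_apply (R := R) _).trans ?_
  congr 1
  apply List.ext_getElem
  · simp
  · intro i h1 h2
    simp [Set.powersetCard.ofFinEmbEquiv_symm_apply, Finset.orderEmbOfFin_apply]

theorem basis_empty : b.ExteriorAlgebra ∅ = 1 := by rw [basis_eq_list]; simp

theorem basis_mem (s : Finset I) : b.ExteriorAlgebra s ∈ ⋀[R]^s.card M := by
  rw [ExteriorAlgebra.basis_apply]
  exact ιMulti_range R _ ⟨_, rfl⟩

/-- Basis elements of the exterior algebra are products of the `b j`, so the weights add. This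
serves both the number operators `numOp` and the Lie derivatives along `xᵢ ∂ᵢ`. -/
theorem derivation_basis (D : ExteriorAlgebra R M →+ ExteriorAlgebra R M)
    (hD : ∀ x y, D (x * y) = D x * y + x * D y) (w : I → ℕ)
    (hw : ∀ j, D (ι R (b j)) = w j • ι R (b j)) (s : Finset I) :
    D (b.ExteriorAlgebra s) = (∑ j ∈ s, w j) • b.ExteriorAlgebra s := by
  have h1 : D 1 = 0 := by simpa using hD 1 1
  have key (l : List I) : D ((l.map fun j => ι R (b j)).prod) =
      (l.map w).sum • ((l.map fun j => ι R (b j)).prod) := by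
    induction l with
    | nil => simpa using h1
    | cons j l ih =>
      simp only [List.map_cons, List.prod_cons, List.sum_cons, hD, ih, hw, add_smul,
        smul_mul_assoc, mul_smul_comm]
  rw [basis_eq_list, key, Finset.sum_eq_multiset_sum, ← s.sort_eq (· ≤ ·), Multiset.map_coe,
    Multiset.sum_coe]

theorem ringHom_basis {S N : Type*} [CommRing S] [AddCommGroup N] [Module S N] (b' : Basis I S N)
    (Ψ : ExteriorAlgebra R M →+* ExteriorAlgebra S N) (c : I → S)
    (h : ∀ j, Ψ (ι R (b j)) = algebraMap S _ (c j) * ι S (b' j)) (s : Finset I) :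
    Ψ (b.ExteriorAlgebra s) = algebraMap S _ (∏ j ∈ s, c j) * b'.ExteriorAlgebra s := by
  have key (l : List I) : Ψ ((l.map fun j => ι R (b j)).prod) =
      algebraMap S _ (l.map c).prod * ((l.map fun j => ι S (b' j)).prod) := by
    induction l with
    | nil => simp
    | cons j l ih =>
      simp only [List.map_cons, List.prod_cons, map_mul, ih, h, mul_assoc]
      congr 1
      rw [← mul_assoc, ← mul_assoc, Algebra.commutes]
  rw [basis_eq_list, basis_eq_list, key, Finset.prod_eq_multiset_prod, ← s.sort_eq (· ≤ ·),
    Multiset.map_coe, Multiset.prod_coe]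

/-- Exterior multiplication by `bᵢ` after contraction with the `i`-th coordinate. -/
def numOp (i : I) : ExteriorAlgebra R M →ₗ[R] ExteriorAlgebra R M :=
  (LinearMap.mulLeft R (ι R (b i))).comp (contr (b.coord i))

theorem numOp_apply (i : I) (x : ExteriorAlgebra R M) :
    numOp b i x = ι R (b i) * contr (b.coord i) x := rfl

theorem numOp_mul (i : I) (x y : ExteriorAlgebra R M) :
    numOp b i (x * y) = numOp b i x * y + x * numOp b i y := by
  simp only [numOp_apply, contr_mul, mul_add, ← mul_assoc]
  congr 2
  rw [ι_mul_comm]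
  exact congrArg (· * _) (CliffordAlgebra.involute_involute x)

theorem numOp_basis (i : I) (s : Finset I) :
    numOp b i (b.ExteriorAlgebra s) = if i ∈ s then b.ExteriorAlgebra s else 0 := by
  have := derivation_basis b (numOp b i).toAddMonoidHom (numOp_mul b i)
    (fun j => if j = i then 1 else 0) (fun j => by
      change numOp b i _ = _
      rw [numOp_apply, contr_ι, ← Algebra.commutes, ← Algebra.smul_def, Basis.coord_apply,
        Basis.repr_self, Finsupp.single_apply]
      split_ifs with h
      · rw [h]; simp
      · simp) s
  rw [Finset.sum_ite_eq'] at this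
  refine Eq.trans this ?_
  split_ifs <;> simp

theorem coord_numOp (i : I) (s : Finset I) (x : ExteriorAlgebra R M) :
    b.ExteriorAlgebra.coord s (numOp b i x) =
      if i ∈ s then b.ExteriorAlgebra.coord s x else 0 := by
  have : (b.ExteriorAlgebra.coord s).comp (numOp b i) =
      if i ∈ s then b.ExteriorAlgebra.coord s else 0 := by
    refine b.ExteriorAlgebra.ext fun t => ?_
    rw [LinearMap.comp_apply, numOp_basis]
    by_cases h : t = s
    · subst h; split_ifs <;> simp
    · split_ifs <;> simp [h]
  have h2 := LinearMap.congr_fun this x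
  rw [LinearMap.comp_apply] at h2
  rw [h2]; split_ifs <;> rfl

/-- If `i ∈ s`, then `numOp b i` leaves the coordinate at `s` unchanged; but it kills `x`, so only
the coordinate at `∅` survives. -/
theorem eq_algebraMap_of_contr_eq_zero {x : ExteriorAlgebra R M}
    (h : ∀ i, contr (b.coord i) x = 0) : x = algebraMap R _ (algebraMapInv x) := by
  have h1 : x = b.ExteriorAlgebra.coord ∅ x • 1 := by
    refine b.ExteriorAlgebra.ext_elem fun s => ?_
    rw [← basis_empty b, map_smul, Finsupp.smul_apply, Basis.repr_self, Finsupp.single_apply]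
    split_ifs with hs
    · subst hs; simp
    · obtain ⟨i, hi⟩ := Finset.nonempty_iff_ne_empty.2 (Ne.symm hs)
      have := coord_numOp b i s x
      rw [if_pos hi, numOp_apply, h, mul_zero, map_zero] at this
      simpa using this.symm
  rw [h1]
  simp [← Algebra.algebraMap_eq_smul_one]

-- The quotient of two exponentials of `ω` is an exponential of `0`, so all its contractions vanish
-- and it is a scalar; its constant term is `1`.
include b in
theorem IsExp.unique {ω E E' : ExteriorAlgebra R M} (h : IsExp ω E) (h' : IsExp ω E') :
    E = E' := by
  obtain ⟨F, hF, h1, h2⟩ := h'.exists_neg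
  have h3 := h.add hF
  rw [add_neg_cancel] at h3
  have h4 : E * F = 1 := by
    rw [eq_algebraMap_of_contr_eq_zero b (x := E * F) fun i => by rw [h3.contr]; simp,
      h3.algebraMapInv, map_one]
  calc E = E * F * E' := by rw [mul_assoc, h2, mul_one]
    _ = E' := by rw [h4, one_mul]

variable [Fintype I]

/-- The top degree coefficient with respect to a basis. -/
abbrev topCoeff : ExteriorAlgebra R M →ₗ[R] R := b.ExteriorAlgebra.coord Finset.univ

/-- The exterior product of the elements of a basis. -/
abbrev topVec : ExteriorAlgebra R M := b.ExteriorAlgebra Finset.univ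

theorem pr_card (x : ExteriorAlgebra R M) :
    pr (Fintype.card I) x = topCoeff b x • topVec b := by
  have : (pr (Fintype.card I) : ExteriorAlgebra R M →ₗ[R] _) =
      (topCoeff b).smulRight (topVec b) := by
    refine b.ExteriorAlgebra.ext fun s => ?_
    rw [LinearMap.smulRight_apply, Basis.coord_apply, Basis.repr_self, Finsupp.single_apply]
    split_ifs with hs
    · subst hs; rw [one_smul]; exact pr_of_mem (basis_mem b _)
    · rw [zero_smul]
      exact pr_of_mem_ne (basis_mem b s) fun h => hs ((Finset.card_eq_iff_eq_univ s).1 h)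
  exact LinearMap.congr_fun this x

theorem topCoeff_topVec : topCoeff b (topVec b) = 1 := by simp

theorem topCoeff_contr (θ : Dual R M) (x : ExteriorAlgebra R M) : topCoeff b (contr θ x) = 0 := by
  have h (i : I) : topCoeff b (contr (b.coord i) x) = 0 := by
    have := coord_numOp b i Finset.univ (contr (b.coord i) x)
    rw [if_pos (Finset.mem_univ i), numOp_apply, CliffordAlgebra.contractLeft_contractLeft,
      mul_zero, map_zero] at this
    exact this.symm
  rw [← b.sum_dual_apply_smul_coord θ]
  simp only [contr, map_sum, map_smul, LinearMap.sum_apply, LinearMap.smul_apply]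
  exact Finset.sum_eq_zero fun i _ => by rw [h, smul_zero]

/-- All top coefficients of multiples `z * E` lie in the ideal generated by that of `E`, by
induction on the degree of `z`: a factor `m` in `z` can be written as a contraction of `ω`, and a
contraction has no top degree part, which lowers the degree of `z`. Since `E` is invertible, some
`z` gives top coefficient `1`. -/
theorem isUnit_topCoeff {ω E : ExteriorAlgebra R M} (h : IsExp ω E)
    (hω : ∀ m : M, ∃ θ : Dual R M, contr θ ω = ι R m) : IsUnit (topCoeff b E) := by
  have key (n : ℕ) : ∀ z ∈ ⋀[R]^n M, topCoeff b (z * E) ∈ Ideal.span {topCoeff b E} := by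
    induction n using Nat.strong_induction_on with
    | _ n ih =>
      intro z hz
      rcases n with _ | n
      · rw [ExteriorAlgebra.exteriorPower, pow_zero] at hz
        obtain ⟨r, rfl⟩ := Submodule.mem_one.1 hz
        rw [← Algebra.smul_def, map_smul]
        exact Ideal.mul_mem_left _ _ (Ideal.mem_span_singleton_self _)
      · rw [ExteriorAlgebra.exteriorPower, pow_succ] at hz
        induction hz using Submodule.mul_induction_on' with
        | mem_mul_mem a ha c hc =>
          obtain ⟨m, rfl⟩ := hc
          obtain ⟨θ, hθ⟩ := hω m
          -- As `contr θ E = ι m * E`, this reads `0 = top (contr θ a * E) ± top (a * ι m * E)`.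
          have h1 := topCoeff_contr b θ (a * E)
          rw [contr_mul, h.contr, hθ, extInv_mem ha, map_add, smul_mul_assoc, map_smul,
            ← mul_assoc] at h1
          have h2 : topCoeff b (contr θ a * E) ∈ Ideal.span {topCoeff b E} := by
            rcases n with _ | n
            · rw [contr_mem_zero θ ha]; simp
            · exact ih n (by omega) _ (contr_mem θ n ha)
          have h3 : ((-1 : R) ^ n * (-1 : R) ^ n) = 1 := by rw [← mul_pow]; simp
          have h4 : topCoeff b (a * ι R m * E) =
              (-1 : R) ^ n * ((-1 : R) ^ n • topCoeff b (a * ι R m * E)) := by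
            rw [smul_eq_mul, ← mul_assoc, h3, one_mul]
          rw [h4, eq_neg_of_add_eq_zero_right h1]
          exact Ideal.mul_mem_left _ _ (neg_mem h2)
        | add x _ y _ hx hy => rw [add_mul, map_add]; exact add_mem hx hy
  obtain ⟨F, -, -, hF⟩ := h.exists_neg
  have h1 (z : ExteriorAlgebra R M) : topCoeff b (z * E) ∈ Ideal.span {topCoeff b E} := by
    induction z using homogeneous_induction with
    | h0 => simp
    | hm n x hx => exact key n x hx
    | ha x y hx hy => rw [add_mul, map_add]; exact add_mem hx hy
  have h2 := h1 (topVec b * F)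
  rw [mul_assoc, hF, mul_one, topCoeff_topVec] at h2
  exact isUnit_of_dvd_one (Ideal.mem_span_singleton.1 h2)

end Basis

end ExteriorAlgebra

/-! ### Differential forms: gradings, pullbacks, and the relation `C ω = η` -/

section Forms

variable {k A : Type*} [CommRing k] [CommRing A] [Algebra k A]

theorem DiffForms.ringHom_ext {R : Type*} [Ring R] {F G : DiffForms k A →+* R}
    (hf : ∀ a, F (fn a) = G (fn a)) (hd : ∀ a, F (dd a) = G (dd a)) : F = G := by
  ext x
  induction x using DiffForms.ind with
  | hf a => exact hf a
  | hd a => exact hd a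
  | hm x y hx hy => rw [map_mul, map_mul, hx, hy]
  | ha x y hx hy => rw [map_add, map_add, hx, hy]

theorem ringHom_mem {R M S N : Type*} [CommRing R] [AddCommGroup M] [Module R M] [CommRing S]
    [AddCommGroup N] [Module S N] (Ψ : ExteriorAlgebra R M →+* ExteriorAlgebra S N)
    (h0 : ∀ r, ∃ s, Ψ (algebraMap R _ r) = algebraMap S _ s)
    (h1 : ∀ m, Ψ (ExteriorAlgebra.ι R m) ∈ ⋀[S]^1 N) {n : ℕ} {x : ExteriorAlgebra R M}
    (hx : x ∈ ⋀[R]^n M) : Ψ x ∈ ⋀[S]^n N := by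
  rw [ExteriorAlgebra.exteriorPower] at hx
  induction n generalizing x with
  | zero =>
    rw [pow_zero] at hx
    obtain ⟨r, rfl⟩ := Submodule.mem_one.1 hx
    obtain ⟨s, hs⟩ := h0 r
    rw [hs, Algebra.algebraMap_eq_smul_one]
    exact Submodule.smul_mem _ _ one_mem_zero
  | succ n ih =>
    rw [pow_succ] at hx
    induction hx using Submodule.mul_induction_on' with
    | mem_mul_mem a ha b hb =>
      obtain ⟨z, rfl⟩ := hb
      rw [map_mul]
      exact mul_mem_add (ih ha) (h1 z)
    | add x _ y _ hx hy => rw [map_add]; exact Submodule.add_mem _ hx hy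

theorem one_form_induction {P : DiffForms k A → Prop} (h0 : P 0) (hd : ∀ a, P (dd a))
    (hf : ∀ (a : A) (m : Ω[A⁄k]), P (ExteriorAlgebra.ι A m) → P (fn a * ExteriorAlgebra.ι A m))
    (ha : ∀ (m n : Ω[A⁄k]), P (ExteriorAlgebra.ι A m) → P (ExteriorAlgebra.ι A n) →
      P (ExteriorAlgebra.ι A m + ExteriorAlgebra.ι A n)) (m : Ω[A⁄k]) :
    P (ExteriorAlgebra.ι A m) := by
  have : m ∈ Submodule.span A (Set.range (KaehlerDifferential.D k A)) := by
    rw [KaehlerDifferential.span_range_derivation]; trivial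
  induction this using Submodule.span_induction with
  | mem y h => obtain ⟨a, rfl⟩ := h; exact hd a
  | zero => rwa [map_zero]
  | add y z _ _ h1 h2 => rw [map_add]; exact ha _ _ h1 h2
  | smul r y _ h => rw [map_smul, Algebra.smul_def]; exact hf _ _ h

theorem fn_mem (a : A) : (fn a : DiffForms k A) ∈ ⋀[A]^0 Ω[A⁄k] := by
  rw [ExteriorAlgebra.exteriorPower, pow_zero]; exact Submodule.mem_one.2 ⟨a, rfl⟩

theorem fn_mul_mem (a : A) {n : ℕ} {x : DiffForms k A} (hx : x ∈ ⋀[A]^n Ω[A⁄k]) :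
    fn a * x ∈ ⋀[A]^n Ω[A⁄k] := by
  rw [← Algebra.smul_def]; exact Submodule.smul_mem _ _ hx

theorem dd_mem (a : A) : (dd a : DiffForms k A) ∈ ⋀[A]^1 Ω[A⁄k] := ι_mem_one _

theorem extd_ι_mem (m : Ω[A⁄k]) : extd k A (ExteriorAlgebra.ι A m) ∈ ⋀[A]^2 Ω[A⁄k] := by
  refine one_form_induction (P := fun x => extd k A x ∈ ⋀[A]^2 Ω[A⁄k]) (by simp) (fun a => ?_)
    (fun a m h => ?_) (fun m n h1 h2 => ?_) m
  · rw [extd_dd]; exact Submodule.zero_mem _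
  · rw [extd_mul, extd_fn, inv_fn]
    exact Submodule.add_mem _ (mul_mem_add (dd_mem a) (ι_mem_one m)) (fn_mul_mem a h)
  · rw [map_add]; exact Submodule.add_mem _ h1 h2

theorem signInv_mem {n : ℕ} {x : DiffForms k A} (hx : x ∈ ⋀[A]^n Ω[A⁄k]) :
    signInv x ∈ ⋀[A]^n Ω[A⁄k] := by
  rw [show signInv x = _ from extInv_mem hx]; exact Submodule.smul_mem _ _ hx

theorem extd_mem (n : ℕ) {x : DiffForms k A} (hx : x ∈ ⋀[A]^n Ω[A⁄k]) :
    extd k A x ∈ ⋀[A]^(n + 1) Ω[A⁄k] := by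
  induction n generalizing x with
  | zero =>
    rw [ExteriorAlgebra.exteriorPower, pow_zero] at hx
    obtain ⟨r, rfl⟩ := Submodule.mem_one.1 hx
    rw [extd_fn]; exact dd_mem r
  | succ n ih =>
    rw [ExteriorAlgebra.exteriorPower, pow_succ] at hx
    induction hx using Submodule.mul_induction_on' with
    | mem_mul_mem a ha b hb =>
      obtain ⟨z, rfl⟩ := hb
      rw [extd_mul]
      exact Submodule.add_mem _ (mul_mem_add (ih ha) (ι_mem_one z))
        (mul_mem_add (i := n) (signInv_mem ha) (extd_ι_mem z))
    | add x _ y _ hx hy => rw [map_add]; exact Submodule.add_mem _ hx hy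

theorem pr_extd (n : ℕ) (x : DiffForms k A) : pr (n + 1) (extd k A x) = extd k A (pr n x) :=
  pr_comp 1 (extd k A) (fun n _ hx => extd_mem n hx) n x

theorem exists_extd_eq_pr (n : ℕ) (x : DiffForms k A) :
    ∃ y, extd k A y = pr n (extd k A x) := by
  rcases n with _ | n
  · exact ⟨0, by rw [pr_of_lt 1 (extd k A) (fun n _ hx => extd_mem n hx) one_pos, map_zero]⟩
  · exact ⟨_, (pr_extd n x).symm⟩

theorem extd_fn_mul_of_dd {a : A} (ha : (dd a : DiffForms k A) = 0) (x : DiffForms k A) :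
    extd k A (fn a * x) = fn a * extd k A x := by
  rw [extd_mul, extd_fn, ha, zero_mul, zero_add, inv_fn]

theorem dd_algebraMap (r : k) : (dd (algebraMap k A r) : DiffForms k A) = 0 := by simp [dd]

theorem extd_smul (r : k) (x : DiffForms k A) : extd k A (r • x) = r • extd k A x := by
  rw [← algebraMap_smul A r x, Algebra.smul_def, extd_fn_mul_of_dd (dd_algebraMap r),
    ← Algebra.smul_def, algebraMap_smul]

section FormMap

variable {k' B : Type*} [CommRing k'] [CommRing B] [Algebra k' B]

/-- Pullback of forms along a ring homomorphism `φ : A → B` over a homomorphism `σ : k → k'` of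
base rings. -/
def formMap (σ : k →+* k') (φ : A →+* B)
    (h : ∀ r, φ (algebraMap k A r) = algebraMap k' B (σ r)) :
    DiffForms k A →+* DiffForms k' B :=
  letI := σ.toAlgebra
  letI := φ.toAlgebra
  letI := (φ.comp (algebraMap k A)).toAlgebra
  haveI : IsScalarTower k A B := IsScalarTower.of_algebraMap_eq fun _ => rfl
  haveI : IsScalarTower k k' B := IsScalarTower.of_algebraMap_eq h
  (ExteriorAlgebra.lift A ⟨((ExteriorAlgebra.ι B).restrictScalars A).comp
    (KaehlerDifferential.map k k' A B), fun _ => ExteriorAlgebra.ι_sq_zero _⟩).toRingHom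

variable (σ : k →+* k') (φ : A →+* B) (h : ∀ r, φ (algebraMap k A r) = algebraMap k' B (σ r))

theorem formMap_fn (a : A) : formMap σ φ h (fn a) = fn (φ a) :=
  letI := φ.toAlgebra
  AlgHom.commutes (ExteriorAlgebra.lift A (A := DiffForms k' B) _) a

theorem formMap_ι_exists (m : Ω[A⁄k]) :
    ∃ n, formMap σ φ h (ExteriorAlgebra.ι A m) = ExteriorAlgebra.ι B n := by
  let := σ.toAlgebra
  let := φ.toAlgebra
  let := (φ.comp (algebraMap k A)).toAlgebra
  have : IsScalarTower k A B := IsScalarTower.of_algebraMap_eq fun _ => rfl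
  have : IsScalarTower k k' B := IsScalarTower.of_algebraMap_eq h
  exact ⟨KaehlerDifferential.map k k' A B m, ExteriorAlgebra.lift_ι_apply A (A := DiffForms k' B)
    (((ExteriorAlgebra.ι B).restrictScalars A).comp (KaehlerDifferential.map k k' A B))
    (fun _ => ExteriorAlgebra.ι_sq_zero _) m⟩

theorem formMap_dd (a : A) : formMap σ φ h (dd a) = dd (φ a) := by
  let := σ.toAlgebra
  let := φ.toAlgebra
  let := (φ.comp (algebraMap k A)).toAlgebra
  have : IsScalarTower k A B := IsScalarTower.of_algebraMap_eq fun _ => rfl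
  have : IsScalarTower k k' B := IsScalarTower.of_algebraMap_eq h
  have h : (ExteriorAlgebra.ι B).restrictScalars A (KaehlerDifferential.map k k' A B
      (KaehlerDifferential.D k A a)) = (dd (φ a) : DiffForms k' B) := by
    rw [KaehlerDifferential.map_D]; rfl
  rw [← h]
  exact ExteriorAlgebra.lift_ι_apply A (A := DiffForms k' B)
    (((ExteriorAlgebra.ι B).restrictScalars A).comp (KaehlerDifferential.map k k' A B))
    (fun _ => ExteriorAlgebra.ι_sq_zero _) (KaehlerDifferential.D k A a)

theorem formMap_signInv (x : DiffForms k A) :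
    formMap σ φ h (signInv x) = signInv (formMap σ φ h x) := by
  induction x using DiffForms.ind with
  | hf a => rw [inv_fn, formMap_fn, inv_fn]
  | hd a => rw [inv_dd, map_neg, formMap_dd, inv_dd]
  | hm x y hx hy => simp only [map_mul, hx, hy]
  | ha x y hx hy => simp only [map_add, hx, hy]

theorem formMap_extd (x : DiffForms k A) :
    formMap σ φ h (extd k A x) = extd k' B (formMap σ φ h x) := by
  induction x using DiffForms.ind with
  | hf a => rw [extd_fn, formMap_fn, extd_fn, formMap_dd]
  | hd a => rw [extd_dd, formMap_dd, extd_dd, map_zero]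
  | hm x y hx hy => simp only [map_mul, extd_mul, map_add, hx, hy, formMap_signInv]
  | ha x y hx hy => simp only [map_add, hx, hy]

theorem formMap_mem {n : ℕ} {x : DiffForms k A} (hx : x ∈ ⋀[A]^n Ω[A⁄k]) :
    formMap σ φ h x ∈ ⋀[B]^n Ω[B⁄k'] :=
  ringHom_mem _ (fun a => ⟨_, formMap_fn σ φ h a⟩) (fun m => by
    obtain ⟨n, hn⟩ := formMap_ι_exists σ φ h m
    rw [hn]; exact ι_mem_one n) hx

theorem formMap_pr (n : ℕ) (x : DiffForms k A) :
    formMap σ φ h (pr n x) = pr n (formMap σ φ h x) :=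
  (pr_comp 0 (formMap σ φ h).toAddMonoidHom (fun _ _ hx => formMap_mem σ φ h hx) n x).symm

theorem formMap_isExp {ω E : DiffForms k A} (hE : IsExp ω E) :
    IsExp (formMap σ φ h ω) (formMap σ φ h E) :=
  hE.map _ (formMap_ι_exists σ φ h)

theorem formMap_smul (r : k) (x : DiffForms k A) :
    formMap σ φ h (r • x) = σ r • formMap σ φ h x := by
  rw [← algebraMap_smul A r x, Algebra.smul_def, map_mul, formMap_fn, h,
    ← Algebra.smul_def, algebraMap_smul]

end FormMap

section PullForms

variable {B : Type*} [CommRing B] [Algebra k B]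

theorem pullForms_eq (φ : A →ₐ[k] B) (x : DiffForms k A) :
    pullForms φ x = formMap (RingHom.id k) φ.toRingHom (fun r => φ.commutes r) x := by
  have : pullForms φ = formMap (RingHom.id k) φ.toRingHom (fun r => φ.commutes r) :=
    DiffForms.ringHom_ext (fun a => by rw [formMap_fn, pullForms_fn]; rfl)
      fun a => by rw [formMap_dd, pullForms_dd]; rfl
  rw [this]

theorem pullForms_extd (φ : A →ₐ[k] B) (x : DiffForms k A) :
    pullForms φ (extd k A x) = extd k B (pullForms φ x) := by
  rw [pullForms_eq, pullForms_eq, formMap_extd]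

theorem pullForms_mem (φ : A →ₐ[k] B) {n : ℕ} {x : DiffForms k A} (hx : x ∈ ⋀[A]^n Ω[A⁄k]) :
    pullForms φ x ∈ ⋀[B]^n Ω[B⁄k] := by
  rw [pullForms_eq]; exact formMap_mem _ _ _ hx

theorem pullForms_pr (φ : A →ₐ[k] B) (n : ℕ) (x : DiffForms k A) :
    pullForms φ (pr n x) = pr n (pullForms φ x) := by
  rw [pullForms_eq, pullForms_eq, formMap_pr]

theorem pullForms_isExp (φ : A →ₐ[k] B) {ω E : DiffForms k A} (hE : IsExp ω E) :
    IsExp (pullForms φ ω) (pullForms φ E) := by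
  rw [pullForms_eq, pullForms_eq]; exact formMap_isExp _ _ _ hE

theorem pullForms_comp {C : Type*} [CommRing C] [Algebra k C] (φ : A →ₐ[k] B) (ψ : B →ₐ[k] C)
    (x : DiffForms k A) : pullForms ψ (pullForms φ x) = pullForms (ψ.comp φ) x := by
  have : (pullForms ψ).comp (pullForms φ) = pullForms (ψ.comp φ) :=
    DiffForms.ringHom_ext
      (fun a => by simp only [RingHom.comp_apply, pullForms_fn, AlgHom.comp_apply])
      fun a => by simp only [RingHom.comp_apply, pullForms_dd, AlgHom.comp_apply]
  exact RingHom.congr_fun this x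

end PullForms

section Cart

variable (p : ℕ) [hp : Fact p.Prime] [CharP k p]

/-- The form `ω` is closed and its class is the image of `η` under the inverse Cartier operator. -/
def Cart (η ω : DiffForms k A) : Prop :=
  ∃ h : extd k A ω = 0, invCartier k A p η = deRhamClass ω h

variable {p} {η η' ω ω' : DiffForms k A}

theorem deRhamClass_eq_iff (hω : extd k A ω = 0) (hω' : extd k A ω' = 0) :
    deRhamClass ω hω = deRhamClass ω' hω' ↔ ∃ y, extd k A y = ω - ω' :=
  Ideal.Quotient.eq

theorem Cart.add (h : Cart p η ω) (h' : Cart p η' ω') : Cart p (η + η') (ω + ω') := by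
  obtain ⟨h1, h2⟩ := h
  obtain ⟨h3, h4⟩ := h'
  exact ⟨by rw [map_add, h1, h3, add_zero], by rw [map_add, h2, h4]; rfl⟩

theorem Cart.neg (h : Cart p η ω) : Cart p (-η) (-ω) := by
  obtain ⟨h1, h2⟩ := h
  exact ⟨by rw [map_neg, h1, neg_zero], by rw [map_neg, h2]; rfl⟩

theorem Cart.sub (h : Cart p η ω) (h' : Cart p η' ω') : Cart p (η - η') (ω - ω') := by
  rw [sub_eq_add_neg, sub_eq_add_neg]; exact h.add h'.neg

theorem Cart.mul (h : Cart p η ω) (h' : Cart p η' ω') : Cart p (η * η') (ω * ω') := by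
  obtain ⟨h1, h2⟩ := h
  obtain ⟨h3, h4⟩ := h'
  exact ⟨by rw [extd_mul, h1, h3]; simp, by rw [map_mul, h2, h4]; rfl⟩

theorem Cart.fn (a : A) : Cart p (fn a : DiffForms k A) (SymplecticFrobenius.fn (a ^ p)) :=
  ⟨_, invCartier_fn k p a⟩

theorem Cart.dd (a : A) : Cart p (dd a : DiffForms k A)
    (SymplecticFrobenius.fn (a ^ (p - 1)) * SymplecticFrobenius.dd a) :=
  ⟨_, invCartier_dd k p a⟩

theorem Cart.zero : Cart p (0 : DiffForms k A) 0 :=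
  ⟨map_zero _, by rw [map_zero]; rfl⟩

theorem Cart.one : Cart p (1 : DiffForms k A) 1 := by
  simpa using Cart.fn (k := k) (p := p) (1 : A)

theorem Cart.fn_mul (a : A) (h : Cart p η ω) :
    Cart p (SymplecticFrobenius.fn a * η) (SymplecticFrobenius.fn (a ^ p) * ω) :=
  (Cart.fn a).mul h

theorem Cart.sum {ι : Type*} (s : Finset ι) {η ω : ι → DiffForms k A}
    (h : ∀ i ∈ s, Cart p (η i) (ω i)) : Cart p (∑ i ∈ s, η i) (∑ i ∈ s, ω i) := by
  classical
  induction s using Finset.induction_on with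
  | empty => exact .zero
  | insert i s hi ih =>
    rw [Finset.sum_insert hi, Finset.sum_insert hi]
    exact (h i (Finset.mem_insert_self i s)).add (ih fun j hj => h j (Finset.mem_insert_of_mem hj))

theorem Cart.of_exact (y : DiffForms k A) : Cart p 0 (extd k A y) :=
  ⟨extd_extd y, by rw [map_zero]; exact (deRhamClass_eq (extd_extd y) (map_zero _) y
    (sub_zero _).symm).symm⟩

theorem Cart.add_exact (h : Cart p η ω) (y : DiffForms k A) : Cart p η (ω + extd k A y) := by
  simpa using h.add (Cart.of_exact (p := p) y)

theorem Cart.exact_sub (h : Cart p η ω) (h' : Cart p η ω') : ∃ y, extd k A y = ω - ω' := by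
  obtain ⟨h1, h2⟩ := h
  obtain ⟨h3, h4⟩ := h'
  exact (deRhamClass_eq_iff h1 h3).1 (h2.symm.trans h4)

theorem Cart.exact (h : Cart p 0 ω) : ∃ y, extd k A y = ω := by
  simpa using h.exact_sub .zero

variable (p) in
theorem Cart.exists_one (m : Ω[A⁄k]) :
    ∃ n, Cart p (ExteriorAlgebra.ι A m) (ExteriorAlgebra.ι A n) := by
  refine one_form_induction (P := fun x => ∃ n, Cart p x (ExteriorAlgebra.ι A n))
    ⟨0, by rw [map_zero]; exact .zero⟩ (fun a => ?_) (fun a m h => ?_) (fun m n h1 h2 => ?_) m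
  · refine ⟨a ^ (p - 1) • KaehlerDifferential.D k A a, ?_⟩
    rw [map_smul, Algebra.smul_def]
    exact .dd a
  · obtain ⟨n, hn⟩ := h
    refine ⟨a ^ p • n, ?_⟩
    rw [map_smul, Algebra.smul_def]
    exact hn.fn_mul a
  · obtain ⟨m', hm⟩ := h1
    obtain ⟨n', hn⟩ := h2
    exact ⟨m' + n', by rw [map_add]; exact hm.add hn⟩

-- Needed for the compatibility of `C` with degrees: the class of a homogeneous form under the
-- inverse Cartier operator has a representative of the same degree.
variable (p) in
theorem Cart.exists_mem {n : ℕ} {η : DiffForms k A} (hη : η ∈ ⋀[A]^n Ω[A⁄k]) :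
    ∃ ω ∈ ⋀[A]^n Ω[A⁄k], Cart p η ω := by
  induction n generalizing η with
  | zero =>
    rw [ExteriorAlgebra.exteriorPower, pow_zero] at hη
    obtain ⟨r, rfl⟩ := Submodule.mem_one.1 hη
    exact ⟨_, fn_mem _, .fn r⟩
  | succ n ih =>
    rw [ExteriorAlgebra.exteriorPower, pow_succ] at hη
    induction hη using Submodule.mul_induction_on' with
    | mem_mul_mem a ha b hb =>
      obtain ⟨z, rfl⟩ := hb
      obtain ⟨w, hw, h1⟩ := ih ha
      obtain ⟨z', h2⟩ := Cart.exists_one p z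
      exact ⟨_, mul_mem_add hw (ι_mem_one z'), h1.mul h2⟩
    | add x _ y _ hx hy =>
      obtain ⟨x', hx', h1⟩ := hx
      obtain ⟨y', hy', h2⟩ := hy
      exact ⟨_, Submodule.add_mem _ hx' hy', h1.add h2⟩

/-- Lifting the homogeneous parts of `η` separately gives one representative for which the claim is
clear. Any other differs from it by an exact form, whose homogeneous parts are exact. -/
theorem Cart.pr (h : Cart p η ω) (n : ℕ) : Cart p (pr n η) (SymplecticFrobenius.pr n ω) := by
  have key : ∃ ω', Cart p η ω' ∧ Cart p (SymplecticFrobenius.pr n η)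
      (SymplecticFrobenius.pr n ω') := by
    clear h
    induction η using homogeneous_induction with
    | h0 => exact ⟨0, .zero, by rw [map_zero]; exact .zero⟩
    | hm m x hx =>
      obtain ⟨w, hw, h1⟩ := Cart.exists_mem p hx
      refine ⟨w, h1, ?_⟩
      by_cases e : m = n
      · subst e; rwa [pr_of_mem hx, pr_of_mem hw]
      · rw [pr_of_mem_ne hx e, pr_of_mem_ne hw e]; exact .zero
    | ha x y hx hy =>
      obtain ⟨x', h1, h2⟩ := hx
      obtain ⟨y', h3, h4⟩ := hy
      exact ⟨_, h1.add h3, by rw [map_add, map_add]; exact h2.add h4⟩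
  obtain ⟨ω', h1, h2⟩ := key
  obtain ⟨y, hy⟩ := h.exact_sub h1
  obtain ⟨z, hz⟩ := exists_extd_eq_pr n y
  rw [← sub_add_cancel ω ω', map_add, ← hy, ← hz, add_comm]
  exact h2.add_exact z

/-- For a representative built from `a ^ p` and `a ^ (p - 1) da` this is immediate; pullback
commutes with `d`, so the exact ambiguity does no harm. -/
theorem Cart.pull {B : Type*} [CommRing B] [Algebra k B] (φ : A →ₐ[k] B) (h : Cart p η ω) :
    Cart p (pullForms φ η) (pullForms φ ω) := by
  have key : ∃ ω', Cart p η ω' ∧ Cart p (pullForms φ η) (pullForms φ ω') := by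
    clear h
    induction η using DiffForms.ind with
    | hf a =>
      refine ⟨_, .fn a, ?_⟩
      rw [pullForms_fn, pullForms_fn, map_pow]; exact .fn _
    | hd a =>
      refine ⟨_, .dd a, ?_⟩
      rw [map_mul, pullForms_fn, pullForms_dd, map_pow]; exact .dd _
    | hm x y hx hy =>
      obtain ⟨x', h1, h2⟩ := hx
      obtain ⟨y', h3, h4⟩ := hy
      exact ⟨_, h1.mul h3, by rw [map_mul, map_mul]; exact h2.mul h4⟩
    | ha x y hx hy =>
      obtain ⟨x', h1, h2⟩ := hx
      obtain ⟨y', h3, h4⟩ := hy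
      exact ⟨_, h1.add h3, by rw [map_add, map_add]; exact h2.add h4⟩
  obtain ⟨ω', h1, h2⟩ := key
  obtain ⟨y, hy⟩ := h.exact_sub h1
  rw [← sub_add_cancel ω ω', map_add, ← hy, pullForms_extd, add_comm]
  exact h2.add_exact _

end Cart

end Forms

/-! ### Lie derivatives, coordinates and the Cartier isomorphism -/

section

open Module

theorem end_mul_apply {M : Type*} [AddCommMonoid M] (f g : AddMonoid.End M) (x : M) :
    (f * g) x = f (g x) := rfl

section Lie

variable {k A : Type*} [CommRing k] [CommRing A] [Algebra k A]

theorem contr_signInv (θ : Dual A Ω[A⁄k]) (x : DiffForms k A) :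
    contr θ (signInv x) = - signInv (contr θ x) := by
  induction x using DiffForms.ind with
  | hf a => rw [inv_fn]; simp
  | hd a =>
    rw [inv_dd, map_neg, dd, contr_ι, AlgHom.commutes]
  | hm x y hx hy =>
    rw [map_mul, contr_mul, contr_mul, hx, hy, map_add, map_mul, map_mul]
    simp only [mul_neg, neg_mul, neg_add]
  | ha x y hx hy => simp only [map_add, hx, hy, neg_add]

/-- The Lie derivative along a vector field. -/
def lie (θ : Dual A Ω[A⁄k]) : AddMonoid.End (DiffForms k A) :=
  (extd k A).comp (contr θ).toAddMonoidHom + (contr θ).toAddMonoidHom.comp (extd k A)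

theorem lie_apply (θ : Dual A Ω[A⁄k]) (x : DiffForms k A) :
    lie θ x = extd k A (contr θ x) + contr θ (extd k A x) := rfl

theorem lie_mul (θ : Dual A Ω[A⁄k]) (x y : DiffForms k A) :
    lie θ (x * y) = lie θ x * y + x * lie θ y := by
  have h (z : DiffForms k A) : signInv (signInv z) = z := CliffordAlgebra.involute_involute z
  simp only [lie_apply, contr_mul, extd_mul, map_add]
  simp only [show ∀ z : DiffForms k A, extInv z = signInv z from fun _ => rfl, extd_inv,
    contr_signInv, h, add_mul, mul_add, neg_mul]
  abel

theorem lie_extd (θ : Dual A Ω[A⁄k]) (x : DiffForms k A) :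
    lie θ (extd k A x) = extd k A (lie θ x) := by
  simp [lie_apply, extd_extd]

theorem lie_fn (θ : Dual A Ω[A⁄k]) (a : A) :
    lie θ (fn a) = fn (θ (KaehlerDifferential.D k A a)) := by
  rw [lie_apply, extd_fn, dd, contr_ι, CliffordAlgebra.contractLeft_algebraMap, map_zero, zero_add]

theorem lie_dd (θ : Dual A Ω[A⁄k]) (a : A) :
    lie θ (dd a) = dd (θ (KaehlerDifferential.D k A a)) := by
  rw [lie_apply, extd_dd, dd, contr_ι, map_zero, add_zero]
  exact extd_fn _

end Lie

/-- Coordinates on an algebra in characteristic `p`: the differentials of the coordinates are a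
basis of the Kähler differentials, and the monomials of degree less than `p` in each coordinate
generate the algebra over its `p`-th powers. -/
structure Coords (k A : Type*) [CommRing k] [CommRing A] [Algebra k A] (p d : ℕ) where
  /-- the coordinate functions -/
  x : Fin d → A
  /-- the basis formed by the differentials of the coordinates -/
  basis : Basis (Fin d) A Ω[A⁄k]
  basis_apply : ∀ i, basis i = KaehlerDifferential.D k A (x i)
  span : ∀ a : A, ∃ c : (Fin d → Fin p) → A, a = ∑ I, c I ^ p * ∏ i, x i ^ (I i : ℕ)

namespace Coords

variable {k A : Type*} [CommRing k] [CommRing A] [Algebra k A] {p d : ℕ} [hp : Fact p.Prime]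
  [CharP k p] (C : Coords k A p d)

/-- The exterior product of the differentials of the coordinates in `s`. -/
abbrev e (s : Finset (Fin d)) : DiffForms k A := C.basis.ExteriorAlgebra s

/-- The vector field `xᵢ ∂ᵢ`. -/
def euler (i : Fin d) : Dual A Ω[A⁄k] := C.x i • C.basis.coord i

theorem euler_D (i j : Fin d) : C.euler i (KaehlerDifferential.D k A (C.x j)) =
    (if j = i then 1 else 0) • C.x j := by
  rw [← C.basis_apply, euler, LinearMap.smul_apply, Basis.coord_apply, Basis.repr_self,
    Finsupp.single_apply]
  split_ifs with h
  · rw [h]; simp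
  · simp

/-- The form `x^I dx_s`. -/
def mono (I : Fin d → ℕ) (s : Finset (Fin d)) : DiffForms k A := fn (∏ i, C.x i ^ I i) * C.e s

theorem lie_e (i : Fin d) (s : Finset (Fin d)) :
    lie (C.euler i) (C.e s) = (if i ∈ s then 1 else 0) • C.e s := by
  have := derivation_basis C.basis (lie (C.euler i)) (lie_mul _) (fun j => if j = i then 1 else 0)
    (fun j => by
      rw [C.basis_apply]
      refine (lie_dd _ _).trans ?_
      rw [euler_D]
      split_ifs <;> simp [dd]) s
  rwa [Finset.sum_ite_eq'] at this

theorem euler_D_prod (i : Fin d) (I : Fin d → ℕ) (s : Finset (Fin d)) :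
    C.euler i (KaehlerDifferential.D k A (∏ j ∈ s, C.x j ^ I j)) =
      (if i ∈ s then I i else 0) • ∏ j ∈ s, C.x j ^ I j := by
  induction s using Finset.induction_on with
  | empty => simp
  | insert j s hj ih =>
    have h : C.euler i (KaehlerDifferential.D k A (C.x j ^ I j)) =
        (if j = i then I i else 0) • C.x j ^ I j := by
      rw [Derivation.leibniz_pow, map_nsmul, map_smul, euler_D]
      split_ifs with h
      · subst h
        rcases Nat.eq_zero_or_pos (I j) with h | h
        · simp [h]
        · rw [one_smul, smul_eq_mul, ← pow_succ, Nat.sub_add_cancel h]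
      · simp
    rw [Finset.prod_insert hj, Derivation.leibniz, map_add, map_smul, map_smul, ih, h]
    by_cases hi : j = i
    · subst hi; simp [hj]; ring
    · simp [hi, Ne.symm hi, mul_left_comm]

theorem lie_mono (i : Fin d) (I : Fin d → ℕ) (s : Finset (Fin d)) :
    lie (C.euler i) (C.mono I s) = (I i + if i ∈ s then 1 else 0) • C.mono I s := by
  rw [mono, lie_mul, lie_e, lie_fn, euler_D_prod, if_pos (Finset.mem_univ i), add_smul, mul_smul_comm,
    show fn (I i • ∏ j, C.x j ^ I j) = I i • (fn (∏ j, C.x j ^ I j) : DiffForms k A) from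
      map_nsmul (algebraMap A (DiffForms k A)) _ _, smul_mul_assoc]

/-- Derivations kill `p`-th powers, so Lie derivatives are linear over them and weights can be read
off from monomials. -/
theorem lie_pow_mul (θ : Dual A Ω[A⁄k]) (c : A) (x : DiffForms k A) :
    lie θ (fn (c ^ p) * x) = fn (c ^ p) * lie θ x := by
  rw [lie_mul, lie_fn, Derivation.leibniz_pow, ← Nat.cast_smul_eq_nsmul A, natCast_eq_zero k A p]
  simp

/-- The projection to the part of weight zero for `xᵢ ∂ᵢ`. -/
def weightProj (i : Fin d) : AddMonoid.End (DiffForms k A) := 1 - lie (C.euler i) ^ (p - 1)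

theorem nsmul_eq_of_modEq {a b : ℕ} (h : a ≡ b [MOD p]) (x : DiffForms k A) : a • x = b • x := by
  have hx : p • x = 0 := by
    rw [← Nat.cast_smul_eq_nsmul A, natCast_eq_zero k A p, zero_smul]
  have key (a : ℕ) : a • x = (a % p) • x := by
    conv_lhs => rw [← Nat.mod_add_div a p, add_smul, mul_comm, mul_smul, hx, smul_zero, add_zero]
  rw [key a, key b, h]

/-- Fermat's little theorem: `w ^ (p - 1)` is `0` or `1` modulo `p`, and `p` annihilates forms. -/
theorem weightProj_of_eigen (i : Fin d) {w : ℕ} {x : DiffForms k A}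
    (h : lie (C.euler i) x = w • x) : C.weightProj i x = if p ∣ w then x else 0 := by
  have h1 (n : ℕ) : (lie (C.euler i) ^ n) x = (w ^ n) • x := by
    induction n with
    | zero => simp
    | succ n ih => rw [pow_succ', end_mul_apply, ih, map_nsmul, h, smul_smul, pow_succ]
  change x - (lie (C.euler i) ^ (p - 1)) x = _
  -- The exponent must be positive so that weight zero gives `0 ^ (p - 1) = 0` rather than `1`.
  have hp1 : p - 1 ≠ 0 := (Nat.sub_pos_of_lt hp.out.one_lt).ne'
  rw [h1]
  split_ifs with hw
  · rw [nsmul_eq_of_modEq (Nat.modEq_zero_iff_dvd.2 (hw.trans (dvd_pow_self w hp1)))]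
    simp
  · have : w ^ (p - 1) ≡ 1 [MOD p] := by
      rw [← Nat.totient_prime hp.out]
      exact Nat.ModEq.pow_totient ((Nat.Prime.coprime_iff_not_dvd hp.out).2 hw).symm
    rw [nsmul_eq_of_modEq this, one_smul, sub_self]

theorem weightProj_extd (i : Fin d) (x : DiffForms k A) :
    C.weightProj i (extd k A x) = extd k A (C.weightProj i x) := by
  have h (n : ℕ) : (lie (C.euler i) ^ n) (extd k A x) = extd k A ((lie (C.euler i) ^ n) x) := by
    induction n with
    | zero => rfl
    | succ n ih => rw [pow_succ', end_mul_apply, end_mul_apply, ih, lie_extd]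
  change extd k A x - (lie (C.euler i) ^ (p - 1)) (extd k A x) = extd k A (x - _)
  rw [h, map_sub]
  rfl

/-- By Cartan's formula the Lie derivative `L` of a closed form is `d` of its contraction, so `L ^
(p - 1) x` is `d` of the contraction of `L ^ (p - 2) x`. -/
theorem weightProj_homotopy (i : Fin d) {x : DiffForms k A} (hx : extd k A x = 0) :
    ∃ y, extd k A y = x - C.weightProj i x := by
  obtain ⟨n, hn⟩ : ∃ n, p - 1 = n + 1 :=
    ⟨p - 2, by have := hp.out.two_le; omega⟩
  have h : extd k A ((lie (C.euler i) ^ n) x) = 0 := by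
    clear hn
    induction n with
    | zero => exact hx
    | succ n ih => rw [pow_succ', end_mul_apply, ← lie_extd, ih, map_zero]
  refine ⟨contr (C.euler i) ((lie (C.euler i) ^ n) x), ?_⟩
  change _ = x - (x - (lie (C.euler i) ^ (p - 1)) x)
  rw [sub_sub_cancel, hn, pow_succ', end_mul_apply, lie_apply, h, map_zero, add_zero]

/-- The projection to the part of weight zero for all `xᵢ ∂ᵢ`. -/
def zeroProj : AddMonoid.End (DiffForms k A) := ((List.finRange d).map C.weightProj).prod

theorem zeroProj_extd (x : DiffForms k A) :
    C.zeroProj (extd k A x) = extd k A (C.zeroProj x) := by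
  have key (l : List (Fin d)) : (l.map C.weightProj).prod (extd k A x) =
      extd k A ((l.map C.weightProj).prod x) := by
    induction l with
    | nil => rfl
    | cons i l ih =>
      rw [List.map_cons, List.prod_cons, end_mul_apply, end_mul_apply, ih,
        weightProj_extd]
  exact key _

theorem zeroProj_homotopy {x : DiffForms k A} (hx : extd k A x = 0) :
    ∃ y, extd k A y = x - C.zeroProj x := by
  have key (l : List (Fin d)) : ∃ y, extd k A y = x - (l.map C.weightProj).prod x := by
    induction l with
    | nil => exact ⟨0, by simp⟩
    | cons i l ih =>
      obtain ⟨y, hy⟩ := ih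
      have h : extd k A ((l.map C.weightProj).prod x) = 0 := by
        rw [show (l.map C.weightProj).prod x = x - extd k A y by rw [hy]; abel, map_sub, hx,
          extd_extd, sub_zero]
      obtain ⟨z, hz⟩ := C.weightProj_homotopy i h
      refine ⟨y + z, ?_⟩
      rw [List.map_cons, List.prod_cons, end_mul_apply, map_add, hy, hz]; abel
  exact key _

theorem zeroProj_mono (c : A) (I : Fin d → ℕ) (s : Finset (Fin d)) :
    C.zeroProj (fn (c ^ p) * C.mono I s) =
      if ∀ i, p ∣ I i + if i ∈ s then 1 else 0 then fn (c ^ p) * C.mono I s else 0 := by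
  have h (i : Fin d) : C.weightProj i (fn (c ^ p) * C.mono I s) =
      if p ∣ I i + if i ∈ s then 1 else 0 then fn (c ^ p) * C.mono I s else 0 :=
    C.weightProj_of_eigen i (by rw [lie_pow_mul, lie_mono, mul_smul_comm])
  have key (l : List (Fin d)) : (l.map C.weightProj).prod (fn (c ^ p) * C.mono I s) =
      if ∀ i ∈ l, p ∣ I i + if i ∈ s then 1 else 0 then fn (c ^ p) * C.mono I s else 0 := by
    induction l with
    | nil => simp
    | cons i l ih =>
      rw [List.map_cons, List.prod_cons, end_mul_apply, ih]
      simp only [List.mem_cons, forall_eq_or_imp]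
      by_cases h1 : ∀ j ∈ l, p ∣ I j + if j ∈ s then 1 else 0
      · rw [if_pos h1, h]
        by_cases h2 : p ∣ I i + if i ∈ s then 1 else 0
        · rw [if_pos h2, if_pos ⟨h2, h1⟩]
        · rw [if_neg h2, if_neg fun h => h2 h.1]
      · rw [if_neg h1, if_neg (fun h => h1 h.2), map_zero]
  rw [zeroProj, key]
  simp

theorem mono_induction {P : DiffForms k A → Prop} (h0 : P 0)
    (hm : ∀ (c : A) (I : Fin d → Fin p) s, P (fn (c ^ p) * C.mono (fun i => I i) s))
    (ha : ∀ x y, P x → P y → P (x + y)) (x : DiffForms k A) : P x := by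
  rw [← C.basis.ExteriorAlgebra.sum_repr x]
  refine Finset.sum_induction _ P ha h0 fun s _ => ?_
  obtain ⟨c, hc⟩ := C.span (C.basis.ExteriorAlgebra.repr x s)
  rw [hc, Finset.sum_smul]
  refine Finset.sum_induction _ P ha h0 fun I _ => ?_
  have := hm (c I) I s
  rwa [mono, ← mul_assoc, ← fn_mul, ← Algebra.smul_def] at this

/-- The exponent `p - 1` at the elements of `s`. -/
def topExp (p : ℕ) (s : Finset (Fin d)) (i : Fin d) : ℕ := if i ∈ s then p - 1 else 0

theorem prod_topExp (s : Finset (Fin d)) :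
    ∏ i, C.x i ^ topExp p s i = ∏ i ∈ s, C.x i ^ (p - 1) := by
  simp only [topExp, pow_ite, pow_zero]
  rw [Finset.prod_ite_mem, Finset.univ_inter]

/-- A closed form representing the image of a form under the inverse Cartier operator. -/
def frobLift (η : DiffForms k A) : DiffForms k A :=
  ∑ s, fn (C.basis.ExteriorAlgebra.repr η s ^ p) * C.mono (topExp p s) s

theorem cart_e (s : Finset (Fin d)) : Cart p (C.e s) (C.mono (topExp p s) s) := by
  have key (l : List (Fin d)) :
      Cart p ((l.map fun j => ExteriorAlgebra.ι A (C.basis j)).prod)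
        (fn (l.map fun j => C.x j ^ (p - 1)).prod *
          (l.map fun j => ExteriorAlgebra.ι A (C.basis j)).prod) := by
    induction l with
    | nil => simpa using Cart.one
    | cons j l ih =>
      simp only [List.map_cons, List.prod_cons]
      have h : Cart p (ExteriorAlgebra.ι A (C.basis j)) _ :=
        (congrArg (fun z => Cart p (ExteriorAlgebra.ι A z) _) (C.basis_apply j)).mpr
          (Cart.dd (k := k) (p := p) (C.x j))
      have h2 := h.mul ih
      have e1 : (dd (C.x j) : DiffForms k A) = ExteriorAlgebra.ι A (C.basis j) := by
        rw [C.basis_apply]; rfl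
      rw [e1] at h2
      rw [fn_mul]
      convert h2 using 1
      simp only [mul_assoc]
      congr 1
      rw [← mul_assoc, ← mul_assoc, fn_comm]
  have := key s.sort
  rw [← basis_eq_list] at this
  rw [mono, prod_topExp, Finset.prod_eq_multiset_prod, ← s.sort_eq (· ≤ ·), Multiset.map_coe,
    Multiset.prod_coe]
  exact this

theorem cart_frobLift (η : DiffForms k A) : Cart p η (C.frobLift η) := by
  nth_rw 1 [← C.basis.ExteriorAlgebra.sum_repr η]
  refine Cart.sum _ fun s _ => ?_
  rw [Algebra.smul_def]
  exact (C.cart_e s).fn_mul _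

theorem topExp_dvd (s : Finset (Fin d)) (i : Fin d) :
    p ∣ topExp p s i + if i ∈ s then 1 else 0 := by
  rw [topExp]
  split_ifs
  · rw [Nat.sub_add_cancel hp.out.one_lt.le]
  · simp

theorem zeroProj_frobLift (η : DiffForms k A) : C.zeroProj (C.frobLift η) = C.frobLift η := by
  rw [frobLift, map_sum]
  exact Finset.sum_congr rfl fun s _ => by rw [zeroProj_mono, if_pos (topExp_dvd s)]

theorem frobLift_add (x y : DiffForms k A) :
    C.frobLift (x + y) = C.frobLift x + C.frobLift y := by
  rw [frobLift, frobLift, frobLift, ← Finset.sum_add_distrib]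
  refine Finset.sum_congr rfl fun s _ => ?_
  rw [map_add, Finsupp.add_apply, show (_ + _) ^ p = _ ^ p + _ ^ p from (powHom k A p).map_add _ _,
    fn_add, add_mul]

theorem frobLift_e (c : A) (s : Finset (Fin d)) :
    C.frobLift (fn c * C.e s) = fn (c ^ p) * C.mono (topExp p s) s := by
  rw [frobLift, Finset.sum_eq_single s]
  · rw [← Algebra.smul_def c, map_smul, Basis.repr_self]; simp
  · intro t _ ht
    rw [← Algebra.smul_def c, map_smul, Basis.repr_self, Finsupp.smul_apply,
      Finsupp.single_eq_of_ne ht, smul_zero, zero_pow hp.out.ne_zero]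
    simp
  · simp

/-- Only monomials `c ^ p x ^ I dx_s` of weight zero survive the projection, and these are the lifts
of `c dx_s`. -/
theorem exists_frobLift_eq (x : DiffForms k A) : ∃ η, C.frobLift η = C.zeroProj x := by
  induction x using C.mono_induction with
  | h0 => exact ⟨0, by simp [frobLift, zero_pow hp.out.ne_zero]⟩
  | hm c I s =>
    rw [zeroProj_mono]
    split_ifs with h
    · refine ⟨fn c * C.e s, ?_⟩
      rw [frobLift_e]
      -- From `I i < p` and `p ∣ I i + [i ∈ s]` it follows that `I i` is `p - 1` on `s` and `0`
      -- elsewhere.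
      congr 2
      ext i
      have h1 := h i
      have h2 := (I i).2
      rw [topExp]
      split_ifs at h1 ⊢ with hi
      · have := Nat.le_of_dvd (by omega) h1; omega
      · rw [add_zero] at h1
        exact (Nat.eq_zero_of_dvd_of_lt h1 h2).symm
    · exact ⟨0, by simp [frobLift, zero_pow hp.out.ne_zero]⟩
  | ha x y hx hy =>
    obtain ⟨η, h1⟩ := hx
    obtain ⟨η', h2⟩ := hy
    exact ⟨η + η', by rw [frobLift_add, h1, h2, map_add]⟩

-- Surjectivity in the Cartier isomorphism: a closed form is cohomologous to its weight zero part,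
-- which is a Frobenius lift.
include C in
theorem exists_cart {ω : DiffForms k A} (h : extd k A ω = 0) : ∃ η, Cart p η ω := by
  obtain ⟨y, hy⟩ := C.zeroProj_homotopy h
  obtain ⟨η, hη⟩ := C.exists_frobLift_eq ω
  refine ⟨η, ?_⟩
  have := (C.cart_frobLift η).add_exact y
  rwa [hη, hy, add_sub_cancel] at this

variable [IsDomain A]

theorem x_ne_zero (i : Fin d) : C.x i ≠ 0 := by
  intro h
  apply C.basis.ne_zero i
  rw [C.basis_apply, h, map_zero]

theorem eq_zero_of_frobLift {η : DiffForms k A} (h : C.frobLift η = 0) : η = 0 := by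
  refine C.basis.ExteriorAlgebra.ext_elem fun s => ?_
  have h1 := congrArg (fun z => C.basis.ExteriorAlgebra.repr z s) h
  simp only [frobLift, mono, ← Algebra.smul_def, smul_smul] at h1
  rw [Basis.repr_sum_self, map_zero, Finsupp.zero_apply, prod_topExp] at h1
  have h2 : ∏ i ∈ s, C.x i ^ (p - 1) ≠ 0 :=
    Finset.prod_ne_zero_iff.2 fun i _ => pow_ne_zero _ (C.x_ne_zero i)
  rw [map_zero, Finsupp.zero_apply]
  exact eq_zero_of_pow_eq_zero ((mul_eq_zero.1 h1).resolve_right h2)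

-- Injectivity in the Cartier isomorphism. If the lift of `η` equals `dy`, projecting to weight zero
-- gives `d` of the weight zero part of `y`. That part is itself a Frobenius lift, hence closed, so
-- the lift of `η` vanishes; comparing coefficients in a domain, `η` vanishes.
include C in
theorem cart_eq_zero {η : DiffForms k A} (h : Cart p η 0) : η = 0 := by
  obtain ⟨y, hy⟩ := (C.cart_frobLift η).exact_sub h
  rw [sub_zero] at hy
  obtain ⟨η', h'⟩ := C.exists_frobLift_eq y
  apply C.eq_zero_of_frobLift
  rw [← zeroProj_frobLift, ← hy, zeroProj_extd, ← h']
  exact (C.cart_frobLift η').1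

include C in
theorem cart_unique {η η' ω : DiffForms k A} (h : Cart p η ω) (h' : Cart p η' ω) : η = η' := by
  rw [← sub_eq_zero]
  apply C.cart_eq_zero (p := p)
  rw [← sub_self ω]
  exact h.sub h'

end Coords

end

/-! ### Volume forms and duality for the Frobenius in coordinates -/

section

open Module

section Volume

variable {k A : Type*} [CommRing k] [CommRing A] [Algebra k A]

theorem fn_zero : (fn (0 : A) : DiffForms k A) = 0 := map_zero _

theorem fn_one : (fn (1 : A) : DiffForms k A) = 1 := map_one _

theorem fn_sum {ι : Type*} (s : Finset ι) (a : ι → A) :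
    (fn (∑ i ∈ s, a i) : DiffForms k A) = ∑ i ∈ s, fn (a i) := map_sum _ _ _

/-- The form `ν` generates the module of forms of degree `d`. -/
def IsVolume (d : ℕ) (ν : DiffForms k A) : Prop :=
  ν ∈ ⋀[A]^d Ω[A⁄k] ∧ ∀ y ∈ ⋀[A]^d Ω[A⁄k], ∃ t : A, y = fn t * ν

theorem eq_zero_of_card_lt {R M I : Type*} [CommRing R] [AddCommGroup M] [Module R M]
    [LinearOrder I] [Fintype I] (b : Basis I R M) {n : ℕ} (hn : Fintype.card I < n)
    {x : ExteriorAlgebra R M} (hx : x ∈ ⋀[R]^n M) : x = 0 := by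
  rw [← pr_of_mem hx]
  have : (pr n : ExteriorAlgebra R M →ₗ[R] _) = 0 := by
    refine b.ExteriorAlgebra.ext fun s => ?_
    exact pr_of_mem_ne (basis_mem b s) (s.card_le_univ.trans_lt hn).ne
  rw [this]; rfl

end Volume

namespace Coords

variable {k A : Type*} [CommRing k] [CommRing A] [Algebra k A] {p d : ℕ} [hp : Fact p.Prime]
  [CharP k p] (C : Coords k A p d)

-- Since `d (∑ aᵢ dxᵢ) = ∑ daᵢ dxᵢ`, each factor is `1 + d (aᵢ dxᵢ)`, and `(1 + dy)(1 + dz) = 1 + d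
-- (y + z + y dz)`.
include C in
theorem exists_isExp_extd (m : Ω[A⁄k]) :
    ∃ E y : DiffForms k A, IsExp (extd k A (ExteriorAlgebra.ι A m)) E ∧ E = 1 + extd k A y := by
  rw [← C.basis.sum_repr m]
  refine Finset.sum_induction _ (fun m => ∃ E y : DiffForms k A,
    IsExp (extd k A (ExteriorAlgebra.ι A m)) E ∧ E = 1 + extd k A y) ?_ ?_ fun i _ => ?_
  · rintro m n ⟨E, y, h1, rfl⟩ ⟨F, z, h2, rfl⟩
    refine ⟨_, y + z + y * extd k A z, by rw [map_add, map_add]; exact h1.add h2, ?_⟩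
    rw [map_add, map_add, extd_mul, extd_extd, mul_zero, add_zero]
    noncomm_ring
  · exact ⟨1, 0, by rw [map_zero, map_zero]; exact .zero, by simp⟩
  · set a := C.basis.repr m i
    have h : extd k A (ExteriorAlgebra.ι A (a • C.basis i)) = dd a * dd (C.x i) := by
      rw [map_smul, Algebra.smul_def, C.basis_apply]
      change extd k A (fn a * dd _) = _
      rw [extd_mul, extd_fn, extd_dd, mul_zero, add_zero]
    exact ⟨_, ExteriorAlgebra.ι A (a • C.basis i), by rw [h]; exact .single _ _, by rw [h]; rfl⟩

-- `C` commutes with exponentials. Lifting the factors of `exp η` gives a `2`-form `ω'` with `C ω' =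
-- η` and `C (exp ω') = exp η`. Then `ω = ω' + dm` for a `1`-form `m`, and `exp (dm)` is `1` plus an
-- exact form, so it has image `1` and multiplicativity concludes.
include C in
theorem cart_exp {η ω F E : DiffForms k A} (h : Cart p η ω) (hω : ω ∈ ⋀[A]^2 Ω[A⁄k])
    (hF : IsExp η F) (hE : IsExp ω E) : Cart p F E := by
  have key : ∃ ω' E', IsExp ω' E' ∧ Cart p η ω' ∧ Cart p F E' := by
    clear h
    induction hF with
    | zero => exact ⟨0, 1, .zero, .zero, .one⟩
    | cons y z η F _ ih =>
      obtain ⟨ω', E', h1, h2, h3⟩ := ih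
      obtain ⟨y', hy⟩ := Cart.exists_one p y
      obtain ⟨z', hz⟩ := Cart.exists_one p z
      exact ⟨_, _, .cons y' z' _ _ h1, (hy.mul hz).add h2, (Cart.one.add (hy.mul hz)).mul h3⟩
  obtain ⟨ω', E', h1, h2, h3⟩ := key
  have h4 : ω' ∈ ⋀[A]^2 Ω[A⁄k] := by
    clear h2 h3
    induction h1 with
    | zero => exact Submodule.zero_mem _
    | cons y z ω E _ ih => exact Submodule.add_mem _ (mul_mem_add (ι_mem_one y) (ι_mem_one z)) ih
  obtain ⟨β, hβ⟩ := h.exact_sub h2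
  -- Taking degree two parts replaces the primitive `β` by its component of degree one.
  have h5 := congrArg (pr 2) hβ
  rw [pr_of_mem (Submodule.sub_mem _ hω h4), pr_extd 1] at h5
  obtain ⟨m, hm⟩ : ∃ m, ExteriorAlgebra.ι A m = pr 1 β := by
    have := pr_mem 1 β
    rwa [ExteriorAlgebra.exteriorPower, pow_one] at this
  rw [← hm] at h5
  obtain ⟨E₂, y, h6, rfl⟩ := C.exists_isExp_extd m
  have h7 := h1.add h6
  rw [h5, add_sub_cancel] at h7
  rw [hE.unique C.basis h7]
  simpa using h3.mul (Cart.one.add_exact y)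

/-- The volume form `dx₁ ⋯ dx_d`. -/
abbrev vol : DiffForms k A := C.e Finset.univ

theorem pr_eq (x : DiffForms k A) : pr d x = fn (topCoeff C.basis x) * C.vol := by
  have := pr_card C.basis x
  rwa [Fintype.card_fin, Algebra.smul_def] at this

theorem vol_mem : C.vol ∈ ⋀[A]^d Ω[A⁄k] := by
  simpa using basis_mem C.basis Finset.univ

theorem eq_fn_mul_vol {x : DiffForms k A} (hx : x ∈ ⋀[A]^d Ω[A⁄k]) :
    x = fn (topCoeff C.basis x) * C.vol := by
  rw [← C.pr_eq, pr_of_mem hx]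

theorem fn_mul_vol_injective {a b : A}
    (h : (fn a * C.vol : DiffForms k A) = fn b * C.vol) : a = b := by
  have := congrArg (topCoeff C.basis) h
  rw [← Algebra.smul_def, ← Algebra.smul_def, map_smul, map_smul, topCoeff_topVec] at this
  simpa using this

include C in
theorem extd_eq_zero_of_mem {x : DiffForms k A} (hx : x ∈ ⋀[A]^d Ω[A⁄k]) : extd k A x = 0 :=
  eq_zero_of_card_lt C.basis (by simp) (extd_mem d hx)

theorem exists_isUnit {ν : DiffForms k A} (h : IsVolume d ν) :
    ∃ u : A, IsUnit u ∧ ν = fn u * C.vol := by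
  refine ⟨_, ?_, C.eq_fn_mul_vol h.1⟩
  obtain ⟨t, ht⟩ := h.2 _ C.vol_mem
  rw [C.eq_fn_mul_vol h.1, ← mul_assoc, ← fn_mul] at ht
  have : 1 = t * topCoeff C.basis ν :=
    C.fn_mul_vol_injective (by rw [fn_one, one_mul]; exact ht)
  exact IsUnit.of_mul_eq_one_right _ this.symm

theorem isVolume_fn_mul {u : A} (hu : IsUnit u) : IsVolume d (fn u * C.vol : DiffForms k A) := by
  refine ⟨fn_mul_mem _ C.vol_mem, fun y hy => ?_⟩
  obtain ⟨v, hv⟩ := hu.exists_left_inv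
  refine ⟨topCoeff C.basis y * v, ?_⟩
  rw [← mul_assoc, ← fn_mul, mul_assoc, hv, mul_one, ← C.eq_fn_mul_vol hy]

include C in
theorem isVolume_pr_exp {ω E : DiffForms k A} (hE : IsExp ω E)
    (h : ∀ m, ∃ θ : Dual A Ω[A⁄k], contr θ ω = ExteriorAlgebra.ι A m) : IsVolume d (pr d E) := by
  rw [C.pr_eq]
  exact C.isVolume_fn_mul (isUnit_topCoeff C.basis hE h)

include C in
theorem fn_mul_volume_injective {ν : DiffForms k A} (h : IsVolume d ν) {a b : A}
    (hab : fn a * ν = fn b * ν) : a = b := by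
  obtain ⟨u, hu, rfl⟩ := C.exists_isUnit h
  rw [← mul_assoc, ← mul_assoc, ← fn_mul, ← fn_mul] at hab
  exact hu.mul_left_injective (C.fn_mul_vol_injective hab)

-- Forms of top degree are closed, so `C` is defined on `s * μ`, and `ν` generates the module in
-- which the image lies.
include C in
theorem exists_cart_volume {ν μ : DiffForms k A} (hν : IsVolume d ν) (hμ : μ ∈ ⋀[A]^d Ω[A⁄k])
    (s : A) : ∃ t : A, Cart p (fn t * ν) (fn s * μ) := by
  have hs := fn_mul_mem s hμ
  obtain ⟨η, hη⟩ := C.exists_cart (p := p) (C.extd_eq_zero_of_mem hs)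
  have h1 := hη.pr d
  rw [pr_of_mem hs] at h1
  obtain ⟨t, ht⟩ := hν.2 _ (pr_mem d η)
  exact ⟨t, by rwa [← ht]⟩

/-- The monomial has nonzero weight for `xᵢ ∂ᵢ`, so the homotopy exhibits it as exact. -/
theorem cart_zero_mono {I : Fin d → ℕ} {i : Fin d} (hi : ¬ p ∣ I i + 1) :
    Cart p 0 (C.mono I Finset.univ) := by
  have h : C.weightProj i (C.mono I Finset.univ) = 0 := by
    rw [C.weightProj_of_eigen i (C.lie_mono i I Finset.univ), if_pos (Finset.mem_univ i), if_neg hi]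
  obtain ⟨y, hy⟩ := C.weightProj_homotopy i (C.extd_eq_zero_of_mem (fn_mul_mem _ C.vol_mem))
    (x := C.mono I Finset.univ)
  rw [h, sub_zero] at hy
  rw [← hy]
  exact .of_exact y

theorem cart_vol : Cart p C.vol (fn (∏ i, C.x i ^ (p - 1)) * C.vol) := by
  have := C.cart_e Finset.univ
  rwa [mono, prod_topExp] at this

/-- Under the pairing `(s, t) ↦ C (s t vol) / vol` the monomials `x ^ (p - 1 - I)` are dual to the
`x ^ J`. -/
theorem cart_mono (I J : Fin d → Fin p) (a : A) :
    Cart p (fn (if I = J then a else 0) * C.vol)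
      (fn (a ^ p * ((∏ i, C.x i ^ (p - 1 - (I i : ℕ))) * ∏ i, C.x i ^ (J i : ℕ))) * C.vol) := by
  have e : (∏ i, C.x i ^ (p - 1 - (I i : ℕ))) * ∏ i, C.x i ^ (J i : ℕ) =
      ∏ i, C.x i ^ (p - 1 - (I i : ℕ) + J i) := by
    simp only [pow_add, Finset.prod_mul_distrib]
  rw [e, fn_mul, mul_assoc]
  split_ifs with h
  · subst h
    refine Cart.fn_mul a ?_
    have h (i : Fin d) : p - 1 - (I i : ℕ) + I i = p - 1 := Nat.sub_add_cancel (by omega)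
    simp only [h]
    exact C.cart_vol
  · obtain ⟨i, hi⟩ := Function.ne_iff.1 h
    -- The number equals `p - I i + J i`, which lies strictly between `0` and `2p`; divisibility
    -- would force `I i = J i`.
    have h0 : ¬ p ∣ p - 1 - (I i : ℕ) + J i + 1 := by
      rintro ⟨c, hc⟩
      have h1 := (I i).2
      have h2 := (J i).2
      have h3 : (I i : ℕ) ≠ J i := fun h => hi (Fin.ext h)
      rcases c with _ | _ | c
      · omega
      · omega
      · rw [show p * (c + 1 + 1) = p * c + p + p by ring] at hc
        omega
    have := (C.cart_zero_mono (I := fun i => p - 1 - (I i : ℕ) + J i) h0).fn_mul a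
    rw [fn_zero, zero_mul]
    rwa [mul_zero] at this

/-- An inverse-Frobenius linear map is determined by its values on the monomials `x ^ I`; the
witness is the expansion with these values along the dual monomials `x ^ (p - 1 - I)`. -/
theorem exists_dual_vol (ψ : A →+ A) (hψ : ∀ a s, ψ (a ^ p * s) = a * ψ s) :
    ∃ g : A, ∀ s, Cart p (fn (ψ s) * C.vol) (fn (g * s) * C.vol) := by
  refine ⟨∑ I : Fin d → Fin p,
    (ψ (∏ i, C.x i ^ (I i : ℕ)) ^ p * ∏ i, C.x i ^ (p - 1 - (I i : ℕ))), fun s => ?_⟩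
  obtain ⟨c, rfl⟩ := C.span s
  rw [map_sum, fn_sum, Finset.mul_sum, fn_sum, Finset.sum_mul, Finset.sum_mul]
  simp only [hψ]
  refine Cart.sum _ fun J _ => ?_
  have h1 (I : Fin d → Fin p) := (C.cart_mono I J (ψ (∏ i, C.x i ^ (I i : ℕ)))).fn_mul (c J)
  have h2 := Cart.sum Finset.univ fun I _ => h1 I
  rw [Finset.sum_mul, fn_sum, Finset.sum_mul]
  convert h2 using 1
  · rw [Finset.sum_eq_single J]
    · rw [if_pos rfl, fn_mul, mul_assoc]
    · intro I _ hI
      rw [if_neg hI, fn_zero, zero_mul, mul_zero]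
    · simp
  · refine Finset.sum_congr rfl fun I _ => ?_
    rw [← mul_assoc (_ : DiffForms k A), ← fn_mul]
    congr 2
    ring

-- For `μ = u vol` apply the previous case to `u ψ`, and divide the resulting multiplier by `u`.
include C in
theorem exists_dual {μ : DiffForms k A} (hμ : IsVolume d μ) (ψ : A →+ A)
    (hψ : ∀ a s, ψ (a ^ p * s) = a * ψ s) :
    ∃ g : A, ∀ s, Cart p (fn (ψ s) * μ) (fn (g * s) * μ) := by
  obtain ⟨u, hu, rfl⟩ := C.exists_isUnit hμ
  obtain ⟨g, hg⟩ := C.exists_dual_vol ((AddMonoidHom.mulLeft u).comp ψ) fun a s => by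
    simp [hψ, mul_left_comm]
  obtain ⟨v, hv⟩ := hu.exists_left_inv
  refine ⟨g * v, fun s => ?_⟩
  rw [← mul_assoc, ← mul_assoc, ← fn_mul, ← fn_mul]
  convert hg s using 3
  · simp [mul_comm]
  · rw [show g * v * s * u = g * s * (v * u) by ring, hv, mul_one]

-- Nondegeneracy of the pairing, tested only on a set that contains every element up to
-- multiplication by a nonzero `p`-th power. This yields uniqueness of multipliers at the generic
-- point from tests on regular functions.
include C in
theorem eq_zero_of_cart_zero [IsDomain A] {μ : DiffForms k A} (hμ : IsVolume d μ) {S : Set A}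
    (hS : ∀ a : A, ∃ b : A, b ≠ 0 ∧ a * b ^ p ∈ S) {h : A}
    (H : ∀ s ∈ S, Cart p 0 (fn (h * s) * μ)) : h = 0 := by
  obtain ⟨u, hu, rfl⟩ := C.exists_isUnit hμ
  obtain ⟨v, hv⟩ := hu.exists_left_inv
  -- With `v` the inverse of `u`, this test function makes `h s μ` equal to `(h b) ^ p ∏ xᵢ ^ (p -
  -- 1) vol`, on which `C` takes the value `h b vol`.
  obtain ⟨b, hb, hs⟩ := hS (h ^ (p - 1) * (∏ i, C.x i ^ (p - 1)) * v)
  have h1 := H _ hs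
  have h2 := C.cart_vol.fn_mul (h * b)
  have e : fn (h * (h ^ (p - 1) * (∏ i, C.x i ^ (p - 1)) * v * b ^ p)) * (fn u * C.vol) =
      fn ((h * b) ^ p) * (fn (∏ i, C.x i ^ (p - 1)) * C.vol) := by
    rw [← mul_assoc (_ : DiffForms k A), ← mul_assoc (_ : DiffForms k A), ← fn_mul, ← fn_mul]
    congr 2
    obtain ⟨n, rfl⟩ : ∃ n, p = n + 1 := ⟨p - 1, (Nat.succ_pred hp.out.ne_zero).symm⟩
    rw [Nat.add_sub_cancel]
    calc _ = h ^ (n + 1) * b ^ (n + 1) * (∏ i, C.x i ^ n) * (v * u) := by ring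
      _ = _ := by rw [hv]; ring
  rw [e] at h1
  have h3 := C.cart_unique h2 h1
  have h4 : h * b = 0 := C.fn_mul_vol_injective (by rw [h3, fn_zero, zero_mul])
  exact (mul_eq_zero.1 h4).resolve_right hb

include C in
theorem eq_zero_of_fn_mul [IsDomain A] {x : DiffForms k A} (hx : x ≠ 0) {a : A}
    (h : fn a * x = 0) : a = 0 := by
  by_contra ha
  apply hx
  refine C.basis.ExteriorAlgebra.ext_elem fun s => ?_
  have := congrArg (fun z => C.basis.ExteriorAlgebra.repr z s) h
  simp only [← Algebra.smul_def, map_smul, Finsupp.smul_apply, map_zero, Finsupp.zero_apply,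
    smul_eq_mul] at this
  rw [map_zero, Finsupp.zero_apply]
  exact (mul_eq_zero.1 this).resolve_left ha

end Coords

end

/-! ### Existence of coordinates, and localization of forms -/

section

open Module TensorProduct

section PBasis

variable {k A : Type*} [Field k] [CommRing A] [Algebra k A] (p : ℕ) [hp : Fact p.Prime]
  [CharP k p]

/-- Division with remainder by `p` in each exponent moves the surplus of a monomial into a `p`-th
power; hence the sums in question are closed under products. -/
theorem exists_pow_sum_of_adjoin {d : ℕ} (x : Fin d → A)
    (h : ∀ a : A, a ∈ Algebra.adjoin (powHom k A p).range (Set.range x)) (a : A) :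
    ∃ c : (Fin d → Fin p) → A, a = ∑ I, c I ^ p * ∏ i, x i ^ (I i : ℕ) := by
  classical
  let Q : A → Prop := fun a => ∃ c : (Fin d → Fin p) → A, a = ∑ I, c I ^ p * ∏ i, x i ^ (I i : ℕ)
  have hadd (a b : A) (ha : Q a) (hb : Q b) : Q (a + b) := by
    obtain ⟨c, rfl⟩ := ha
    obtain ⟨c', rfl⟩ := hb
    refine ⟨fun I => c I + c' I, ?_⟩
    rw [← Finset.sum_add_distrib]
    refine Finset.sum_congr rfl fun I _ => ?_
    rw [show (c I + c' I) ^ p = c I ^ p + c' I ^ p from (powHom k A p).map_add _ _, add_mul]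
  have hpow (a b : A) (hb : Q b) : Q (a ^ p * b) := by
    obtain ⟨c, rfl⟩ := hb
    exact ⟨fun I => a * c I, by simp only [Finset.mul_sum, mul_pow, mul_assoc]⟩
  have hmono (n : Fin d → ℕ) : Q (∏ i, x i ^ n i) := by
    have h1 : ∏ i, x i ^ n i = (∏ i, x i ^ (n i / p)) ^ p * ∏ i, x i ^ (n i % p) := by
      rw [← Finset.prod_pow, ← Finset.prod_mul_distrib]
      refine Finset.prod_congr rfl fun i _ => ?_
      rw [← pow_mul, ← pow_add, mul_comm, Nat.div_add_mod]
    rw [h1]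
    refine hpow _ _ ⟨Pi.single (fun i => ⟨n i % p, Nat.mod_lt _ hp.out.pos⟩) 1, ?_⟩
    rw [Finset.sum_eq_single fun i => (⟨n i % p, Nat.mod_lt _ hp.out.pos⟩ : Fin p)]
    · simp
    · intro J _ hJ
      rw [Pi.single_eq_of_ne hJ, zero_pow hp.out.ne_zero, zero_mul]
    · simp
  have hzero : Q 0 := ⟨0, by simp [zero_pow hp.out.ne_zero]⟩
  have hmul (a b : A) (ha : Q a) (hb : Q b) : Q (a * b) := by
    obtain ⟨c, rfl⟩ := ha
    obtain ⟨c', rfl⟩ := hb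
    rw [Finset.sum_mul_sum]
    refine Finset.sum_induction _ Q hadd hzero fun I _ =>
      Finset.sum_induction _ Q hadd hzero fun J _ => ?_
    rw [show c I ^ p * ∏ i, x i ^ (I i : ℕ) = c I ^ p * ∏ i, x i ^ (I i : ℕ) from rfl,
      mul_mul_mul_comm, ← mul_pow, ← Finset.prod_mul_distrib]
    simp only [← pow_add]
    exact hpow _ _ (hmono _)
  induction h a using Algebra.adjoin_induction with
  | mem y hy =>
    obtain ⟨i, rfl⟩ := hy
    have := hmono (Pi.single i 1)
    rwa [Finset.prod_eq_single i, Pi.single_eq_same, pow_one] at this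
    · intro j _ hj; rw [Pi.single_eq_of_ne hj, pow_zero]
    · simp
  | algebraMap r =>
    obtain ⟨_, b, rfl⟩ := r
    have h1 := hpow b _ (hmono 0)
    change Q (b ^ p)
    simpa using h1
  | add a b _ _ ha hb => exact hadd a b ha hb
  | mul a b _ _ ha hb => exact hmul a b ha hb

variable [PerfectField k]

/-- Let `S` be generated by the `p`-th powers and the `x i`. Perfectness puts `k` inside `S`, so `A`
is of finite type and integral over `S`, hence finite. As the `dxᵢ` generate, `Ω[A⁄S] = 0`, so the
kernel of `A ⊗ A → A` is an idempotent ideal. It is also nil, since `1 ⊗ b - b ⊗ 1` has `p`-th power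
zero, and so it vanishes. A finite epimorphism is surjective, which gives `S = A`. -/
theorem mem_adjoin_pow [Algebra.FiniteType k A] {d : ℕ} (x : Fin d → A)
    (hx : Submodule.span A (Set.range fun i => KaehlerDifferential.D k A (x i)) = ⊤) (a : A) :
    a ∈ Algebra.adjoin (powHom k A p).range (Set.range x) := by
  have hk (r : k) : algebraMap k A r ∈ (powHom k A p).range := by
    have : PerfectRing k p := PerfectField.toPerfectRing p
    obtain ⟨s, hs⟩ := surjective_frobenius k p r
    refine ⟨algebraMap k A s, ?_⟩
    rw [← hs]
    exact (map_pow (algebraMap k A) s p).symm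
  set S := Algebra.adjoin (powHom k A p).range (Set.range x) with hS
  have hkS (r : k) : algebraMap k A r ∈ S := S.algebraMap_mem ⟨_, hk r⟩
  let : Algebra k S := ((algebraMap k A).codRestrict S.toSubring hkS).toAlgebra
  have : IsScalarTower k S A := IsScalarTower.of_algebraMap_eq fun _ => rfl
  have : Algebra.FiniteType S A := Algebra.FiniteType.of_restrictScalars_finiteType k S A
  have hpS (b : A) : b ^ p ∈ S := S.algebraMap_mem ⟨_, b, rfl⟩
  have : Algebra.IsIntegral S A :=
    ⟨fun b => .of_pow hp.out.pos (isIntegral_algebraMap (x := (⟨_, hpS b⟩ : S)))⟩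
  have : Module.Finite S A := Algebra.IsIntegral.finite
  have hΩ : Subsingleton Ω[A⁄S] := by
    have h0 : KaehlerDifferential.map k S A A = 0 := by
      refine LinearMap.ext_on_range hx fun i => ?_
      rw [KaehlerDifferential.map_D, LinearMap.zero_apply]
      exact (KaehlerDifferential.D S A).map_algebraMap
        (⟨x i, Algebra.subset_adjoin ⟨i, rfl⟩⟩ : S)
    refine ⟨fun u v => ?_⟩
    obtain ⟨u, rfl⟩ := KaehlerDifferential.map_surjective k S A u
    obtain ⟨v, rfl⟩ := KaehlerDifferential.map_surjective k S A v
    rw [h0]; rfl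
  have hid : IsIdempotentElem (KaehlerDifferential.ideal S A) :=
    (Ideal.cotangent_subsingleton_iff _).1 hΩ
  -- A finitely generated idempotent ideal is generated by an idempotent, and a nilpotent idempotent
  -- is zero.
  obtain ⟨e, he, hI⟩ :=
    (Ideal.isIdempotentElem_iff_of_fg _ (KaehlerDifferential.ideal_fg S A)).1 hid
  have hnil : KaehlerDifferential.ideal S A ≤ nilradical (A ⊗[S] A) := by
    rw [← KaehlerDifferential.span_range_eq_ideal, Ideal.span_le]
    rintro _ ⟨b, rfl⟩
    refine ⟨p, ?_⟩
    have h1 : (1 ⊗ₜ[S] b - b ⊗ₜ[S] 1 : A ⊗[S] A) ^ p = (1 ⊗ₜ[S] b) ^ p - (b ⊗ₜ[S] 1) ^ p :=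
      (powHom k (A ⊗[S] A) p).map_sub _ _
    rw [h1, Algebra.TensorProduct.tmul_pow, Algebra.TensorProduct.tmul_pow, one_pow]
    have h2 : b ^ p = (⟨_, hpS b⟩ : S) • (1 : A) := by
      rw [Subalgebra.smul_def, smul_eq_mul, mul_one]
    rw [h2, TensorProduct.tmul_smul, TensorProduct.smul_tmul', sub_self]
    exact Submodule.zero_mem _
  have he0 : e = 0 := by
    have : e ∈ KaehlerDifferential.ideal S A := by rw [hI]; exact Ideal.mem_span_singleton_self e
    obtain ⟨n, hn⟩ := hnil this
    rcases n with _ | n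
    · rw [pow_zero] at hn; rw [← mul_one e, hn, mul_zero]
    · rwa [he.pow_succ_eq] at hn
  have hepi : Algebra.IsEpi S A := by
    rw [Algebra.isEpi_iff_forall_one_tmul_eq]
    intro b
    rw [← sub_eq_zero, ← Submodule.mem_bot (A ⊗[S] A)]
    have h1 : (1 ⊗ₜ[S] b - b ⊗ₜ[S] 1 : A ⊗[S] A) ∈ KaehlerDifferential.ideal S A :=
      KaehlerDifferential.one_smul_sub_smul_one_mem_ideal S b
    rw [hI, he0] at h1
    simpa using h1
  obtain ⟨b, hb⟩ := Algebra.isEpi_iff_surjective_algebraMap_of_finite.1 hepi a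
  rw [← hb]
  exact b.2

theorem nonempty_coords_of_isStandardSmooth [Algebra.IsStandardSmooth k A] :
    ∃ d, Nonempty (Coords k A p d) := by
  obtain ⟨ι, σ, _, _, ⟨P⟩⟩ := ‹Algebra.IsStandardSmooth k A›.out
  have : Fintype ((Set.range P.map)ᶜ : Set ι) := Fintype.ofFinite _
  let e := Fintype.equivFin ((Set.range P.map)ᶜ : Set ι)
  have hb (i) : P.basisKaehler.reindex e i = KaehlerDifferential.D k A (P.val (e.symm i)) := by
    rw [Basis.reindex_apply, Algebra.SubmersivePresentation.basisKaehler_apply]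
  refine ⟨_, ⟨⟨fun i => P.val (e.symm i), P.basisKaehler.reindex e, hb,
    exists_pow_sum_of_adjoin p _ (mem_adjoin_pow (k := k) p _ ?_)⟩⟩⟩
  rw [← (P.basisKaehler.reindex e).span_eq]
  congr 2
  ext i
  rw [hb]

end PBasis

section Localization

variable {k A B : Type*} [CommRing k] [CommRing A] [CommRing B] [Algebra k A] [Algebra k B]
  {p d : ℕ} [hp : Fact p.Prime]

/-- Coordinates on a localization. -/
def Coords.localization (C : Coords k A p d) [Algebra A B] [IsScalarTower k A B] (M : Submonoid A)
    [IsLocalization M B] : Coords k B p d where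
  x i := algebraMap A B (C.x i)
  basis := C.basis.ofIsLocalizedModule B M (KaehlerDifferential.map k k A B)
  basis_apply i := by
    rw [Basis.ofIsLocalizedModule_apply, C.basis_apply, KaehlerDifferential.map_D]
  span b := by
    obtain ⟨a, s, rfl⟩ := IsLocalization.exists_mk'_eq M b
    -- The denominator must be a `p`-th power: `a / s = a s ^ (p - 1) / s ^ p`.
    obtain ⟨c, hc⟩ := C.span (a * s ^ (p - 1))
    refine ⟨fun I => IsLocalization.mk' B (c I) s, ?_⟩
    have hu : IsUnit (algebraMap A B s ^ p) := (IsLocalization.map_units B s).pow p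
    rw [← hu.mul_left_inj, Finset.sum_mul]
    have h1 : IsLocalization.mk' B a s * algebraMap A B s ^ p =
        algebraMap A B (a * s ^ (p - 1)) := by
      conv_lhs => rw [← Nat.sub_add_cancel hp.out.one_lt.le, pow_succ', ← mul_assoc,
        IsLocalization.mk'_spec]
      rw [map_mul, map_pow]
    rw [h1, hc, map_sum]
    refine Finset.sum_congr rfl fun I _ => ?_
    rw [mul_right_comm, ← mul_pow, IsLocalization.mk'_spec, map_mul, map_prod, map_pow]
    simp only [map_pow]

theorem exteriorAlgebra_repr_map {R S I : Type*} [CommRing R] [CommRing S]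
    {M N : Type*} [AddCommGroup M] [Module R M] [AddCommGroup N] [Module S N] [LinearOrder I]
    (φ : R →+* S) (b : Basis I R M) (b' : Basis I S N)
    (J : ExteriorAlgebra R M →+* ExteriorAlgebra S N)
    (h0 : ∀ r, J (algebraMap R _ r) = algebraMap S _ (φ r))
    (h1 : ∀ i, J (ExteriorAlgebra.ι R (b i)) = ExteriorAlgebra.ι S (b' i))
    (x : ExteriorAlgebra R M) (s : Finset I) :
    b'.ExteriorAlgebra.repr (J x) s = φ (b.ExteriorAlgebra.repr x s) := by
  induction b.ExteriorAlgebra.mem_span x using Submodule.span_induction with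
  | mem x hx =>
    obtain ⟨t, rfl⟩ := hx
    rw [ringHom_basis b b' J 1 (by simpa using h1)]
    by_cases hts : t = s
    · subst hts; simp
    · simp [hts]
  | zero => simp
  | add x y _ _ hx hy => simp only [map_add, Finsupp.add_apply, hx, hy]
  | smul r x _ hx =>
    rw [Algebra.smul_def, map_mul, h0, ← Algebra.smul_def, ← Algebra.smul_def, map_smul, map_smul,
      Finsupp.smul_apply, Finsupp.smul_apply, hx, smul_eq_mul, smul_eq_mul, map_mul]

theorem exteriorAlgebra_map_injective {R S I : Type*} [CommRing R] [CommRing S]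
    {M N : Type*} [AddCommGroup M] [Module R M] [AddCommGroup N] [Module S N] [LinearOrder I]
    {φ : R →+* S} (h : Function.Injective φ) (b : Basis I R M) (b' : Basis I S N)
    (J : ExteriorAlgebra R M →+* ExteriorAlgebra S N)
    (h0 : ∀ r, J (algebraMap R _ r) = algebraMap S _ (φ r))
    (h1 : ∀ i, J (ExteriorAlgebra.ι R (b i)) = ExteriorAlgebra.ι S (b' i)) :
    Function.Injective J := by
  rw [injective_iff_map_eq_zero]
  intro x hx
  refine b.ExteriorAlgebra.ext_elem fun s => h ?_
  rw [← exteriorAlgebra_repr_map φ b b' J h0 h1, hx]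
  simp

/-- For free modules injectivity is read off from coefficients. A projective `Ω[A⁄k]` is a direct
summand of a free module `F`; its exterior algebra embeds in that of `F`, and the section extends to
`B` because Kähler differentials commute with localization. -/
theorem pullForms_injective [Module.Projective A Ω[A⁄k]] [Algebra A B] [IsScalarTower k A B]
    (hφ : Function.Injective (algebraMap A B)) (M : Submonoid A) [IsLocalization M B] :
    Function.Injective (pullForms (IsScalarTower.toAlgHom k A B)) := by
  classical
  set φ := IsScalarTower.toAlgHom k A B
  have : Algebra.FormallyEtale A B := Algebra.FormallyEtale.of_isLocalization M
  let : LinearOrder Ω[A⁄k] := linearOrderOfSTO WellOrderingRel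
  obtain ⟨s, hs⟩ := Module.projective_def'.1 ‹Module.Projective A Ω[A⁄k]›
  let b : Basis Ω[A⁄k] A (Ω[A⁄k] →₀ A) := Finsupp.basisSingleOne
  let b' : Basis Ω[A⁄k] B (Ω[A⁄k] →₀ B) := Finsupp.basisSingleOne
  let j : (Ω[A⁄k] →₀ A) →ₗ[A] (Ω[A⁄k] →₀ B) := Finsupp.mapRange.linearMap (Algebra.linearMap A B)
  let J : ExteriorAlgebra A (Ω[A⁄k] →₀ A) →ₐ[A] ExteriorAlgebra B (Ω[A⁄k] →₀ B) :=
    ExteriorAlgebra.lift A ⟨((ExteriorAlgebra.ι B).restrictScalars A).comp j,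
      fun _ => ExteriorAlgebra.ι_sq_zero _⟩
  have hJι (m) : J (ExteriorAlgebra.ι A m) = ExteriorAlgebra.ι B (j m) :=
    ExteriorAlgebra.lift_ι_apply A (A := ExteriorAlgebra B (Ω[A⁄k] →₀ B))
      (((ExteriorAlgebra.ι B).restrictScalars A).comp j) (fun _ => ExteriorAlgebra.ι_sq_zero _) m
  have hJ : Function.Injective J := by
    refine exteriorAlgebra_map_injective hφ b b' J.toRingHom (fun r => J.commutes r) fun i => ?_
    refine (hJι _).trans ?_
    congr 1
    simp [j, b, b']
  have hbc := KaehlerDifferential.isBaseChange_of_formallyEtale k A B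
  let sB : Ω[B⁄k] →ₗ[B] (Ω[A⁄k] →₀ B) := hbc.lift (j.comp s)
  have hcomm : ((ExteriorAlgebra.map sB).toRingHom.comp (pullForms φ)) =
      J.toRingHom.comp (ExteriorAlgebra.map s).toRingHom := by
    refine DiffForms.ringHom_ext (fun a => ?_) fun a => ?_
    · rw [RingHom.comp_apply, pullForms_fn]
      change ExteriorAlgebra.map sB (algebraMap B _ _) = J (ExteriorAlgebra.map s (algebraMap A _ a))
      rw [AlgHom.commutes, AlgHom.commutes, AlgHom.commutes]
      rfl
    · rw [RingHom.comp_apply, pullForms_dd]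
      change ExteriorAlgebra.map sB (ExteriorAlgebra.ι B _) =
        J (ExteriorAlgebra.map s (ExteriorAlgebra.ι A _))
      rw [ExteriorAlgebra.map_apply_ι, ExteriorAlgebra.map_apply_ι, hJι]
      congr 1
      have := hbc.lift_eq (j.comp s) (KaehlerDifferential.D k A a)
      rwa [KaehlerDifferential.map_D] at this
  have hs' : Function.Injective (ExteriorAlgebra.map s) := by
    refine (ExteriorAlgebra.leftInverse_map_iff
      (g := Finsupp.linearCombination A id)).2 (fun m => ?_) |>.injective
    exact LinearMap.congr_fun hs m
  intro x y hxy
  apply hs'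
  apply hJ
  have h1 (z) : J (ExteriorAlgebra.map s z) = ExteriorAlgebra.map sB (pullForms φ z) :=
    (RingHom.congr_fun hcomm z).symm
  rw [h1, h1, hxy]

theorem exists_fn_pow_mul_eq_pullForms [Algebra A B] [IsScalarTower k A B] (f : A) [IsLocalization.Away f B] (y : DiffForms k B) :
    ∃ (n : ℕ) (x : DiffForms k A),
      fn (algebraMap A B f ^ n) * y = pullForms (IsScalarTower.toAlgHom k A B) x := by
  induction y using DiffForms.ind with
  | hf b =>
    obtain ⟨n, a, h⟩ := IsLocalization.Away.surj f b
    exact ⟨n, fn a, by rw [← fn_mul, mul_comm, h, pullForms_fn]; rfl⟩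
  | hd b =>
    obtain ⟨n, a, h⟩ := IsLocalization.Away.surj f b
    -- Quotient rule: for `a = f ^ n b`, one has `f ^ (2n) db = f ^ n da - a d(f ^ n)`.
    refine ⟨n + n, fn (f ^ n) * dd a - fn a * dd (f ^ n), ?_⟩
    simp only [map_sub, map_mul, pullForms_fn, pullForms_dd]
    change _ = fn (algebraMap A B (f ^ n)) * dd (algebraMap A B a) -
      fn (algebraMap A B a) * dd (algebraMap A B (f ^ n))
    rw [← h, map_pow, dd_mul, fn_mul, pow_add, fn_mul, mul_add]
    rw [fn_comm b (fn _)]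
    simp only [mul_assoc]
    abel
  | hm x y hx hy =>
    obtain ⟨n, x', hx⟩ := hx
    obtain ⟨m, y', hy⟩ := hy
    refine ⟨n + m, x' * y', ?_⟩
    rw [map_mul, ← hx, ← hy, pow_add, fn_mul, mul_assoc, mul_assoc, ← mul_assoc _ x y,
      fn_comm _ x, mul_assoc]
  | ha x y hx hy =>
    obtain ⟨n, x', hx⟩ := hx
    obtain ⟨m, y', hy⟩ := hy
    refine ⟨n + m, fn (f ^ m) * x' + fn (f ^ n) * y', ?_⟩
    simp only [map_add, map_mul, pullForms_fn, ← hx, ← hy]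
    change _ = fn (algebraMap A B (f ^ m)) * _ + fn (algebraMap A B (f ^ n)) * _
    rw [mul_add, map_pow, map_pow, ← mul_assoc, ← mul_assoc, ← fn_mul, ← fn_mul, pow_add,
      mul_comm (_ ^ n)]

end Localization

section SmoothDomain

variable {k A : Type*} [Field k] [PerfectField k] [CommRing A] [IsDomain A] [Algebra k A]
  [Algebra.Smooth k A] {p : ℕ} [hp : Fact p.Prime] [CharP k p]

theorem pullForms_away_injective (f : A) (hf : f ≠ 0) :
    Function.Injective (pullForms (IsScalarTower.toAlgHom k A (Localization.Away f))) :=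
  pullForms_injective (IsLocalization.injective (M := .powers f) _
    (powers_le_nonZeroDivisors_of_noZeroDivisors hf)) (.powers f)

variable (k A p) in
theorem exists_span_coords : ∃ s : Set A, Ideal.span s = ⊤ ∧
    ∀ f ∈ s, ∃ d, Nonempty (Coords k (Localization.Away f) p d) := by
  obtain ⟨s, hs, h⟩ := Algebra.Smooth.exists_span_eq_top_isStandardSmooth k A
  exact ⟨s, hs, fun f hf => have := h f hf; nonempty_coords_of_isStandardSmooth p⟩

/-- The functions `a` for which `a ^ p ω` has a Cartier image form an ideal, because `a ↦ a ^ p` is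
additive. Clearing denominators on coordinate charts puts a power of each localizing element in it,
so it contains `1`. -/
theorem exists_cart_of_smooth {ω : DiffForms k A} (h : extd k A ω = 0) : ∃ η, Cart p η ω := by
  let I : Ideal A :=
    { carrier := {a | ∃ η, Cart p η (fn (a ^ p) * ω)}
      zero_mem' := ⟨0, by rw [zero_pow hp.out.ne_zero, fn_zero, zero_mul]; exact .zero⟩
      add_mem' := by
        rintro a b ⟨η, hη⟩ ⟨η', hη'⟩
        refine ⟨η + η', ?_⟩
        rw [show (a + b) ^ p = a ^ p + b ^ p from (powHom k A p).map_add a b, fn_add, add_mul]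
        exact hη.add hη'
      smul_mem' := by
        rintro c a ⟨η, hη⟩
        refine ⟨fn c * η, ?_⟩
        rw [smul_eq_mul, mul_pow, fn_mul, mul_assoc]
        exact hη.fn_mul c }
  obtain ⟨s, hs, hC⟩ := exists_span_coords k A p
  have hI : I.radical = ⊤ := by
    rw [eq_top_iff, ← hs, Ideal.span_le]
    intro f hf
    obtain ⟨d, ⟨C⟩⟩ := hC f hf
    rcases eq_or_ne f 0 with rfl | hf0
    · exact Ideal.zero_mem _
    let B := Localization.Away f
    have hinj := pullForms_away_injective (k := k) f hf0
    set φ := IsScalarTower.toAlgHom k A B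
    obtain ⟨η', hη'⟩ := C.exists_cart (p := p) (ω := pullForms φ ω)
      (by rw [← pullForms_extd, h, map_zero])
    obtain ⟨n, η, hη⟩ := exists_fn_pow_mul_eq_pullForms f η'
    have h1 := hη'.fn_mul (algebraMap A B f ^ n)
    rw [hη] at h1
    obtain ⟨ω', -, h2⟩ : ∃ ω', ω' = ω' ∧ Cart p η ω' := by
      obtain ⟨⟨ω', h'⟩, h2⟩ := Ideal.Quotient.mk_surjective (invCartier k A p η)
      exact ⟨ω', rfl, h', h2.symm⟩
    obtain ⟨β', hβ'⟩ := h1.exact_sub (h2.pull φ)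
    obtain ⟨m, β, hβ⟩ := exists_fn_pow_mul_eq_pullForms f β'
    have hpow (a : B) : (dd (a ^ p) : DiffForms k B) = 0 := by
      rw [← extd_fn]; exact extd_pow k B p a
    -- With `β = f ^ m β'`, the extra factor `f ^ (m (p - 1))` turns `f ^ m` into the `p`-th power
    -- `(f ^ m) ^ p`, which passes through `d`.
    have h3 : extd k A (fn (f ^ (m * (p - 1))) * β) =
        fn ((f ^ (m + n)) ^ p) * ω - fn ((f ^ m) ^ p) * ω' := by
      apply hinj
      rw [pullForms_extd, map_mul (pullForms φ), pullForms_fn, ← hβ, map_sub,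
        map_mul (pullForms φ), map_mul (pullForms φ), pullForms_fn, pullForms_fn]
      have e : algebraMap A B f ^ (m * (p - 1)) * algebraMap A B f ^ m =
          (algebraMap A B f ^ m) ^ p := by
        rw [← pow_add, ← pow_mul]
        congr 1
        conv_lhs => rw [← Nat.mul_succ, Nat.succ_eq_add_one, Nat.sub_add_cancel hp.out.one_lt.le]
      rw [show φ (f ^ (m * (p - 1))) = algebraMap A B f ^ (m * (p - 1)) from map_pow _ _ _,
        ← mul_assoc, ← fn_mul, e, extd_fn_mul_of_dd (hpow _), hβ', mul_sub, ← mul_assoc, ← fn_mul,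
        ← mul_pow, ← pow_add]
      congr 4 <;> simp [φ, B]
    refine ⟨m + n, fn (f ^ m) * η, ?_⟩
    have h4 := (h2.fn_mul (f ^ m)).add_exact (fn (f ^ (m * (p - 1))) * β)
    rwa [h3, add_sub_cancel] at h4
  obtain ⟨η, hη⟩ : (1 : A) ∈ I := by rw [Ideal.radical_eq_top.1 hI]; trivial
  exact ⟨η, by rwa [one_pow, fn_one, one_mul] at hη⟩

/-- A single nonzero localization with coordinates suffices, as forms inject into it. -/
theorem cart_unique_of_smooth {η η' ω : DiffForms k A} (h : Cart p η ω) (h' : Cart p η' ω) :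
    η = η' := by
  obtain ⟨s, hs, hC⟩ := exists_span_coords k A p
  obtain ⟨f, hf, hf0⟩ : ∃ f ∈ s, f ≠ 0 := by
    by_contra! hcon
    have : Ideal.span s = ⊥ := Ideal.span_eq_bot.2 hcon
    rw [hs] at this
    exact top_ne_bot this
  obtain ⟨d, ⟨C⟩⟩ := hC f hf
  have : IsDomain (Localization.Away f) := IsLocalization.isDomain_localization
    (powers_le_nonZeroDivisors_of_noZeroDivisors hf0)
  exact pullForms_away_injective (k := k) f hf0 (C.cart_unique (h.pull _) (h'.pull _))

theorem exists_cart_mem_of_smooth {n : ℕ} {ω : DiffForms k A} (h : extd k A ω = 0)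
    (hω : ω ∈ ⋀[A]^n Ω[A⁄k]) : ∃ η ∈ ⋀[A]^n Ω[A⁄k], Cart p η ω := by
  obtain ⟨η, hη⟩ := exists_cart_of_smooth (p := p) h
  refine ⟨_, pr_mem n η, ?_⟩
  rw [← pr_of_mem hω]
  exact hη.pr n

end SmoothDomain

end

/-! ### Nondegeneracy through Gram determinants, and descent along field extensions -/

section

open Module TensorProduct Matrix

section Gram

variable {R M I : Type*} [CommRing R] [AddCommGroup M] [Module R M]

/-- The matrix of the bilinear form defined by a `2`-form on the dual of a free module. -/
def gram (b : Basis I R M) (ω : ExteriorAlgebra R M) : Matrix I I R :=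
  Matrix.of fun i j => ExteriorAlgebra.algebraMapInv (contr (b.coord j) (contr (b.coord i) ω))

theorem gram_apply (b : Basis I R M) (ω : ExteriorAlgebra R M) (i j : I) : gram b ω i j =
    ExteriorAlgebra.algebraMapInv (contr (b.coord j) (contr (b.coord i) ω)) := rfl

theorem exists_eq_ι_of_mem_one {x : ExteriorAlgebra R M} (hx : x ∈ ⋀[R]^1 M) :
    ∃ m, x = ExteriorAlgebra.ι R m := by
  rw [ExteriorAlgebra.exteriorPower, pow_one] at hx
  obtain ⟨m, rfl⟩ := hx
  exact ⟨m, rfl⟩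

theorem exists_contr_eq_of_isUnit [Fintype I] [DecidableEq I] (b : Basis I R M)
    {ω : ExteriorAlgebra R M} (hω : ω ∈ ⋀[R]^2 M) (h : IsUnit (gram b ω).det) (m : M) :
    ∃ θ : Dual R M, contr θ ω = ExteriorAlgebra.ι R m := by
  -- Contracting `ω` with `∑ tᵢ bᵢ*` has coordinate vector `t · gram`, so `t` is the coordinate
  -- vector of `m` times the inverse Gram matrix.
  let t : I → R := (fun j => b.coord j m) ᵥ* (gram b ω)⁻¹
  have hθ : contr (∑ i, t i • b.coord i) ω = ∑ i, t i • contr (b.coord i) ω := by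
    simp [contr, map_sum, LinearMap.sum_apply]
  refine ⟨∑ i, t i • b.coord i, ?_⟩
  obtain ⟨m', hm'⟩ := exists_eq_ι_of_mem_one (contr_mem (∑ i, t i • b.coord i) 1 hω)
  rw [hm']
  congr 1
  refine b.ext_elem fun j => ?_
  have h1 : b.coord j m' = (t ᵥ* gram b ω) j := by
    have h2 : ExteriorAlgebra.algebraMapInv (contr (b.coord j) (ExteriorAlgebra.ι R m')) =
        b.coord j m' := by
      rw [contr_ι, ExteriorAlgebra.algebraMap_leftInverse]
    rw [← h2, ← hm', hθ, map_sum, map_sum]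
    simp only [map_smul, Matrix.vecMul, dotProduct, smul_eq_mul, gram_apply]
  rw [← Basis.coord_apply, h1, Matrix.vecMul_vecMul, Matrix.nonsing_inv_mul _ h,
    Matrix.vecMul_one, Basis.coord_apply]

end Gram

section Evaluation

variable {k A : Type*} [CommRing k] [CommRing A] [Algebra k A] {I : Type*} [Fintype I]

/-- Both sides are linear in `ω`, so it is enough to compare them on `x ∧ y`, where the Gram entries
are `2 × 2` minors of coordinates. -/
theorem evalTwoForm_eq_sum {K : Type*} [CommRing K] [Algebra A K] (b : Basis I A Ω[A⁄k])
    (θ₁ θ₂ : Ω[A⁄k] →ₗ[A] K) (ω : ⋀[A]^2 Ω[A⁄k]) : evalTwoForm θ₁ θ₂ ω =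
      ∑ j, (∑ i, θ₁ (b i) * algebraMap A K (gram b ω.1 i j)) * θ₂ (b j) := by
  let T : ⋀[A]^2 Ω[A⁄k] →ₗ[A] K := ∑ j, ∑ i, (LinearMap.toSpanSingleton A K
    (θ₁ (b i) * θ₂ (b j))).comp (ExteriorAlgebra.algebraMapInv.toLinearMap.comp
      ((contr (b.coord j)).comp ((contr (b.coord i)).comp (Submodule.subtype _))))
  have hT (ω : ⋀[A]^2 Ω[A⁄k]) : T ω =
      ∑ j, (∑ i, θ₁ (b i) * algebraMap A K (gram b ω.1 i j)) * θ₂ (b j) := by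
    simp only [T, LinearMap.sum_apply, Finset.sum_mul]
    refine Finset.sum_congr rfl fun j _ => Finset.sum_congr rfl fun i _ => ?_
    rw [LinearMap.comp_apply, LinearMap.toSpanSingleton_apply, Algebra.smul_def, gram_apply]
    simp only [LinearMap.comp_apply, Submodule.subtype_apply, AlgHom.toLinearMap_apply]
    ring
  rw [← hT]
  refine LinearMap.congr_fun (exteriorPower.linearMap_ext (AlternatingMap.ext fun v => ?_)) ω
  obtain ⟨x, y, rfl⟩ : ∃ x y, v = ![x, y] := ⟨v 0, v 1, by ext i; fin_cases i <;> rfl⟩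
  rw [LinearMap.compAlternatingMap_apply, LinearMap.compAlternatingMap_apply, evalTwoForm_apply, hT]
  have e : (exteriorPower.ιMulti A 2 ![x, y] : ExteriorAlgebra A Ω[A⁄k]) =
      ExteriorAlgebra.ι A x * ExteriorAlgebra.ι A y := by
    rw [exteriorPower.ιMulti_apply_coe, ExteriorAlgebra.ιMulti_apply]
    simp
  have hg (i j : I) : gram b (exteriorPower.ιMulti A 2 ![x, y]).1 i j =
      b.coord i x * b.coord j y - b.coord i y * b.coord j x := by
    rw [gram_apply, e, contr_ι_mul, contr_ι, map_sub, map_smul, contr_ι, ← Algebra.commutes,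
      ← Algebra.smul_def, map_smul, contr_ι, map_sub, map_smul, map_smul,
      ExteriorAlgebra.algebraMap_leftInverse, ExteriorAlgebra.algebraMap_leftInverse]
    simp only [smul_eq_mul]
  have hs (θ : Ω[A⁄k] →ₗ[A] K) (m : Ω[A⁄k]) :
      θ m = ∑ i, algebraMap A K (b.coord i m) * θ (b i) := by
    conv_lhs => rw [← b.sum_repr m]
    simp only [map_sum, map_smul, Algebra.smul_def, Basis.coord_apply]
  simp only [hg, map_sub, map_mul, mul_sub, sub_mul, Finset.sum_sub_distrib, Finset.sum_mul]
  rw [hs θ₁ x, hs θ₂ y, hs θ₁ y, hs θ₂ x, Finset.sum_mul_sum, Finset.sum_mul_sum]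
  congr 1 <;> rw [Finset.sum_comm] <;>
  exact Finset.sum_congr rfl fun j _ => Finset.sum_congr rfl fun i _ => by ring

/-- If the determinant lay in a maximal ideal, a vector in the left kernel of the reduced matrix
would give a nonzero tangent vector orthogonal to all others. -/
theorem IsNondegenerate.isUnit_det_gram [DecidableEq I] (b : Basis I A Ω[A⁄k])
    {ω : ⋀[A]^2 Ω[A⁄k]} (h : IsNondegenerate ω) : IsUnit (gram b ω.1).det := by
  by_contra hu
  obtain ⟨m, hm, hu⟩ := exists_max_ideal_of_mem_nonunits hu
  have := hm.isPrime
  let P : PrimeSpectrum A := ⟨m, hm.isPrime⟩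
  have hdet : ((gram b ω.1).map (algebraMap A P.asIdeal.ResidueField)).det = 0 := by
    rw [← RingHom.mapMatrix_apply, ← RingHom.map_det]
    exact Ideal.algebraMap_residueField_eq_zero.2 hu
  obtain ⟨v, hv, hv'⟩ := Matrix.exists_vecMul_eq_zero_iff.2 hdet
  let θ : Ω[A⁄k] →ₗ[A] P.asIdeal.ResidueField := b.constr A v
  have hθ (i) : θ (b i) = v i := b.constr_basis A v i
  apply hv
  have := h P θ fun θ₂ => by
    rw [evalTwoForm_eq_sum b]
    refine Finset.sum_eq_zero fun j _ => ?_
    have := congrFun hv' j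
    simp only [Matrix.vecMul, dotProduct, Matrix.map_apply, Pi.zero_apply] at this
    simp only [hθ, this, zero_mul]
  ext i
  rw [← hθ, this]
  rfl

end Evaluation

section BaseChange

variable {k A k' B : Type*} [CommRing k] [CommRing A] [Algebra k A] [CommRing k'] [CommRing B]
  [Algebra k' B] {I : Type*} (σ : k →+* k') (φ : A →+* B)
  (h : ∀ r, φ (algebraMap k A r) = algebraMap k' B (σ r)) (b : Basis I A Ω[A⁄k])
  (b' : Basis I B Ω[B⁄k'])
  (hb : ∀ i, formMap σ φ h (ExteriorAlgebra.ι A (b i)) = ExteriorAlgebra.ι B (b' i))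

include hb in
theorem formMap_contr_coord (i : I) (x : DiffForms k A) :
    formMap σ φ h (contr (b.coord i) x) = contr (b'.coord i) (formMap σ φ h x) := by
  classical
  induction x using ExteriorAlgebra.induction with
  | algebraMap r =>
    rw [formMap_fn, CliffordAlgebra.contractLeft_algebraMap,
      CliffordAlgebra.contractLeft_algebraMap, map_zero]
  | ι m =>
    induction b.mem_span m using Submodule.span_induction with
    | mem m hm =>
      obtain ⟨j, rfl⟩ := hm
      rw [hb, contr_ι, contr_ι, formMap_fn]
      rcases eq_or_ne j i with rfl | hij
      · simp
      · simp [hij]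
    | zero => simp
    | add m n _ _ hm hn => simp only [map_add, hm, hn]
    | smul r m _ hm =>
      rw [map_smul, map_smul, Algebra.smul_def, Algebra.smul_def, map_mul, map_mul, formMap_fn,
        hm, ← Algebra.smul_def, ← Algebra.smul_def, map_smul]
  | mul x y hx hy =>
    rw [contr_mul, map_add, map_mul, map_mul, map_mul, contr_mul, hx, hy]
    congr 2
    exact formMap_signInv σ φ h x
  | add x y hx hy => simp only [map_add, hx, hy]

theorem formMap_algebraMapInv (x : DiffForms k A) :
    ExteriorAlgebra.algebraMapInv (formMap σ φ h x) = φ (ExteriorAlgebra.algebraMapInv x) := by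
  have : (ExteriorAlgebra.algebraMapInv (R := B) (M := Ω[B⁄k'])).toRingHom.comp (formMap σ φ h) =
      φ.comp (ExteriorAlgebra.algebraMapInv (R := A) (M := Ω[A⁄k])).toRingHom := by
    refine DiffForms.ringHom_ext (fun a => ?_) fun a => ?_
    · rw [RingHom.comp_apply, formMap_fn]
      exact (ExteriorAlgebra.algebraMap_leftInverse _ _).trans
        (congrArg φ (ExteriorAlgebra.algebraMap_leftInverse _ a)).symm
    · rw [RingHom.comp_apply, formMap_dd]
      simp [dd, ExteriorAlgebra.algebraMapInv]
  exact RingHom.congr_fun this x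

include hb in
theorem gram_formMap (ω : DiffForms k A) : gram b' (formMap σ φ h ω) = (gram b ω).map φ := by
  ext i j
  rw [gram_apply, Matrix.map_apply, gram_apply, ← formMap_contr_coord σ φ h b b' hb,
    ← formMap_contr_coord σ φ h b b' hb, formMap_algebraMapInv]

include hb in
/-- If the base change of a `2`-form is nondegenerate, then so is the form itself. -/
theorem exists_contr_eq_of_isNondegenerate_formMap [Fintype I] [IsLocalHom φ]
    {ω : DiffForms k A} (hω : ω ∈ ⋀[A]^2 Ω[A⁄k]) {ω' : ⋀[B]^2 Ω[B⁄k']} (hn : IsNondegenerate ω')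
    {c : k'} (hc : ω'.1 = c • formMap σ φ h ω) (m : Ω[A⁄k]) :
    ∃ θ : Dual A Ω[A⁄k], contr θ ω = ExteriorAlgebra.ι A m := by
  classical
  refine exists_contr_eq_of_isUnit b hω ?_ m
  have h1 := hn.isUnit_det_gram b'
  have h2 : gram b' ω'.1 = algebraMap k' B c • (gram b ω).map φ := by
    rw [← gram_formMap σ φ h b b' hb, hc, ← algebraMap_smul B c]
    ext i j
    simp only [gram_apply, map_smul, Matrix.smul_apply]
  rw [h2, Matrix.det_smul, ← RingHom.mapMatrix_apply, ← RingHom.map_det] at h1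
  exact isUnit_of_map_unit φ _ (isUnit_of_mul_isUnit_right h1)

end BaseChange

section FieldExtension

variable {k A k' B : Type*} [Field k] [CommRing A] [Algebra k A] [Field k'] [Algebra k k']
  [CommRing B] [Algebra k' B] [Algebra A B] [Algebra k B] [IsScalarTower k A B]
  [IsScalarTower k k' B] [Algebra.IsPushout k k' A B]

variable (A B) in
/-- The `A`-linear extension to `B = A ⊗ k'` of a linear form on `k'`. -/
def extendForm (l : k' →ₗ[k] k) : B →ₗ[A] A :=
  have : Algebra.IsPushout k A k' B := .symm inferInstance
  (AlgebraTensorModule.rid k A A).toLinearMap.comp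
    ((AlgebraTensorModule.lTensor A A l).comp
      (Algebra.IsPushout.equiv k A k' B).symm.toLinearMap)

theorem extendForm_apply (l : k' →ₗ[k] k) (c : k') :
    extendForm A B l (algebraMap k' B c) = algebraMap k A (l c) := by
  have : Algebra.IsPushout k A k' B := .symm inferInstance
  have h : (Algebra.IsPushout.equiv k A k' B).symm (algebraMap k' B c) = 1 ⊗ₜ c :=
    Algebra.IsPushout.equiv_symm_algebraMap_right k A k' B c
  change AlgebraTensorModule.rid k A A (AlgebraTensorModule.lTensor A A l
    ((Algebra.IsPushout.equiv k A k' B).symm (algebraMap k' B c))) = _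
  rw [h, AlgebraTensorModule.lTensor_tmul, AlgebraTensorModule.rid_tmul,
    Algebra.algebraMap_eq_smul_one]

/-- Extend to `B → A` a linear form `l` on `k'` with `l 1 ≠ 0`; it sends the image of `a` to a unit
multiple of `a`. -/
theorem algebraMap_injective_of_isPushout (_h : Algebra.IsPushout k k' A B) : Function.Injective (algebraMap A B) := by
  obtain ⟨l, hl, -⟩ := Submodule.exists_le_ker_of_notMem (p := (⊥ : Submodule k k'))
    (v := 1) (by simp)
  rw [injective_iff_map_eq_zero]
  intro a ha
  have h1 : extendForm A B l (a • algebraMap k' B 1) = a * algebraMap k A (l 1) := by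
    rw [map_smul, extendForm_apply, smul_eq_mul]
  rw [Algebra.smul_def, ha, zero_mul, map_zero] at h1
  have hu : IsUnit (algebraMap k A (l 1)) := (isUnit_iff_ne_zero.2 hl).map _
  exact (hu.mul_left_eq_zero.1 h1.symm)

/-- If `c` were not in `k`, a linear form on `k'` would vanish at `1` but not at `c`; extended to
`B` and applied to the equation, it would give `a = 0`. -/
theorem mem_range_of_algebraMap_mul_eq {a b : A} (ha : a ≠ 0) {c : k'}
    (h : algebraMap A B b = algebraMap A B a * algebraMap k' B c) :
    c ∈ Set.range (algebraMap k k') := by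
  by_contra hc
  obtain ⟨l, hl, h1⟩ := Submodule.exists_le_ker_of_notMem (p := k ∙ (1 : k')) (v := c) (by
    intro h
    obtain ⟨r, rfl⟩ := Submodule.mem_span_singleton.1 h
    exact hc ⟨r, Algebra.algebraMap_eq_smul_one r⟩)
  have h1 : l 1 = 0 := h1 (Submodule.mem_span_singleton_self 1)
  have h2 : extendForm A B l (b • algebraMap k' B 1) =
      extendForm A B l (a • algebraMap k' B c) := by
    rw [Algebra.smul_def, Algebra.smul_def, ← h, map_one, mul_one]
  rw [map_smul, map_smul, extendForm_apply, extendForm_apply, h1, map_zero, smul_zero,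
    smul_eq_mul] at h2
  have hu : IsUnit (algebraMap k A (l c)) := (isUnit_iff_ne_zero.2 hl).map _
  exact ha (hu.mul_left_eq_zero.1 h2.symm)

/-- `A → B` is injective, and integral as a base change of the algebraic extension `k'` of `k`.
Units therefore descend, in particular Gram determinants. -/
theorem isLocalHom_of_isPushout [Algebra.IsAlgebraic k k'] (h : Algebra.IsPushout k k' A B) : IsLocalHom (algebraMap A B) := by
  have : Algebra.IsPushout k A k' B := .symm inferInstance
  have : Algebra.IsIntegral k k' := inferInstance
  have : Algebra.IsIntegral A B := (Algebra.IsPushout.equiv k A k' B).isIntegral_iff.1 inferInstance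
  have : FaithfulSMul A B := (faithfulSMul_iff_algebraMap_injective A B).2
    (algebraMap_injective_of_isPushout h)
  exact Algebra.IsIntegral.isLocalHom A B

/-- The differentials of coordinates on `A` form a basis of the Kähler differentials of
`B = A ⊗ k'`. -/
theorem Coords.exists_basis {p d : ℕ} (C : Coords k A p d) : ∃ b' : Basis (Fin d) B Ω[B⁄k'],
    ∀ i, b' i = KaehlerDifferential.D k' B (algebraMap A B (C.x i)) := by
  refine ⟨(C.basis.baseChange B).map (KaehlerDifferential.tensorKaehlerEquiv k k' A B),
    fun i => ?_⟩
  rw [Basis.map_apply, Basis.baseChange_apply, C.basis_apply,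
    KaehlerDifferential.tensorKaehlerEquiv_tmul_D, one_smul]

end FieldExtension

end

/-! ### The function field: regularity, extension of forms, and dimension -/

section FunctionField

open AlgebraicGeometry Opposite Module TopologicalSpace

universe u

variable {k : Type u} [Field k] {X : Scheme.{u}} (f : X ⟶ Spec (CommRingCat.of k))

section Sections

variable {f}

theorem smooth_sections [Smooth f] {V : X.Opens} (hV : IsAffineOpen V) :
    Algebra.Smooth k (Sections f V) := by
  have h1 := f.smooth_appLE (isAffineOpen_top _) hV le_top
  have h2 : (Scheme.ΓSpecIso (CommRingCat.of k)).inv.hom.Smooth :=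
    .of_bijective (ConcreteCategory.bijective_of_isIso (Scheme.ΓSpecIso (CommRingCat.of k)).inv)
  exact h2.comp h1

/-- Sections over a basic open subset as an algebra over the sections over an affine open set. -/
theorem isLocalization_basicOpen {V : X.Opens} (hV : IsAffineOpen V) (g : Sections f V)
    (h : X.basicOpen g ≤ V) :
    letI := (resSections f h).toRingHom.toAlgebra
    IsLocalization.Away g (Sections f (X.basicOpen g)) :=
  hV.isLocalization_basicOpen g

end Sections

variable [IsIntegral X]

theorem nonempty_inf (U V : X.Opens) [hU : Nonempty U] [hV : Nonempty V] :
    Nonempty (U ⊓ V : X.Opens) := by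
  obtain ⟨x, hx, hx'⟩ := nonempty_preirreducible_inter U.isOpen V.isOpen
    ⟨hU.some.1, hU.some.2⟩ ⟨hV.some.1, hV.some.2⟩
  exact ⟨⟨x, hx, hx'⟩⟩

instance (U : X.Opens) [Nonempty U] : IsDomain (Sections f U) :=
  inferInstanceAs (IsDomain Γ(X, U))

/-- The function field of an integral scheme, as a field extension of the base field. -/
def FunField (_f : X ⟶ Spec (CommRingCat.of k)) : Type u := X.functionField

instance : Field (FunField f) := inferInstanceAs (Field X.functionField)

/-- The ring map from sections to the function field. -/
def germHom (U : X.Opens) [Nonempty U] : Sections f U →+* FunField f :=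
  (X.germToFunctionField U).hom

instance : Nonempty (⊤ : X.Opens) := ⟨⟨Nonempty.some inferInstance, trivial⟩⟩

instance : Algebra k (FunField f) := ((germHom f ⊤).comp (algebraMap k (Sections f ⊤))).toAlgebra

theorem germHom_res {U V : X.Opens} [Nonempty U] [Nonempty V] (h : U ≤ V) (s : Sections f V) :
    germHom f U (resSections f h s) = germHom f V s :=
  X.presheaf.germ_res_apply (homOfLE h) (genericPoint X) _ s

/-- The map from sections to the function field. -/
def germK (U : X.Opens) [Nonempty U] : Sections f U →ₐ[k] FunField f where
  __ := germHom f U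
  commutes' r := by
    change germHom f U (algebraMap k (Sections f U) r) =
      germHom f ⊤ (algebraMap k (Sections f ⊤) r)
    rw [← germHom_res f (U := U) (V := ⊤) le_top, AlgHom.commutes]

theorem germK_res {U V : X.Opens} [Nonempty U] [Nonempty V] (h : U ≤ V) (s : Sections f V) :
    germK f U (resSections f h s) = germK f V s := germHom_res f h s

theorem germK_comp_res {U V : X.Opens} [Nonempty U] [Nonempty V] (h : U ≤ V) :
    (germK f U).comp (resSections f h) = germK f V := AlgHom.ext fun s => germK_res f h s

theorem germK_injective (U : X.Opens) [Nonempty U] : Function.Injective (germK f U) :=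
  X.germToFunctionField_injective U

theorem isFractionRing_germK {V : X.Opens} (hV : IsAffineOpen V) [Nonempty V] :
    letI := (germK f V).toRingHom.toAlgebra
    IsFractionRing (Sections f V) (FunField f) :=
  functionField_isFractionRing_of_isAffineOpen X V hV

/-- A rational function is regular on a nonempty open set. -/
def IsRegularOn (U : X.Opens) [Nonempty U] (t : FunField f) : Prop := ∃ s, germK f U s = t

theorem isRegularOn_of_local {U : X.Opens} [Nonempty U] {t : FunField f}
    (h : ∀ x ∈ U, ∃ (V : X.Opens) (_ : Nonempty V), x ∈ V ∧ V ≤ U ∧ IsRegularOn f V t) :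
    IsRegularOn f U t := by
  choose V hne hx hle s hs using h
  let W : U → X.Opens := fun x => V x.1 x.2
  have hW (x : U) : Nonempty (W x) := hne x.1 x.2
  obtain ⟨g, hg, -⟩ := X.sheaf.existsUnique_gluing' W U (fun x => homOfLE (hle x.1 x.2))
    (fun x hxU => Opens.mem_iSup.2 ⟨⟨x, hxU⟩, hx x hxU⟩) (fun x => s x.1 x.2) (fun x y => by
      have := nonempty_inf (W x) (W y)
      apply germK_injective f (W x ⊓ W y)
      exact (germK_res f (U := W x ⊓ W y) (V := W x) inf_le_left (s x.1 x.2)).trans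
        ((hs x.1 x.2).trans ((hs y.1 y.2).symm.trans
          (germK_res f (U := W x ⊓ W y) (V := W y) inf_le_right (s y.1 y.2)).symm)))
  refine ⟨g, ?_⟩
  obtain ⟨x⟩ := ‹Nonempty U›
  exact (germK_res f (U := W x) (hle x.1 x.2) g).symm.trans
    ((congrArg (germK f (W x)) (hg x)).trans (hs x.1 x.2))

theorem isRegularOn_of_le {U V : X.Opens} [Nonempty U] [Nonempty V] (h : U ≤ V) {t : FunField f}
    (ht : IsRegularOn f V t) : IsRegularOn f U t := by
  obtain ⟨s, rfl⟩ := ht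
  exact ⟨resSections f h s, germK_res f h s⟩

/-- The map from forms on an open set to forms on the function field. -/
abbrev formK (U : X.Opens) [Nonempty U] : DiffForms k (Sections f U) →+* DiffForms k (FunField f) :=
  pullForms (germK f U)

theorem formK_res {U V : X.Opens} [Nonempty U] [Nonempty V] (h : U ≤ V)
    (ω : DiffForms k (Sections f V)) : formK f U (pullForms (resSections f h) ω) = formK f V ω := by
  rw [formK, pullForms_comp, germK_comp_res]

theorem formK_fn (U : X.Opens) [Nonempty U] (s : Sections f U) :
    formK f U (fn s) = fn (germK f U s) := pullForms_fn _ _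

variable [Smooth f]

theorem formK_injective {V : X.Opens} (hV : IsAffineOpen V) [Nonempty V] :
    Function.Injective (formK f V) := by
  let := (germK f V).toRingHom.toAlgebra
  have : IsScalarTower k (Sections f V) (FunField f) :=
    IsScalarTower.of_algebraMap_eq fun r => ((germK f V).commutes r).symm
  have := smooth_sections (f := f) hV
  have := isFractionRing_germK f hV
  exact pullForms_injective (germK_injective f V) (nonZeroDivisors (Sections f V))

/-- The denominators of `ξ`, that is, the functions whose product with `ξ` comes from `W`, form an
ideal. Near each point a power of some `g` that does not vanish there belongs to it, so the ideal
contains `1`. -/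
theorem exists_formK_eq_of_local {W : X.Opens} (hW : IsAffineOpen W) [Nonempty W]
    {ξ : DiffForms k (FunField f)}
    (h : ∀ x ∈ W, ∃ (V : X.Opens) (_ : Nonempty V), x ∈ V ∧ ξ ∈ (formK f V).range) :
    ξ ∈ (formK f W).range := by
  let I : Ideal (Sections f W) :=
    { carrier := {a | fn (germK f W a) * ξ ∈ (formK f W).range}
      zero_mem' := by
        change fn (germK f W 0) * ξ ∈ (formK f W).range
        rw [map_zero, fn_zero, zero_mul]
        exact zero_mem _
      add_mem' := by
        intro a b ha hb
        change fn (germK f W (a + b)) * ξ ∈ (formK f W).range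
        rw [map_add, fn_add, add_mul]
        exact add_mem ha hb
      smul_mem' := by
        intro c a ha
        change fn (germK f W (c • a)) * ξ ∈ (formK f W).range
        rw [smul_eq_mul, map_mul, fn_mul, mul_assoc, ← formK_fn]
        exact mul_mem ⟨_, rfl⟩ ha }
  let s : Set Γ(X, W) := {g | g ∈ I.radical}
  have hs : Ideal.span s = ⊤ := by
    rw [← hW.self_le_iSup_basicOpen_iff]
    intro x hx
    obtain ⟨V, _, hxV, η, hη⟩ := h x hx
    obtain ⟨g, hgV, hxg⟩ : ∃ g : Sections f W, X.basicOpen g ≤ V ∧ x ∈ X.basicOpen g :=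
      hW.exists_basicOpen_le (V := V) ⟨x, hxV⟩ hx
    have : Nonempty (X.basicOpen g) := ⟨⟨x, hxg⟩⟩
    refine Opens.mem_iSup.2 ⟨⟨g, ?_⟩, hxg⟩
    let := (resSections f (X.basicOpen_le g)).toRingHom.toAlgebra
    have : IsScalarTower k (Sections f W) (Sections f (X.basicOpen g)) :=
      IsScalarTower.of_algebraMap_eq fun r => ((resSections f (X.basicOpen_le g)).commutes r).symm
    have hloc := isLocalization_basicOpen (f := f) hW g (X.basicOpen_le g)
    obtain ⟨n, ω, hω⟩ := exists_fn_pow_mul_eq_pullForms (k := k) (A := Sections f W)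
      (B := Sections f (X.basicOpen g)) g
      (pullForms (resSections f hgV) η)
    refine ⟨n, ω, ?_⟩
    rw [← formK_res f (X.basicOpen_le g) ω]
    have h1 := congrArg (formK f (X.basicOpen g)) hω
    rw [map_mul, formK_res, hη, formK_fn, map_pow] at h1
    rw [map_pow, ← germK_res f (X.basicOpen_le g)]
    exact h1.symm
  have hI : I.radical = ⊤ := by
    have : Ideal.span s = I.radical := Ideal.span_eq I.radical
    rw [← this]
    exact hs
  have : (1 : Sections f W) ∈ I := by rw [Ideal.radical_eq_top.1 hI]; trivial
  have h1 : fn (germK f W 1) * ξ ∈ (formK f W).range := this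
  rwa [map_one, fn_one, one_mul] at h1

variable (p : ℕ) [hp : Fact p.Prime] [CharP k p]

theorem exists_coords_dim [PerfectField k] {U : X.Opens} {x : X} (hx : x ∈ U) :
    ∃ V : X.Opens, IsAffineOpen V ∧ x ∈ V ∧ V ≤ U ∧ ∃ d, Nonempty (Coords k (Sections f V) p d) := by
  obtain ⟨_, ⟨W, hW, rfl⟩, hxW, hWU⟩ :=
    X.isBasis_affineOpens.exists_subset_of_mem_open hx U.isOpen
  have : Nonempty W := ⟨⟨x, hxW⟩⟩
  have := smooth_sections (f := f) hW
  obtain ⟨s, hs, hC⟩ := exists_span_coords k (Sections f W) p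
  have hcov := (IsAffineOpen.self_le_iSup_basicOpen_iff hW (s := s)).2 hs hxW
  obtain ⟨g, hg, hxg⟩ : ∃ g : Sections f W, g ∈ s ∧ x ∈ X.basicOpen g := by
    obtain ⟨⟨g, hg⟩, hxg⟩ := Opens.mem_iSup.1 hcov
    exact ⟨g, hg, hxg⟩
  refine ⟨X.basicOpen g, hW.basicOpen g, hxg, (X.basicOpen_le g).trans hWU, ?_⟩
  obtain ⟨d, ⟨C⟩⟩ := hC g hg
  let := (resSections f (X.basicOpen_le g)).toRingHom.toAlgebra
  have : IsScalarTower k (Sections f W) (Sections f (X.basicOpen g)) :=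
    IsScalarTower.of_algebraMap_eq fun r => ((resSections f (X.basicOpen_le g)).commutes r).symm
  have hloc := isLocalization_basicOpen (f := f) hW g (X.basicOpen_le g)
  let e : Localization.Away g ≃ₐ[Sections f W]
    Sections f (X.basicOpen g) := IsLocalization.algEquiv (.powers g) _ _
  let := e.toRingHom.toAlgebra
  have : IsScalarTower k (Localization.Away g)
      (Sections f (X.basicOpen g)) := IsScalarTower.of_algebraMap_eq fun r =>
    ((e.restrictScalars k).commutes r).symm
  -- Coordinates are carried over the isomorphism by regarding it as a localization at the trivial
  -- submonoid.
  have : IsLocalization (⊥ : Submonoid (Localization.Away g))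
      (Sections f (X.basicOpen g)) :=
    IsLocalization.of_le_isUnit_of_bijective (by rintro _ ⟨_, rfl, rfl⟩; simp) e.bijective
  exact ⟨d, ⟨C.localization ⊥⟩⟩

/-- The dimension of an integral smooth scheme. -/
def dimK : ℕ := finrank (FunField f) Ω[FunField f⁄k]

variable {f p} in
/-- Coordinates on an open set, as coordinates on the function field. -/
def Coords.toFunField {V : X.Opens} (hV : IsAffineOpen V) [Nonempty V] {d : ℕ}
    (C : Coords k (Sections f V) p d) : Coords k (FunField f) p d :=
  letI := (germK f V).toRingHom.toAlgebra
  haveI : IsScalarTower k (Sections f V) (FunField f) :=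
    IsScalarTower.of_algebraMap_eq fun r => ((germK f V).commutes r).symm
  haveI := isFractionRing_germK f hV
  C.localization (nonZeroDivisors (Sections f V))

/-- Coordinates on any chart give a basis of the differentials of the function field, so their
number does not depend on the chart. -/
theorem exists_coords [PerfectField k] {U : X.Opens} {x : X} (hx : x ∈ U) :
    ∃ V : X.Opens, IsAffineOpen V ∧ x ∈ V ∧ V ≤ U ∧ Nonempty (Coords k (Sections f V) p (dimK f)) := by
  obtain ⟨V, hV, hxV, hle, d, ⟨C⟩⟩ := exists_coords_dim f p hx
  have : Nonempty V := ⟨⟨x, hxV⟩⟩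
  have hd : dimK f = d := by
    have := finrank_eq_card_basis (Coords.toFunField hV C).basis
    rwa [Fintype.card_fin] at this
  exact ⟨V, hV, hxV, hle, hd ▸ ⟨C⟩⟩

end FunctionField

/-! ### Volume forms over a field -/

section VolumeField

open Module

variable {k A : Type*} [CommRing k] [CommRing A] [Algebra k A] {p d : ℕ} [hp : Fact p.Prime]
  [CharP k p] (C : Coords k A p d)

theorem fn_sub (a b : A) : (fn (a - b) : DiffForms k A) = fn a - fn b := map_sub _ a b

include C in
theorem IsVolume.ne_zero [Nontrivial A] {ν : DiffForms k A} (h : IsVolume d ν) : ν ≠ 0 := by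
  rintro rfl
  refine zero_ne_one (C.fn_mul_volume_injective h (a := 0) (b := 1) ?_)
  rw [mul_zero, mul_zero]

theorem isVolume_of_ne_zero {K : Type*} [Field K] [Algebra k K] (C : Coords k K p d)
    {ν : DiffForms k K} (h : ν ∈ ⋀[K]^d Ω[K⁄k]) (h0 : ν ≠ 0) : IsVolume d ν := by
  rw [C.eq_fn_mul_vol h] at h0 ⊢
  refine C.isVolume_fn_mul (isUnit_iff_ne_zero.2 ?_)
  intro h1
  rw [h1, fn_zero, zero_mul] at h0
  exact h0 rfl

end VolumeField

/-! ### Global forms at the generic point, and the splitting criterion on `X` -/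

section Geometry

open AlgebraicGeometry Opposite Module TopologicalSpace

universe u

variable {k : Type u} [Field k] {X : Scheme.{u}} [IsIntegral X] {f : X ⟶ Spec (CommRingCat.of k)}

theorem subsingleton_forms {V : X.Opens} (hV : ¬ Nonempty V) :
    Subsingleton (DiffForms k (Sections f V)) := by
  have h : V = ⊥ := by
    rw [eq_bot_iff]
    exact fun x hx => (hV ⟨⟨x, hx⟩⟩).elim
  have : Subsingleton (Sections f V) := by
    subst h
    exact inferInstanceAs (Subsingleton Γ(X, ⊥))
  exact Module.subsingleton (Sections f V) _

theorem nonempty_of_le {U V : X.Opens} (h : U ≤ V) (hU : Nonempty U) : Nonempty V :=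
  ⟨⟨hU.some.1, h hU.some.2⟩⟩

theorem exists_affine_le {U : X.Opens} {x : X} (hx : x ∈ U) :
    ∃ V : X.affineOpens, x ∈ V.1 ∧ V.1 ≤ U := by
  obtain ⟨_, ⟨W, hW, rfl⟩, hxW, hWU⟩ :=
    X.isBasis_affineOpens.exists_subset_of_mem_open hx U.isOpen
  exact ⟨⟨W, hW⟩, hxW, hWU⟩

section Generic

/-- Two nonempty affine opens of an integral scheme share a nonempty affine open, on which both
restrictions agree. -/
theorem exists_genericForm {i : ℕ} (ω : globalForms f i) :
    ∃ ξ : DiffForms k (FunField f), ξ ∈ ⋀[FunField f]^i Ω[FunField f⁄k] ∧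
      ∀ (V : X.affineOpens) [Nonempty V.1], formK f V.1 (ω.1 V) = ξ := by
  obtain ⟨x⟩ : Nonempty X := inferInstance
  obtain ⟨W, hxW, -⟩ := exists_affine_le (U := ⊤) (x := x) trivial
  have : Nonempty W.1 := ⟨⟨x, hxW⟩⟩
  refine ⟨formK f W.1 (ω.1 W), pullForms_mem _ (ω.2.1 W), fun V _ => ?_⟩
  obtain ⟨y, hy⟩ := nonempty_inf V.1 W.1
  obtain ⟨V', hyV, hle⟩ := exists_affine_le hy
  have : Nonempty V'.1 := ⟨⟨y, hyV⟩⟩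
  rw [← formK_res f (hle.trans inf_le_left), ← formK_res f (hle.trans inf_le_right),
    ω.2.2 V' V, ω.2.2 V' W]

/-- A global form at the generic point. -/
def genericForm {i : ℕ} (ω : globalForms f i) : DiffForms k (FunField f) :=
  (exists_genericForm ω).choose

theorem genericForm_mem {i : ℕ} (ω : globalForms f i) :
    genericForm ω ∈ ⋀[FunField f]^i Ω[FunField f⁄k] := (exists_genericForm ω).choose_spec.1

theorem formK_eq_genericForm {i : ℕ} (ω : globalForms f i) (V : X.affineOpens) [Nonempty V.1] :
    formK f V.1 (ω.1 V) = genericForm ω := (exists_genericForm ω).choose_spec.2 V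

theorem genericForm_smul {i : ℕ} (c : k) (ω : globalForms f i) :
    genericForm (c • ω) = c • genericForm ω := by
  obtain ⟨x⟩ : Nonempty X := inferInstance
  obtain ⟨W, hxW, -⟩ := exists_affine_le (U := ⊤) (x := x) trivial
  have : Nonempty W.1 := ⟨⟨x, hxW⟩⟩
  rw [← formK_eq_genericForm _ W, ← formK_eq_genericForm _ W]
  exact pullForms_smul _ c _

variable [Smooth f]

theorem genericForm_injective {i : ℕ} :
    Function.Injective (genericForm : globalForms f i → DiffForms k (FunField f)) := by
  intro ω ω' h
  refine Subtype.ext (funext fun V => ?_)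
  by_cases hV : Nonempty V.1
  · apply formK_injective f V.2
    rw [formK_eq_genericForm, formK_eq_genericForm, h]
  · have := subsingleton_forms (f := f) hV
    exact Subsingleton.elim _ _

theorem genericForm_ne_zero {i : ℕ} {ω : globalForms f i} (h : ω ≠ 0) : genericForm ω ≠ 0 := by
  intro h0
  apply h
  apply genericForm_injective
  have := genericForm_smul (0 : k) ω
  rw [zero_smul, zero_smul] at this
  rw [this, h0]

/-- Being regular near each point suffices on every affine open, and injectivity into the generic
point makes the local forms compatible. -/
theorem exists_globalForm {i : ℕ} {ξ : DiffForms k (FunField f)}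
    (hξ : ξ ∈ ⋀[FunField f]^i Ω[FunField f⁄k])
    (h : ∀ x : X, ∃ (V : X.Opens) (_ : Nonempty V), x ∈ V ∧ ξ ∈ (formK f V).range) :
    ∃ ω : globalForms f i, genericForm ω = ξ := by
  classical
  have h1 (V : X.affineOpens) : ∃ ω ∈ ⋀[Sections f V.1]^i Ω[Sections f V.1⁄k],
      ∀ _ : Nonempty V.1, formK f V.1 ω = ξ := by
    by_cases hV : Nonempty V.1
    · obtain ⟨ω, hω⟩ := exists_formK_eq_of_local f V.2 (ξ := ξ) fun x _ => h x
      -- A form mapping to `ξ` need not be known to be homogeneous; as `ξ` has degree `i`, its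
      -- component of degree `i` maps to `ξ` as well.
      refine ⟨pr i ω, pr_mem i ω, fun _ => ?_⟩
      rw [formK, pullForms_pr, show pullForms _ ω = ξ from hω, pr_of_mem hξ]
    · exact ⟨0, Submodule.zero_mem _, fun h => (hV h).elim⟩
  choose ω hω hω' using h1
  let Ω : globalForms f i := ⟨ω, hω, fun V W hVW => by
    by_cases hV : Nonempty V.1
    · have := nonempty_of_le hVW hV
      apply formK_injective f V.2
      rw [formK_res, hω' W this, hω' V hV]
    · have := subsingleton_forms (f := f) hV
      exact Subsingleton.elim _ _⟩
  refine ⟨Ω, ?_⟩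
  obtain ⟨x⟩ : Nonempty X := inferInstance
  obtain ⟨W, hxW, -⟩ := exists_affine_le (U := ⊤) (x := x) trivial
  have : Nonempty W.1 := ⟨⟨x, hxW⟩⟩
  rw [← formK_eq_genericForm Ω W]
  exact hω' W this

end Generic

variable (p : ℕ) [hp : Fact p.Prime] [CharP k p]

/-- Sections over nonempty opens inject into the function field, so linearity, compatibility with
restrictions and the normalization all follow from those of `ψ`. -/
theorem isFrobeniusSplit_of_funField (ψ : FunField f →+ FunField f)
    (hψ : ∀ a s, ψ (a ^ p * s) = a * ψ s) (h1 : ψ 1 = 1)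
    (h : ∀ (U : X.Opens) [Nonempty U] t, IsRegularOn f U t → IsRegularOn f U (ψ t)) :
    IsFrobeniusSplit f p := by
  classical
  have key (U : X.Opens) : ∃ φ : Sections f U →+ Sections f U,
      ∀ (_ : Nonempty U) s, germK f U (φ s) = ψ (germK f U s) := by
    by_cases hU : Nonempty U
    · choose φ hφ using fun s : Sections f U => h U (germK f U s) ⟨s, rfl⟩
      refine ⟨AddMonoidHom.mk' φ fun a b => germK_injective f U ?_, fun _ s => hφ s⟩
      rw [map_add, hφ, hφ, hφ, map_add, map_add]
    · exact ⟨0, fun h => (hU h).elim⟩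
  choose φ hφ using key
  have hsub (U : X.Opens) (hU : ¬ Nonempty U) : Subsingleton (Sections f U) := by
    have : U = ⊥ := by
      rw [eq_bot_iff]
      exact fun x hx => (hU ⟨⟨x, hx⟩⟩).elim
    subst this
    exact inferInstanceAs (Subsingleton Γ(X, ⊥))
  have hres (U V : X.Opens) (hUV : U ≤ V) (s : Sections f V) :
      φ U (resSections f hUV s) = resSections f hUV (φ V s) := by
    by_cases hU : Nonempty U
    · have hV := nonempty_of_le hUV hU
      apply germK_injective f U
      rw [hφ U hU, germK_res, germK_res, hφ V hV]
    · have := hsub U hU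
      exact Subsingleton.elim _ _
  have hmul (U : X.Opens) (a s : Sections f U) : φ U (a ^ p * s) = a * φ U s := by
    by_cases hU : Nonempty U
    · apply germK_injective f U
      rw [hφ U hU, map_mul (germK f U), map_mul (germK f U), map_pow, hψ, hφ U hU]
    · have := hsub U hU
      exact Subsingleton.elim _ _
  have hone (U : X.Opens) : φ U 1 = 1 := by
    by_cases hU : Nonempty U
    · apply germK_injective f U
      rw [hφ U hU, map_one, h1]
    · have := hsub U hU
      exact Subsingleton.elim _ _
  refine ⟨φ, fun U V hUV s => hres U V hUV s, fun U a s => hmul U a s, fun U a => ?_⟩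
  have h2 (b : Sections f U) : φ U (b ^ p) = b := by simpa [hone] using hmul U b 1
  exact h2 a

theorem IsFrobeniusSplit.exists_sections (h : IsFrobeniusSplit f p) :
    ∃ φ : ∀ U : X.Opens, Sections f U →+ Sections f U,
      (∀ (U V : X.Opens) (hUV : U ≤ V) (s : Sections f V),
        φ U (resSections f hUV s) = resSections f hUV (φ V s)) ∧
      (∀ (U : X.Opens) (a s : Sections f U), φ U (a ^ p * s) = a * φ U s) ∧
      ∀ U : X.Opens, φ U 1 = 1 := by
  obtain ⟨φ, h1, h2, h3⟩ := h
  refine ⟨φ, h1, h2, fun U => ?_⟩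
  have h4 := h3 U 1
  rw [map_one] at h4
  exact h4

variable [Smooth f] [PerfectField k]

section Cartier

variable {p}

theorem isCartierImage_iff {i : ℕ} {ω η : globalForms f i} :
    IsCartierImage p ω η ↔ ∀ V, Cart p (η.1 V) (ω.1 V) := Iff.rfl

theorem IsCartierImage.unique {i : ℕ} {ω η η' : globalForms f i} (h : IsCartierImage p ω η)
    (h' : IsCartierImage p ω η') : η = η' := by
  refine Subtype.ext (funext fun V => ?_)
  by_cases hV : Nonempty V.1
  · have := smooth_sections (f := f) V.2
    exact cart_unique_of_smooth (isCartierImage_iff.1 h V) (isCartierImage_iff.1 h' V)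
  · have := subsingleton_forms (f := f) hV
    exact Subsingleton.elim _ _

variable (p) in
-- Uniqueness of the Cartier image on each affine open makes the local images compatible.
theorem IsClosedForm.exists_isCartierImage {i : ℕ} {ω : globalForms f i} (h : IsClosedForm ω) :
    ∃ η, IsCartierImage p ω η := by
  have h1 (V : X.affineOpens) : ∃ η ∈ ⋀[Sections f V.1]^i Ω[Sections f V.1⁄k],
      Cart p η (ω.1 V) := by
    by_cases hV : Nonempty V.1
    · have := smooth_sections (f := f) V.2
      exact exists_cart_mem_of_smooth (h V) (ω.2.1 V)
    · have := subsingleton_forms (f := f) hV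
      refine ⟨0, Submodule.zero_mem _, ?_⟩
      rw [Subsingleton.elim (ω.1 V) 0]
      exact .zero
  choose η hη hη' using h1
  refine ⟨⟨η, hη, fun V W hVW => ?_⟩, hη'⟩
  by_cases hV : Nonempty V.1
  · have := smooth_sections (f := f) V.2
    refine cart_unique_of_smooth (p := p) ?_ (hη' V)
    rw [← ω.2.2 V W hVW]
    exact (hη' W).pull _
  · have := subsingleton_forms (f := f) hV
    exact Subsingleton.elim _ _

end Cartier

/-- The `2`-form `ω` identifies vector fields with `1`-forms on all coordinate neighbourhoods. -/
def IsSymplecticForm (ω : globalForms f 2) : Prop :=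
  ∀ V : X.affineOpens, Nonempty V.1 → Nonempty (Coords k (Sections f V.1) p (dimK f)) →
    ∀ m, ∃ θ : Dual (Sections f V.1) Ω[Sections f V.1⁄k],
      contr θ (ω.1 V) = ExteriorAlgebra.ι (Sections f V.1) m

variable {p}

theorem IsSymplecticForm.smul {ω : globalForms f 2} (h : IsSymplecticForm p ω) {c : k}
    (hc : c ≠ 0) : IsSymplecticForm p (c • ω) := by
  intro V hV C m
  obtain ⟨θ, hθ⟩ := h V hV C (algebraMap k (Sections f V.1) c⁻¹ • m)
  refine ⟨θ, ?_⟩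
  have h1 : (c • ω).1 V = algebraMap k (Sections f V.1) c • ω.1 V := by
    rw [algebraMap_smul]; rfl
  rw [h1, map_smul, hθ, map_smul, smul_smul, ← map_mul, mul_inv_cancel₀ hc, map_one, one_smul]

theorem exists_chart (p : ℕ) [hp : Fact p.Prime] [CharP k p] {U : X.Opens} {x : X} (hx : x ∈ U) :
    ∃ (V : X.affineOpens) (_ : Nonempty V.1), x ∈ V.1 ∧ V.1 ≤ U ∧
      Nonempty (Coords k (Sections f V.1) p (dimK f)) := by
  obtain ⟨V, hV, hx, hle, hC⟩ := exists_coords f p hx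
  exact ⟨⟨V, hV⟩, ⟨⟨x, hx⟩⟩, hx, hle, hC⟩

variable (f p) in
theorem nonempty_coords_funField : Nonempty (Coords k (FunField f) p (dimK f)) := by
  obtain ⟨x⟩ : Nonempty X := inferInstance
  obtain ⟨V, _, -, -, ⟨C⟩⟩ := exists_chart (f := f) p (U := ⊤) (x := x) trivial
  exact ⟨Coords.toFunField V.2 C⟩

/-- The top degree part of the exponential of a `2`-form at the generic point. -/
theorem exists_genericVolume (C : Coords k (FunField f) p (dimK f)) (ω : globalForms f 2) :
    ∃ μ : DiffForms k (FunField f), μ ∈ ⋀[FunField f]^(dimK f) Ω[FunField f⁄k] ∧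
      (∃ E, IsExp (genericForm ω) E ∧ μ = pr (dimK f) E) ∧
      ∀ (V : X.affineOpens) [Nonempty V.1] (E : DiffForms k (Sections f V.1)),
        IsExp (ω.1 V) E → formK f V.1 (pr (dimK f) E) = μ := by
  obtain ⟨E, hE⟩ := IsExp.exists (genericForm_mem ω)
  refine ⟨pr (dimK f) E, pr_mem _ _, ⟨E, hE, rfl⟩, fun V _ E' hE' => ?_⟩
  have h1 := pullForms_isExp (germK f V.1) hE'
  rw [formK_eq_genericForm] at h1
  rw [formK, pullForms_pr, h1.unique C.basis hE]

/-- Over a field a top degree form is a volume form as soon as it is nonzero, and this is visible on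
one chart. -/
theorem IsSymplecticForm.isVolume {ω : globalForms f 2} (h : IsSymplecticForm p ω)
    {μ : DiffForms k (FunField f)} (hμ : μ ∈ ⋀[FunField f]^(dimK f) Ω[FunField f⁄k])
    (h2 : ∀ (V : X.affineOpens) [Nonempty V.1] (E : DiffForms k (Sections f V.1)),
        IsExp (ω.1 V) E → formK f V.1 (pr (dimK f) E) = μ) : IsVolume (dimK f) μ := by
  obtain ⟨C⟩ := nonempty_coords_funField f p
  refine isVolume_of_ne_zero C hμ ?_
  obtain ⟨x⟩ : Nonempty X := inferInstance
  obtain ⟨V, hV, -, -, ⟨CV⟩⟩ := exists_chart (f := f) p (U := ⊤) (x := x) trivial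
  obtain ⟨E, hE⟩ := IsExp.exists (ω.2.1 V)
  rw [← h2 V E hE]
  intro h0
  refine (CV.isVolume_pr_exp hE (h V hV ⟨CV⟩)).ne_zero CV (formK_injective f V.2 ?_)
  rw [h0, map_zero]

/-- If `C(ω) = η` and both forms are symplectic, then the Cartier operator on forms of top degree
splits the Frobenius. -/
theorem IsCartierImage.isFrobeniusSplit {ω η : globalForms f 2} (h : IsCartierImage p ω η)
    (hω : IsSymplecticForm p ω) (hη : IsSymplecticForm p η) : IsFrobeniusSplit f p := by
  obtain ⟨C⟩ := nonempty_coords_funField f p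
  obtain ⟨μ, hμ, ⟨E, hE, hμE⟩, hμV⟩ := exists_genericVolume C ω
  obtain ⟨ν, hν, ⟨F, hF, hνF⟩, hνV⟩ := exists_genericVolume C η
  have hμ' := hω.isVolume hμ hμV
  have hν' := hη.isVolume hν hνV
  have hu {t t' : FunField f} {y : DiffForms k (FunField f)} (h : Cart p (fn t * ν) y)
      (h' : Cart p (fn t' * ν) y) : t = t' :=
    C.fn_mul_volume_injective hν' (C.cart_unique h h')
  -- The candidate splitting at the generic point is `ψ s = C (s μ) / ν`; uniqueness of this
  -- quotient gives its properties.
  choose ψ hψ using C.exists_cart_volume (p := p) hν' hμ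
  have hgen : Cart p (genericForm η) (genericForm ω) := by
    obtain ⟨x⟩ : Nonempty X := inferInstance
    obtain ⟨V, _, -, -, -⟩ := exists_chart (f := f) p (U := ⊤) (x := x) trivial
    rw [← formK_eq_genericForm η V, ← formK_eq_genericForm ω V]
    exact (isCartierImage_iff.1 h V).pull _
  refine isFrobeniusSplit_of_funField p (AddMonoidHom.mk' ψ fun a b => hu (hψ _) ?_)
    (fun a s => hu (hψ _) ?_) (hu (hψ _) ?_) fun U _ t ht => ?_
  · rw [fn_add, fn_add, add_mul, add_mul]
    exact (hψ a).add (hψ b)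
  · rw [fn_mul, fn_mul, mul_assoc, mul_assoc]
    exact (hψ s).fn_mul a
  -- The value at `1` is the equality `C μ = ν`, the top degree part of `C (exp ω) = exp η`.
  · rw [fn_one, one_mul, one_mul, hμE, hνF]
    exact (C.cart_exp hgen (genericForm_mem ω) hF hE).pr _
  · refine isRegularOn_of_local f fun x hx => ?_
    obtain ⟨V, hV, hxV, hVU, ⟨CV⟩⟩ := exists_chart (f := f) p hx
    refine ⟨V.1, hV, hxV, hVU, ?_⟩
    obtain ⟨s, rfl⟩ := isRegularOn_of_le f hVU ht
    obtain ⟨EV, hEV⟩ := IsExp.exists (ω.2.1 V)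
    obtain ⟨FV, hFV⟩ := IsExp.exists (η.2.1 V)
    -- On a chart, `exp η` has a top degree part without zeros, so the quotient `C (s μ) / ν` is
    -- already regular there.
    obtain ⟨t, ht⟩ := CV.exists_cart_volume (p := p)
      (CV.isVolume_pr_exp hFV (hη V hV ⟨CV⟩)) (pr_mem _ EV) s
    have h1 := ht.pull (germK f V.1)
    rw [map_mul, map_mul, hμV V EV hEV, hνV V FV hFV, formK_fn, formK_fn] at h1
    exact ⟨t, hu h1 (hψ _)⟩

theorem dimK_ne_zero (C : Coords k (FunField f) p (dimK f)) {ω : globalForms f 2} (hω : ω ≠ 0) :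
    dimK f ≠ 0 := by
  intro h
  exact genericForm_ne_zero hω
    (eq_zero_of_card_lt C.basis (by rw [Fintype.card_fin, h]; exact two_pos) (genericForm_mem ω))

/-- For `a = n / s` take `b = s`: then `a s ^ p = n s ^ (p - 1)`. -/
theorem exists_mul_pow_mem_range (V : X.affineOpens) [Nonempty V.1] (a : FunField f) :
    ∃ b : FunField f, b ≠ 0 ∧ a * b ^ p ∈ Set.range (germK f V.1) := by
  let := (germK f V.1).toRingHom.toAlgebra
  have := isFractionRing_germK f V.2
  obtain ⟨n, s, hs, rfl⟩ := IsFractionRing.div_surjective (A := Sections f V.1) a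
  have hs' : algebraMap (Sections f V.1) (FunField f) s ≠ 0 :=
    IsFractionRing.to_map_ne_zero_of_mem_nonZeroDivisors hs
  refine ⟨algebraMap (Sections f V.1) (FunField f) s, hs', n * s ^ (p - 1), ?_⟩
  obtain ⟨m, hm⟩ : ∃ m, p = m + 1 := ⟨p - 1, (Nat.succ_pred hp.out.ne_zero).symm⟩
  rw [map_mul, map_pow]
  change algebraMap (Sections f V.1) (FunField f) n *
    algebraMap (Sections f V.1) (FunField f) s ^ (p - 1) = _
  rw [hm, Nat.add_sub_cancel, pow_succ]
  field_simp

/-- If the Frobenius splits and all `2`-forms are multiples of the symplectic form `ω`, then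
`C(ω) ≠ 0`. -/
theorem IsFrobeniusSplit.not_isCartierImage_zero (hsplit : IsFrobeniusSplit f p)
    {ω : globalForms f 2} (h0 : ω ≠ 0) (hω : IsSymplecticForm p ω)
    (hspan : ∀ η : globalForms f 2, ∃ c : k, η = c • ω) : ¬ IsCartierImage p ω 0 := by
  intro hC
  obtain ⟨φ, hres, hmul, hone⟩ := hsplit.exists_sections
  obtain ⟨C⟩ := nonempty_coords_funField f p
  obtain ⟨μ, hμ, -, hμV⟩ := exists_genericVolume C ω
  have hμ' := hω.isVolume hμ hμV
  -- Locally the splitting is `s ↦ C (g s μ) / μ`.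
  have hg (V : X.affineOpens) [Nonempty V.1]
      (hV : Nonempty (Coords k (Sections f V.1) p (dimK f))) : ∃ g : Sections f V.1, ∀ s,
        Cart p (fn (germK f V.1 (φ V.1 s)) * μ) (fn (germK f V.1 g * germK f V.1 s) * μ) := by
    obtain ⟨CV⟩ := hV
    obtain ⟨E, hE⟩ := IsExp.exists (ω.2.1 V)
    obtain ⟨g, hg⟩ := CV.exists_dual (p := p) (CV.isVolume_pr_exp hE (hω V ‹_› ⟨CV⟩)) (φ V.1)
      (hmul V.1)
    refine ⟨g, fun s => ?_⟩
    have h1 := (hg s).pull (germK f V.1)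
    rwa [map_mul, map_mul, hμV V E hE, formK_fn, formK_fn, map_mul] at h1
  obtain ⟨x⟩ : Nonempty X := inferInstance
  obtain ⟨V, hV, -, -, ⟨CV⟩⟩ := exists_chart (f := f) p (U := ⊤) (x := x) trivial
  obtain ⟨g, hgV⟩ := hg V ⟨CV⟩
  -- The multipliers on `U` and `W` both describe the splitting on functions restricted from `W`,
  -- which are enough to determine a multiplier.
  have hle {U W : X.affineOpens} [Nonempty U.1] [Nonempty W.1] (hUW : U.1 ≤ W.1)
      {a : Sections f U.1} {b : Sections f W.1}
      (ha : ∀ s, Cart p (fn (germK f U.1 (φ U.1 s)) * μ) (fn (germK f U.1 a * germK f U.1 s) * μ))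
      (hb : ∀ s, Cart p (fn (germK f W.1 (φ W.1 s)) * μ)
        (fn (germK f W.1 b * germK f W.1 s) * μ)) : germK f W.1 b = germK f U.1 a := by
    rw [← sub_eq_zero]
    refine C.eq_zero_of_cart_zero hμ' (exists_mul_pow_mem_range W) ?_
    rintro _ ⟨s, rfl⟩
    have h1 := ha (resSections f hUW s)
    rw [hres, germK_res, germK_res] at h1
    have h2 := (hb s).sub h1
    rwa [sub_self, ← sub_mul, ← fn_sub, ← sub_mul] at h2
  have hindep (W : X.affineOpens) [Nonempty W.1] (g' : Sections f W.1) (h' : ∀ s,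
      Cart p (fn (germK f W.1 (φ W.1 s)) * μ) (fn (germK f W.1 g' * germK f W.1 s) * μ)) :
      germK f W.1 g' = germK f V.1 g := by
    obtain ⟨y, hy⟩ := nonempty_inf W.1 V.1
    obtain ⟨U, hU, -, hUWV, hCU⟩ := exists_chart (f := f) p hy
    obtain ⟨a, ha⟩ := hg U hCU
    rw [hle (hUWV.trans inf_le_left) ha h', hle (hUWV.trans inf_le_right) ha hgV]
  -- The multipliers agree on all charts, so `g ω` is regular everywhere. One-dimensionality of the
  -- space of `2`-forms then makes `g` a constant `c`.
  obtain ⟨η, hη⟩ := exists_globalForm (i := 2) (f := f)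
    (ξ := fn (germK f V.1 g) * genericForm ω) (fn_mul_mem _ (genericForm_mem ω)) fun y => by
      obtain ⟨W, hW, hy, -, hCW⟩ := exists_chart (f := f) p (U := ⊤) (x := y) trivial
      obtain ⟨g', hg'⟩ := hg W hCW
      refine ⟨W.1, hW, hy, fn g' * ω.1 W, ?_⟩
      rw [map_mul, formK_fn, formK_eq_genericForm, hindep W g' hg']
  obtain ⟨c, rfl⟩ := hspan η
  have hgc : germK f V.1 g = algebraMap k (FunField f) c := by
    rw [← sub_eq_zero]
    refine C.eq_zero_of_fn_mul (genericForm_ne_zero h0) ?_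
    rw [fn_sub, sub_mul, ← hη, genericForm_smul, ← algebraMap_smul (FunField f) c,
      Algebra.smul_def, sub_self]
  -- `C ω = 0` gives `C (exp ω) = exp 0 = 1`, which has no part in the positive degree `dimK f`.
  have hexact : Cart p 0 μ := by
    obtain ⟨E, hE⟩ := IsExp.exists (ω.2.1 V)
    have h1 : Cart p (pr (dimK f) 1) (pr (dimK f) E) :=
      (CV.cart_exp (isCartierImage_iff.1 hC V) (ω.2.1 V) .zero hE).pr _
    rw [pr_of_mem_ne one_mem_zero (dimK_ne_zero C h0).symm] at h1
    have h2 := h1.pull (germK f V.1)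
    rwa [map_zero, hμV V E hE] at h2
  obtain ⟨y, hy⟩ := hexact.exact
  -- `d` is `k`-linear, so `c μ` is exact; yet `φ 1 = 1` requires `C (c μ) = μ`.
  have h1 := Cart.of_exact (p := p) (c • y)
  rw [extd_smul, hy] at h1
  have h2 := hgV 1
  rw [hone, map_one, mul_one, hgc, ← Algebra.smul_def (algebraMap k (FunField f) c),
    algebraMap_smul] at h2
  have h3 := C.cart_unique h2 h1
  rw [fn_one, one_mul] at h3
  exact hμ'.ne_zero C h3

/-- The criterion for Frobenius splitting by the Cartier operator. -/
theorem exists_isCartierImage_and_iff {ω : globalForms f 2} (h0 : ω ≠ 0) (hcl : IsClosedForm ω)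
    (hω : IsSymplecticForm p ω) (hspan : ∀ η : globalForms f 2, ∃ c : k, η = c • ω) :
    ∃ η : globalForms f 2, IsCartierImage p ω η ∧
      (∀ η' : globalForms f 2, IsCartierImage p ω η' → η' = η) ∧
      (η ≠ 0 ↔ IsFrobeniusSplit f p) := by
  obtain ⟨η, hη⟩ := hcl.exists_isCartierImage p
  refine ⟨η, hη, fun η' h' => h'.unique hη, fun hne => ?_, ?_⟩
  · obtain ⟨c, rfl⟩ := hspan η
    refine hη.isFrobeniusSplit hω (hω.smul ?_)
    rintro rfl
    exact hne (zero_smul _ _)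
  · rintro hsplit rfl
    exact hsplit.not_isCartierImage_zero h0 hω hspan hη

end Geometry

/-! ### Descent of global `2`-forms from the algebraic closure -/

section BaseChangeGeometry

open AlgebraicGeometry Opposite Module TopologicalSpace

universe u

variable {k k' : Type u} [Field k] [Field k'] [Algebra k k'] {X Y : Scheme.{u}}
  {f : X ⟶ Spec (CommRingCat.of k)} {g : Y ⟶ Spec (CommRingCat.of k')} {π : Y ⟶ X}
  (H : IsPullback π g f (Spec.map (CommRingCat.ofHom (algebraMap k k'))))

include H in
theorem isPushout_structureMap {V : X.Opens} (hV : IsAffineOpen V) :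
    IsPushout (structureMap f V) (CommRingCat.ofHom (algebraMap k k')) (π.app V)
      (structureMap g (π ⁻¹ᵁ V)) := by
  have h0 := (isIso_pushoutSection_iff H (US := ⊤) (UT := ⊤) (UX := V) (UY := π ⁻¹ᵁ V) le_top
    le_top (by simp)).1 (isIso_pushoutSection_of_isAffineOpen H le_top le_top (by simp)
      (isAffineOpen_top _) (isAffineOpen_top _) hV)
  refine IsPushout.of_iso h0 (Scheme.ΓSpecIso (CommRingCat.of k)) (Iso.refl _)
    (Scheme.ΓSpecIso (CommRingCat.of k')) (Iso.refl _) ?_ ?_ ?_ ?_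
  · simp [structureMap, Scheme.Hom.appLE]
  · simp only [Scheme.Hom.appLE]
    exact (congrArg (· ≫ (Scheme.ΓSpecIso (CommRingCat.of k')).hom) (Category.comp_id _)).trans
      (Scheme.ΓSpecIso_naturality (CommRingCat.ofHom (algebraMap k k')))
  · simp [Scheme.Hom.appLE]
  · simp [structureMap, Scheme.Hom.appLE]

variable (f g π) in
/-- Pullback of functions along the base change morphism. -/
def baseHom (V : X.Opens) : Sections f V →+* Sections g (π ⁻¹ᵁ V) := (π.app V).hom

include H in
theorem baseHom_algebraMap {V : X.Opens} (hV : IsAffineOpen V) (r : k) :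
    baseHom f g π V (algebraMap k (Sections f V) r) =
      algebraMap k' (Sections g (π ⁻¹ᵁ V)) (algebraMap k k' r) :=
  congrArg (fun h => h.hom r) (isPushout_structureMap H hV).w

theorem baseHom_res {U V : X.Opens} (h : U ≤ V) (s : Sections f V) :
    baseHom f g π U (resSections f h s) =
      resSections g (π.preimage_mono h) (baseHom f g π V s) :=
  congrArg (fun h => h.hom s) (π.naturality (homOfLE h).op)

include H in
theorem isPushout_sections {V : X.Opens} (hV : IsAffineOpen V) :
    letI := (baseHom f g π V).toAlgebra
    letI := ((algebraMap k' (Sections g (π ⁻¹ᵁ V))).comp (algebraMap k k')).toAlgebra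
    haveI : IsScalarTower k k' (Sections g (π ⁻¹ᵁ V)) := IsScalarTower.of_algebraMap_eq fun _ => rfl
    haveI : IsScalarTower k (Sections f V) (Sections g (π ⁻¹ᵁ V)) :=
      IsScalarTower.of_algebraMap_eq fun r => (baseHom_algebraMap H hV r).symm
    Algebra.IsPushout k k' (Sections f V) (Sections g (π ⁻¹ᵁ V)) := by
  let := (baseHom f g π V).toAlgebra
  let := ((algebraMap k' (Sections g (π ⁻¹ᵁ V))).comp (algebraMap k k')).toAlgebra
  have : IsScalarTower k k' (Sections g (π ⁻¹ᵁ V)) := IsScalarTower.of_algebraMap_eq fun _ => rfl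
  have : IsScalarTower k (Sections f V) (Sections g (π ⁻¹ᵁ V)) :=
    IsScalarTower.of_algebraMap_eq fun r => (baseHom_algebraMap H hV r).symm
  exact CommRingCat.isPushout_iff_isPushout.1 (isPushout_structureMap H hV).flip

include H in
theorem baseHom_injective {V : X.Opens} (hV : IsAffineOpen V) :
    Function.Injective (baseHom f g π V) := by
  let := (baseHom f g π V).toAlgebra
  let := ((algebraMap k' (Sections g (π ⁻¹ᵁ V))).comp (algebraMap k k')).toAlgebra
  have : IsScalarTower k k' (Sections g (π ⁻¹ᵁ V)) := IsScalarTower.of_algebraMap_eq fun _ => rfl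
  have : IsScalarTower k (Sections f V) (Sections g (π ⁻¹ᵁ V)) :=
    IsScalarTower.of_algebraMap_eq fun r => (baseHom_algebraMap H hV r).symm
  have := isPushout_sections H hV
  exact algebraMap_injective_of_isPushout (isPushout_sections H hV)

include H in
theorem isLocalHom_baseHom [Algebra.IsAlgebraic k k'] {V : X.Opens} (hV : IsAffineOpen V) :
    IsLocalHom (baseHom f g π V) := by
  let := (baseHom f g π V).toAlgebra
  let := ((algebraMap k' (Sections g (π ⁻¹ᵁ V))).comp (algebraMap k k')).toAlgebra
  have : IsScalarTower k k' (Sections g (π ⁻¹ᵁ V)) := IsScalarTower.of_algebraMap_eq fun _ => rfl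
  have : IsScalarTower k (Sections f V) (Sections g (π ⁻¹ᵁ V)) :=
    IsScalarTower.of_algebraMap_eq fun r => (baseHom_algebraMap H hV r).symm
  have := isPushout_sections H hV
  exact isLocalHom_of_isPushout (isPushout_sections H hV)

include H in
theorem mem_range_of_baseHom {V : X.Opens} (hV : IsAffineOpen V) {a b : Sections f V} (ha : a ≠ 0)
    {c : k'} (h : baseHom f g π V b = baseHom f g π V a * algebraMap k' _ c) :
    c ∈ Set.range (algebraMap k k') := by
  let := (baseHom f g π V).toAlgebra
  let := ((algebraMap k' (Sections g (π ⁻¹ᵁ V))).comp (algebraMap k k')).toAlgebra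
  have : IsScalarTower k k' (Sections g (π ⁻¹ᵁ V)) := IsScalarTower.of_algebraMap_eq fun _ => rfl
  have : IsScalarTower k (Sections f V) (Sections g (π ⁻¹ᵁ V)) :=
    IsScalarTower.of_algebraMap_eq fun r => (baseHom_algebraMap H hV r).symm
  have := isPushout_sections H hV
  exact mem_range_of_algebraMap_mul_eq ha h

/-- Pullback of forms along the base change morphism. -/
abbrev baseForms {V : X.Opens} (hV : IsAffineOpen V) :
    DiffForms k (Sections f V) →+* DiffForms k' (Sections g (π ⁻¹ᵁ V)) :=
  formMap (algebraMap k k') (baseHom f g π V) (baseHom_algebraMap H hV)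

theorem exists_basis_baseForms {V : X.Opens} (hV : IsAffineOpen V) {p d : ℕ}
    (C : Coords k (Sections f V) p d) :
    ∃ b' : Basis (Fin d) (Sections g (π ⁻¹ᵁ V)) Ω[Sections g (π ⁻¹ᵁ V)⁄k'],
      ∀ i, baseForms H hV (ExteriorAlgebra.ι _ (C.basis i)) = ExteriorAlgebra.ι _ (b' i) := by
  let := (baseHom f g π V).toAlgebra
  let := ((algebraMap k' (Sections g (π ⁻¹ᵁ V))).comp (algebraMap k k')).toAlgebra
  have : IsScalarTower k k' (Sections g (π ⁻¹ᵁ V)) := IsScalarTower.of_algebraMap_eq fun _ => rfl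
  have : IsScalarTower k (Sections f V) (Sections g (π ⁻¹ᵁ V)) :=
    IsScalarTower.of_algebraMap_eq fun r => (baseHom_algebraMap H hV r).symm
  have := isPushout_sections H hV
  obtain ⟨b', hb'⟩ := C.exists_basis (k' := k') (B := Sections g (π ⁻¹ᵁ V))
  refine ⟨b', fun i => ?_⟩
  rw [hb', C.basis_apply]
  exact formMap_dd _ _ _ _

theorem baseForms_injective {V : X.Opens} (hV : IsAffineOpen V) {p d : ℕ}
    (C : Coords k (Sections f V) p d) : Function.Injective (baseForms H hV) := by
  obtain ⟨b', hb'⟩ := exists_basis_baseForms H hV C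
  exact exteriorAlgebra_map_injective (baseHom_injective H hV) C.basis b' _
    (formMap_fn _ _ _) hb'

theorem baseForms_res {U V : X.Opens} (hU : IsAffineOpen U) (hV : IsAffineOpen V) (h : U ≤ V)
    (ω : DiffForms k (Sections f V)) : baseForms H hU (pullForms (resSections f h) ω) =
      pullForms (resSections g (π.preimage_mono h)) (baseForms H hV ω) := by
  have : (baseForms H hU).comp (pullForms (resSections f h)) =
      (pullForms (resSections g (π.preimage_mono h))).comp (baseForms H hV) := by
    refine DiffForms.ringHom_ext (fun a => ?_) fun a => ?_
    · simp only [RingHom.comp_apply, pullForms_fn, formMap_fn, baseHom_res]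
    · simp only [RingHom.comp_apply, pullForms_dd, formMap_dd, baseHom_res]
  exact RingHom.congr_fun this ω

variable [IsIntegral X] [IsIntegral Y]

-- Functions on `V` inject into functions on the preimage, where `1 ≠ 0` must therefore persist.
include H in
theorem nonempty_preimage {V : X.Opens} (hV : IsAffineOpen V) [Nonempty V] :
    Nonempty (π ⁻¹ᵁ V) := by
  by_contra h
  have hb : π ⁻¹ᵁ V = ⊥ := by
    rw [eq_bot_iff]
    exact fun x hx => (h ⟨⟨x, hx⟩⟩).elim
  have : Subsingleton Γ(Y, π ⁻¹ᵁ V) := by rw [hb]; infer_instance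
  have h1 : baseHom f g π V 1 = baseHom f g π V 0 := Subsingleton.elim (α := Γ(Y, π ⁻¹ᵁ V)) _ _
  exact one_ne_zero (baseHom_injective H hV h1)

variable [Smooth f] [Smooth g]

-- The pulled back forms live on preimages of affine opens. They agree at the generic point of `Y`,
-- and these preimages cover `Y`, so they come from one global form.
include H in
theorem exists_baseForm [IsAffineHom π] {i : ℕ} (ω : globalForms f i) :
    ∃ θ : globalForms g i, ∀ (V : X.affineOpens) [Nonempty V.1],
      θ.1 ⟨π ⁻¹ᵁ V.1, V.2.preimage π⟩ = baseForms H V.2 (ω.1 V) := by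
  have hind : ∃ ξ ∈ ⋀[FunField g]^i Ω[FunField g⁄k'], ∀ (V : X.affineOpens) [Nonempty V.1]
      [Nonempty (π ⁻¹ᵁ V.1)], formK g (π ⁻¹ᵁ V.1) (baseForms H V.2 (ω.1 V)) = ξ := by
    obtain ⟨x⟩ : Nonempty X := inferInstance
    obtain ⟨W, hxW, -⟩ := exists_affine_le (U := ⊤) (x := x) trivial
    have : Nonempty W.1 := ⟨⟨x, hxW⟩⟩
    have := nonempty_preimage H W.2
    refine ⟨formK g (π ⁻¹ᵁ W.1) (baseForms H W.2 (ω.1 W)),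
      pullForms_mem _ (formMap_mem _ _ _ (ω.2.1 W)), fun V _ _ => ?_⟩
    obtain ⟨y, hy⟩ := nonempty_inf V.1 W.1
    obtain ⟨V', hyV, hle⟩ := exists_affine_le hy
    have : Nonempty V'.1 := ⟨⟨y, hyV⟩⟩
    have := nonempty_preimage H V'.2
    rw [← formK_res g (π.preimage_mono (hle.trans inf_le_left)),
      ← formK_res g (π.preimage_mono (hle.trans inf_le_right)), 
      ← baseForms_res H V'.2 V.2 (hle.trans inf_le_left),
      ← baseForms_res H V'.2 W.2 (hle.trans inf_le_right), ω.2.2 V' V, ω.2.2 V' W]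
  obtain ⟨ξ, hξ, h⟩ := hind
  obtain ⟨θ, hθ⟩ := exists_globalForm (f := g) hξ fun y => by
    obtain ⟨V, hyV, -⟩ := exists_affine_le (U := ⊤) (x := π y) trivial
    have : Nonempty V.1 := ⟨⟨_, hyV⟩⟩
    have : Nonempty (π ⁻¹ᵁ V.1) := ⟨⟨y, hyV⟩⟩
    exact ⟨π ⁻¹ᵁ V.1, this, hyV, _, h V⟩
  refine ⟨θ, fun V _ => ?_⟩
  have := nonempty_preimage H V.2
  apply formK_injective g (V.2.preimage π)
  rw [h V, ← hθ]
  exact formK_eq_genericForm θ ⟨π ⁻¹ᵁ V.1, V.2.preimage π⟩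

variable {p : ℕ} [hp : Fact p.Prime] [CharP k p] [PerfectField k] [Algebra.IsAlgebraic k k']

include H in
/-- If the forms of degree `2` on the base change form a line that contains a closed nondegenerate
form, then every nonzero form `ω` of degree `2` is symplectic and generates the space of forms. -/
theorem isSymplecticForm_of_baseChange [IsAffineHom π] (hrank : finrank k' (globalForms g 2) = 1)
    {ω' : globalForms g 2} (hcl : IsClosedForm ω') (hn : IsNondegenerateForm ω')
    {ω : globalForms f 2} (h0 : ω ≠ 0) :
    IsClosedForm ω ∧ IsSymplecticForm p ω ∧ ∀ η : globalForms f 2, ∃ c : k, η = c • ω := by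
  obtain ⟨x⟩ : Nonempty X := inferInstance
  obtain ⟨V, hV, -, -, ⟨C⟩⟩ := exists_chart (f := f) p (U := ⊤) (x := x) trivial
  have hne {η : globalForms f 2} (hη : η ≠ 0) : η.1 V ≠ 0 := by
    intro h
    apply genericForm_ne_zero hη
    rw [← formK_eq_genericForm η V, h, map_zero]
  obtain ⟨θ, hθ⟩ := exists_baseForm H ω
  have hθ0 : θ ≠ 0 := by
    rintro rfl
    refine hne h0 (baseForms_injective H V.2 C ?_)
    rw [← hθ V, map_zero]
    rfl
  have hspan := (finrank_eq_one_iff_of_nonzero' θ hθ0).1 hrank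
  obtain ⟨c, rfl⟩ := hspan ω'
  -- The Gram determinant of a nondegenerate form upstairs is a unit, and being a unit descends.
  have hdet (W : X.affineOpens) (_ : Nonempty W.1)
      (CW : Coords k (Sections f W.1) p (dimK f)) {ω₀ : globalForms f 2} {c₀ : k'}
      (h : (c • θ).1 ⟨π ⁻¹ᵁ W.1, W.2.preimage π⟩ = c₀ • baseForms H W.2 (ω₀.1 W)) (m) :
      ∃ θ : Dual (Sections f W.1) Ω[Sections f W.1⁄k],
        contr θ (ω₀.1 W) = ExteriorAlgebra.ι (Sections f W.1) m := by
    obtain ⟨b', hb'⟩ := exists_basis_baseForms H W.2 CW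
    have := isLocalHom_baseHom H W.2
    exact exists_contr_eq_of_isNondegenerate_formMap _ _ _ CW.basis b' hb' (ω₀.2.1 W)
      (hn ⟨π ⁻¹ᵁ W.1, W.2.preimage π⟩) h m
  -- Otherwise the zero form would be nondegenerate, which is impossible in positive dimension.
  have hc : c ≠ 0 := by
    rintro rfl
    obtain ⟨C'⟩ := nonempty_coords_funField f p
    obtain ⟨d, hd⟩ := Nat.exists_eq_succ_of_ne_zero (dimK_ne_zero C' h0)
    have i : Fin (dimK f) := ⟨0, by omega⟩
    obtain ⟨t, ht⟩ := hdet V hV C (ω₀ := 0) (c₀ := 0) (by rw [zero_smul, zero_smul]; rfl) (C.basis i)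
    have h1 : contr t (0 : DiffForms k (Sections f V.1)) =
      ExteriorAlgebra.ι (Sections f V.1) (C.basis i) := ht
    rw [map_zero, eq_comm, ExteriorAlgebra.ι_eq_zero_iff] at h1
    exact C.basis.ne_zero i h1
  have hclV (W : X.affineOpens) (_ : Nonempty W.1)
      (CW : Coords k (Sections f W.1) p (dimK f)) : extd k (Sections f W.1) (ω.1 W) = 0 := by
    apply baseForms_injective H W.2 CW
    rw [formMap_extd, map_zero]
    change extd k' _ (baseForms H W.2 (ω.1 W)) = 0
    rw [← hθ W]
    have h1 : extd k' _ (c • θ.1 ⟨π ⁻¹ᵁ W.1, W.2.preimage π⟩) = 0 :=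
      hcl ⟨π ⁻¹ᵁ W.1, W.2.preimage π⟩
    rw [extd_smul] at h1
    have h2 := congrArg (c⁻¹ • ·) h1
    simpa only [smul_smul, inv_mul_cancel₀ hc, one_smul, smul_zero] using h2
  refine ⟨fun W => ?_, fun W hW CW => hdet W hW CW.some (by rw [← hθ W]; rfl), fun η => ?_⟩
  · by_cases hW : Nonempty W.1
    · apply formK_injective f W.2
      rw [formK, pullForms_extd, map_zero]
      change extd k _ (formK f W.1 (ω.1 W)) = 0
      rw [formK_eq_genericForm, ← formK_eq_genericForm ω V, formK, ← pullForms_extd, hclV V hV C,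
        map_zero]
    · have := subsingleton_forms (f := f) hW
      exact Subsingleton.elim _ _
  · obtain ⟨θ', hθ'⟩ := exists_baseForm H η
    obtain ⟨c', hc'⟩ := hspan θ'
    have h1 : baseForms H V.2 (η.1 V) = c' • baseForms H V.2 (ω.1 V) := by
      rw [← hθ V, ← hθ' V, ← hc']
      rfl
    obtain ⟨b', hb'⟩ := exists_basis_baseForms H V.2 C
    -- A nonzero coefficient of `ω` is compared with that of `η`: their ratio `c'` relates two
    -- functions defined over `k`, so it lies in `k`.
    obtain ⟨s, hs⟩ : ∃ s, C.basis.ExteriorAlgebra.repr (ω.1 V) s ≠ 0 := by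
      by_contra! hcon
      exact hne h0 (C.basis.ExteriorAlgebra.ext_elem fun s => by rw [hcon s]; simp)
    have hr (x : DiffForms k (Sections f V.1)) := exteriorAlgebra_repr_map (baseHom f g π V.1)
      C.basis b' (baseForms H V.2) (formMap_fn _ _ _) hb' x s
    have h2 := congrArg (fun y => b'.ExteriorAlgebra.repr y s) h1
    simp only [hr] at h2
    rw [← algebraMap_smul (Sections g (π ⁻¹ᵁ V.1)) c', map_smul, Finsupp.smul_apply, hr,
      smul_eq_mul, mul_comm] at h2
    obtain ⟨r, rfl⟩ := mem_range_of_baseHom H V.2 hs h2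
    refine ⟨r, genericForm_injective ?_⟩
    rw [genericForm_smul, ← formK_eq_genericForm η V, ← formK_eq_genericForm ω V]
    rw [← formMap_smul] at h1
    rw [baseForms_injective H V.2 C h1]
    exact pullForms_smul _ r _

end BaseChangeGeometry

end SymplecticFrobenius

end

/-! ### The main theorem -/

theorem mainTheorem8 {k : Type*} [Field k] [PerfectField k] (p : ℕ) [Fact p.Prime] [CharP k p]
    {X : AlgebraicGeometry.Scheme} (f : X ⟶ AlgebraicGeometry.Spec (CommRingCat.of k))
    (hX : SymplecticFrobenius.IsIrreducibleSymplectic f)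
    (Ω : SymplecticFrobenius.globalForms f 2) (hΩ : Ω ≠ 0) :
    ∃ η : SymplecticFrobenius.globalForms f 2,
      SymplecticFrobenius.IsCartierImage p Ω η ∧
      (∀ η' : SymplecticFrobenius.globalForms f 2,
        SymplecticFrobenius.IsCartierImage p Ω η' → η' = η) ∧
      (η ≠ 0 ↔ SymplecticFrobenius.IsFrobeniusSplit f p) := by
  have := hX.smooth
  have := hX.geometricallyIntegral
  have : AlgebraicGeometry.IsIntegral X := AlgebraicGeometry.GeometricallyIntegral.isIntegral_of_subsingleton f
  have : AlgebraicGeometry.IsIntegral (Limits.pullback f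
      (AlgebraicGeometry.Spec.map (CommRingCat.ofHom (algebraMap k (AlgebraicClosure k))))) :=
    AlgebraicGeometry.GeometricallyIntegral.isIntegral_of_subsingleton (SymplecticFrobenius.geometricBaseChange f)
  -- The projection to `X` is a base change of a morphism between spectra of fields, hence affine.
  have : AlgebraicGeometry.IsAffineHom (Limits.pullback.fst f
      (AlgebraicGeometry.Spec.map (CommRingCat.ofHom (algebraMap k (AlgebraicClosure k))))) :=
    MorphismProperty.of_isPullback (P := @AlgebraicGeometry.IsAffineHom) (IsPullback.of_hasPullback f
      (AlgebraicGeometry.Spec.map (CommRingCat.ofHom (algebraMap k (AlgebraicClosure k))))).flip inferInstance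
  obtain ⟨ω', hcl, hn⟩ := hX.exists_form
  obtain ⟨h1, h2, h3⟩ := SymplecticFrobenius.isSymplecticForm_of_baseChange (p := p)
    (IsPullback.of_hasPullback f
      (AlgebraicGeometry.Spec.map (CommRingCat.ofHom (algebraMap k (AlgebraicClosure k)))))
    hX.finrank_forms hcl hn hΩ
  exact SymplecticFrobenius.exists_isCartierImage_and_iff hΩ h1 h2 h3
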